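/- **Setting.** Let $n\ge 1$, $t\ge 0$, $d=2^n$. Pauli strings are the tensor products $P\in\{I,X,Y,Z\}^{\otimes n}$; modulo phases they form the group $\mathbb P_n\cong\mathbb F_2^{2n}$. Clifford operators are the unitaries $C$ with $C^\dagger PC\in\{\pm1,\pm i\}\cdot\mathbb P_n$ for every $P\in\mathbb P_n$, and $T=\mathrm{diag}(1,e^{i\pi/4})$. A $t$-doped stabilizer state is $|\psi\rangle=C_tT_{q_t}C_{t-1}\cdots T_{q_1}C_0|0\rangle^{\otimes n}$ with Clifford operators $C_i$ and $T_q$ the gate $T$ on qubit $q$; its density matrix is also written $\psi$. Put $G_\psi=\{P\in\mathbb P_n: P|\psi\rangle=\pm|\psi\rangle\}$, $S_\psi=\{P\in\mathbb P_n:\mathrm{tr}(P\psi)\ne0\}$, and let $\Xi_\psi(P)=\mathrm{tr}^2(P\psi)/d$ be the characteristic distribution. A measurement shot of $P$ returns $\pm1$ with probability $(1\pm\mathrm{tr}(P\psi))/2$, independently of everything else. An *exact description* of $\psi$ consists of * $m=\log_2|G_\psi|$ generators $g_1,\dots,g_m$ of $G_\psi$ and their phases $\phi_j=\pm1$, $g_j|\psi\rangle=\phi_j|\psi\rangle$;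 * Pauli strings $h_1,\dots,h_k$ (the bad generators) such that, with $h_0=I$, $S_\psi$ is the disjoint union of the cosets $h_0G_\psi,h_1G_\psi,\dots,h_kG_\psi$; * the exact values $\mathrm{tr}(h_i\psi)$, $i=1,\dots,k$, each given by integers $a,b$ as $(a+b\sqrt2)/\sqrt2^{\,t}$; and it satisfies $$\psi=\frac1d\sum_{i=0}^k\mathrm{tr}(h_i\psi)\,h_i\prod_{j=1}^m\left(I+\phi_jg_j\right).$$ **Model.** An algorithm is one fixed program, the same for all $n$, $t$ and $\psi$, of a word RAM whose words have $O(n+t)$ bits, so that a Pauli string fits into two words. It gets $n$ and $t$ as input. Besides arithmetic, bitwise, comparison, memory, branching and loop instructions on words, each of which is one computational step (every loop iteration also counts as a step), it may request a sample from $\Xi_\psi$ or a measurement shot of a Pauli string that it has written down; samples and shots are counted separately. **Theorem.** There are such an algorithm and a constant $C$ such that for all $n\ge1$, all $t\ge0$ and every $t$-doped stabilizer state $\psi$ on $n$ qubits, every run on $\psi$ uses at most $C(2^tn+t2^{5t})$ samples from $\Xi_\psi$, at most $C(2^{7t}+2^{4t}n(n+t))$ measurement shots and at most $C\,4^{2t}n^2$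 computational steps, and, except with probability at most $C\,n2^{-n}$, it outputs an exact description of $\psi$. -/

import Mathlib

open scoped Matrix BigOperators

noncomputable section

/-! ## Qubits, Pauli operators, stabilizer groups -/

/-- Computational basis labels of `n` qubits. -/
abbrev Basis (n : ℕ) : Type := Fin n → Fin 2

/-- Operators on `n` qubits, in the computational basis. -/
abbrev Op (n : ℕ) : Type := Matrix (Basis n) (Basis n) ℂ

/-- The Pauli group of `n` qubits modulo phases: a Pauli string is given by its bits
`(x i, z i)`, and addition of bits is multiplication of Pauli strings up to a phase. -/
abbrev Pauli (n : ℕ) : Type := Fin n → ZMod 2 × ZMod 2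

/-- The single-qubit Pauli matrices: `(0,0) ↦ I`, `(1,0) ↦ X`, `(0,1) ↦ Z`, `(1,1) ↦ Y`. -/
def pauliOne (p : ZMod 2 × ZMod 2) : Matrix (Fin 2) (Fin 2) ℂ :=
  if p = (0, 0) then !![1, 0; 0, 1]
  else if p = (1, 0) then !![0, 1; 1, 0]
  else if p = (0, 1) then !![1, 0; 0, -1]
  else !![0, -Complex.I; Complex.I, 0]

/-- The (Hermitian) Pauli string: the tensor product of the single-qubit Pauli matrices. -/
def pauliOp {n : ℕ} (P : Pauli n) : Op n :=
  Matrix.of fun a b => ∏ i, pauliOne (P i) (a i) (b i)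

/-- Pure states of `n` qubits. -/
structure PureState (n : ℕ) where
  vec : Basis n → ℂ
  normalized : ∑ a, ‖vec a‖ ^ 2 = 1

/-- The density matrix of a pure state. -/
def PureState.density {n : ℕ} (ψ : PureState n) : Op n :=
  Matrix.vecMulVec ψ.vec (star ψ.vec)

/-- The expectation value `tr(Pψ)`. It is real, see `PureState.trace_eq`. -/
def PureState.expect {n : ℕ} (ψ : PureState n) (P : Pauli n) : ℝ :=
  (Matrix.trace (pauliOp P * ψ.density)).re

/-- The stabilizer group `G_ψ`: Pauli strings with `Pψ = ±ψ`. -/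
def PureState.stab {n : ℕ} (ψ : PureState n) : Set (Pauli n) :=
  {P | pauliOp P *ᵥ ψ.vec = ψ.vec ∨ pauliOp P *ᵥ ψ.vec = -ψ.vec}

/-- The Pauli support `S_ψ`: Pauli strings with non-zero expectation value. -/
def PureState.supp {n : ℕ} (ψ : PureState n) : Set (Pauli n) :=
  {P | ψ.expect P ≠ 0}

/-! ## Clifford operators, `T`-gates and doped stabilizer states -/

/-- Elements of the Pauli group: Pauli strings multiplied by `1`, `i`, `-1` or `-i`. -/
def IsPauliElement {n : ℕ} (A : Op n) : Prop :=
  ∃ (j : Fin 4) (P : Pauli n), A = (Complex.I ^ (j : ℕ)) • pauliOp P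

/-- Clifford operators: unitaries normalizing the Pauli group. -/
def IsClifford {n : ℕ} (C : Op n) : Prop :=
  C ∈ Matrix.unitaryGroup (Basis n) ℂ ∧ ∀ P : Pauli n, IsPauliElement (Cᴴ * pauliOp P * C)

/-- The gate `T = diag(1, exp(iπ/4))` on qubit `q`. -/
def tGate {n : ℕ} (q : Fin n) : Op n :=
  Matrix.diagonal fun a => if a q = 1 then Complex.exp (Complex.I * Real.pi / 4) else 1

/-- Unitaries made of Clifford operators and exactly `t` `T`-gates, at arbitrary places. -/
inductive IsDopedClifford {n : ℕ} : ℕ → Op n → Prop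
  | clifford (C : Op n) (hC : IsClifford C) : IsDopedClifford 0 C
  | doped (t : ℕ) (U C : Op n) (q : Fin n) (hU : IsDopedClifford t U) (hC : IsClifford C) :
      IsDopedClifford (t + 1) (C * tGate q * U)

/-- `t`-doped stabilizer states `C_t |0⟩^{⊗ n}`. -/
def PureState.IsDoped {n : ℕ} (ψ : PureState n) (t : ℕ) : Prop :=
  ∃ U : Op n, IsDopedClifford t U ∧ ψ.vec = U *ᵥ Pi.single 0 1

/-! ## Facts needed for the two probability distributions -/

theorem pauliOne_conj (p : ZMod 2 × ZMod 2) (a b : Fin 2) :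
    star (pauliOne p a b) = pauliOne p b a := by
  unfold pauliOne
  split_ifs <;> fin_cases a <;> fin_cases b <;> simp

theorem pauliOne_sq (p : ZMod 2 × ZMod 2) (a b : Fin 2) :
    ∑ c, pauliOne p a c * pauliOne p c b = if a = b then 1 else 0 := by
  unfold pauliOne
  split_ifs with h1 h2 h3 h4 <;> fin_cases a <;> fin_cases b <;> simp_all

theorem pauliOne_swap (a b c d : Fin 2) :
    ∑ p, pauliOne p a b * pauliOne p c d = if a = d ∧ b = c then 2 else 0 := by
  rw [Fintype.sum_prod_type]
  have h2 : ∀ f : ZMod 2 → ℂ, ∑ x, f x = f 0 + f 1 := fun f => Fin.sum_univ_two f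
  have h10 : (1 : ZMod 2) ≠ 0 := by decide
  simp only [h2, pauliOne, Prod.mk.injEq, h10, h10.symm]
  fin_cases a <;> fin_cases b <;> fin_cases c <;> fin_cases d <;> norm_num

theorem pauliOp_conj {n : ℕ} (P : Pauli n) (a b : Basis n) :
    star (pauliOp P a b) = pauliOp P b a := by
  simp only [pauliOp, Matrix.of_apply, star_prod, pauliOne_conj]

theorem pauliOp_sq {n : ℕ} (P : Pauli n) : pauliOp P * pauliOp P = 1 := by
  ext a b
  simp only [Matrix.mul_apply, pauliOp, Matrix.of_apply, ← Finset.prod_mul_distrib]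
  rw [← Fintype.piFinset_univ, ← Finset.prod_univ_sum
    (f := fun i c => pauliOne (P i) (a i) c * pauliOne (P i) c (b i))]
  simp only [pauliOne_sq, Matrix.one_apply, funext_iff]
  by_cases h : ∀ i, a i = b i
  · simp [h]
  · rw [if_neg h]
    obtain ⟨i, hi⟩ := not_forall.mp h
    exact Finset.prod_eq_zero (Finset.mem_univ i) (if_neg hi)

theorem pauliOp_swap {n : ℕ} (a b c d : Basis n) :
    ∑ P : Pauli n, pauliOp P a b * pauliOp P c d = if a = d ∧ b = c then 2 ^ n else 0 := by
  simp only [pauliOp, Matrix.of_apply, ← Finset.prod_mul_distrib]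
  rw [← Fintype.piFinset_univ, ← Finset.prod_univ_sum
    (f := fun i p => pauliOne p (a i) (b i) * pauliOne p (c i) (d i))]
  simp only [pauliOne_swap]
  by_cases h : a = d ∧ b = c
  · simp [h]
  · rw [if_neg h]
    have : ∃ i, ¬ (a i = d i ∧ b i = c i) := by
      by_contra hc
      push Not at hc
      exact h ⟨funext fun i => (hc i).1, funext fun i => (hc i).2⟩
    obtain ⟨i, hi⟩ := this
    exact Finset.prod_eq_zero (Finset.mem_univ i) (if_neg hi)

theorem PureState.trace_eq_sum {n : ℕ} (ψ : PureState n) (P : Pauli n) :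
    Matrix.trace (pauliOp P * ψ.density) =
      ∑ a, ∑ b, pauliOp P a b * (ψ.vec b * star (ψ.vec a)) := by
  simp [Matrix.trace, Matrix.mul_apply, PureState.density, Matrix.vecMulVec_apply]

theorem PureState.trace_eq {n : ℕ} (ψ : PureState n) (P : Pauli n) :
    Matrix.trace (pauliOp P * ψ.density) = (ψ.expect P : ℂ) := by
  have h : star (Matrix.trace (pauliOp P * ψ.density)) =
      Matrix.trace (pauliOp P * ψ.density) := by
    rw [ψ.trace_eq_sum]
    simp only [star_sum, star_mul', star_star, pauliOp_conj]
    rw [Finset.sum_comm]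
    refine Finset.sum_congr rfl fun a _ => Finset.sum_congr rfl fun b _ => ?_
    ring
  exact (Complex.conj_eq_iff_re.mp h).symm

theorem PureState.sum_normalized {n : ℕ} (ψ : PureState n) :
    ∑ a, ψ.vec a * star (ψ.vec a) = 1 := by
  have h := congrArg (fun x : ℝ => (x : ℂ)) ψ.normalized
  simp only [Complex.ofReal_sum, Complex.ofReal_pow, Complex.ofReal_one] at h
  rw [← h]
  refine Finset.sum_congr rfl fun a _ => ?_
  exact Complex.mul_conj' (ψ.vec a)

theorem PureState.sum_expect_sq {n : ℕ} (ψ : PureState n) :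
    ∑ P, ψ.expect P ^ 2 = 2 ^ n := by
  have key : ∑ P, (ψ.expect P : ℂ) ^ 2 = 2 ^ n := by
    have h1 : ∀ P, (ψ.expect P : ℂ) ^ 2 = ∑ a, ∑ b, ∑ c, ∑ d,
        (pauliOp P a b * pauliOp P c d) *
          ((ψ.vec b * star (ψ.vec a)) * (ψ.vec d * star (ψ.vec c))) := by
      intro P
      rw [← ψ.trace_eq, ψ.trace_eq_sum, sq]
      simp only [Finset.sum_mul, Finset.mul_sum]
      refine Finset.sum_congr rfl fun a _ => Finset.sum_congr rfl fun b _ =>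
        Finset.sum_congr rfl fun c _ => Finset.sum_congr rfl fun d _ => ?_
      ring
    simp only [h1]
    rw [Finset.sum_comm]
    have h2 : ∀ a : Basis n, ∑ P : Pauli n, ∑ b, ∑ c, ∑ d,
        (pauliOp P a b * pauliOp P c d) *
          ((ψ.vec b * star (ψ.vec a)) * (ψ.vec d * star (ψ.vec c))) =
        2 ^ n * (ψ.vec a * star (ψ.vec a)) := by
      intro a
      rw [Finset.sum_comm]
      have h3 : ∀ b : Basis n, ∑ P : Pauli n, ∑ c, ∑ d,
          (pauliOp P a b * pauliOp P c d) *
            ((ψ.vec b * star (ψ.vec a)) * (ψ.vec d * star (ψ.vec c))) =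
          2 ^ n * (ψ.vec a * star (ψ.vec a)) * (ψ.vec b * star (ψ.vec b)) := by
        intro b
        rw [Finset.sum_comm]
        rw [Finset.sum_eq_single b]
        · rw [Finset.sum_comm, Finset.sum_eq_single a]
          · rw [← Finset.sum_mul, pauliOp_swap, if_pos ⟨rfl, rfl⟩]
            ring
          · intro d _ hd
            rw [← Finset.sum_mul, pauliOp_swap, if_neg (fun h => hd h.1.symm), zero_mul]
          · simp
        · intro c _ hc
          rw [Finset.sum_comm]
          refine Finset.sum_eq_zero fun d _ => ?_
          rw [← Finset.sum_mul, pauliOp_swap, if_neg (fun h => hc h.2.symm), zero_mul]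
        · simp
      simp only [h3]
      rw [← Finset.mul_sum, ψ.sum_normalized, mul_one]
    simp only [h2]
    rw [← Finset.mul_sum, ψ.sum_normalized, mul_one]
  exact_mod_cast key

theorem PureState.expect_nonneg_aux {n : ℕ} (ψ : PureState n) (P : Pauli n) (s : ℝ)
    (hs : s ^ 2 = 1) : 0 ≤ 1 + s * ψ.expect P := by
  have hx : star ψ.vec ⬝ᵥ ψ.vec = 1 := by
    rw [← ψ.sum_normalized]
    exact Finset.sum_congr rfl fun a _ => mul_comm _ _
  have hH : (pauliOp P)ᴴ = pauliOp P := by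
    ext a b
    rw [Matrix.conjTranspose_apply, pauliOp_conj]
  have he : star ψ.vec ⬝ᵥ (pauliOp P *ᵥ ψ.vec) = (ψ.expect P : ℂ) := by
    rw [← ψ.trace_eq, ψ.trace_eq_sum]
    simp only [dotProduct, Matrix.mulVec, Finset.mul_sum, Pi.star_apply]
    refine Finset.sum_congr rfl fun a _ => Finset.sum_congr rfl fun b _ => ?_
    ring
  have hs1 : star (pauliOp P *ᵥ ψ.vec) = star ψ.vec ᵥ* pauliOp P := by
    rw [Matrix.star_mulVec, hH]
  have hMM : star (pauliOp P *ᵥ ψ.vec) ⬝ᵥ (pauliOp P *ᵥ ψ.vec) = 1 := by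
    rw [hs1, ← Matrix.dotProduct_mulVec, Matrix.mulVec_mulVec, pauliOp_sq, Matrix.one_mulVec, hx]
  have hM1 : star (pauliOp P *ᵥ ψ.vec) ⬝ᵥ ψ.vec = (ψ.expect P : ℂ) := by
    rw [hs1, ← Matrix.dotProduct_mulVec, he]
  have hsC : ((s : ℂ)) ^ 2 = 1 := by exact_mod_cast hs
  have hst : star (s : ℂ) = (s : ℂ) := Complex.conj_ofReal s
  have tot : star (ψ.vec + (s : ℂ) • (pauliOp P *ᵥ ψ.vec)) ⬝ᵥ
      (ψ.vec + (s : ℂ) • (pauliOp P *ᵥ ψ.vec)) = ((2 * (1 + s * ψ.expect P) : ℝ) : ℂ) := by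
    simp only [star_add, star_smul, add_dotProduct, dotProduct_add, smul_dotProduct,
      dotProduct_smul, smul_eq_mul, hx, he, hM1, hMM, hst]
    push_cast
    linear_combination hsC
  have nn : 0 ≤ (star (ψ.vec + (s : ℂ) • (pauliOp P *ᵥ ψ.vec)) ⬝ᵥ
      (ψ.vec + (s : ℂ) • (pauliOp P *ᵥ ψ.vec))).re := by
    simp only [dotProduct, Complex.re_sum, Pi.star_apply]
    refine Finset.sum_nonneg fun a _ => ?_
    set y := (ψ.vec + (s : ℂ) • (pauliOp P *ᵥ ψ.vec)) a
    have : (star y * y).re = y.re * y.re + y.im * y.im := by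
      simp [Complex.mul_re]
    rw [this]
    nlinarith [mul_self_nonneg y.re, mul_self_nonneg y.im]
  rw [tot, Complex.ofReal_re] at nn
  linarith

/-! ## The two kinds of access to the unknown state -/

/-- The characteristic distribution `Ξ_ψ(P) = tr(Pψ)² / 2^n`. -/
def PureState.charDist {n : ℕ} (ψ : PureState n) : PMF (Pauli n) :=
  PMF.ofFintype (fun P => ENNReal.ofReal (ψ.expect P ^ 2 / 2 ^ n)) (by
    rw [← ENNReal.ofReal_sum_of_nonneg (fun P _ => by positivity), ← Finset.sum_div,
      ψ.sum_expect_sq, div_self (by positivity), ENNReal.ofReal_one])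

/-- One measurement shot of the observable `P` on a fresh copy of `ψ`: the outcome is `+1`
(`false`) with probability `(1 + tr(Pψ))/2` and `-1` (`true`) with probability
`(1 - tr(Pψ))/2`. -/
def PureState.shotDist {n : ℕ} (ψ : PureState n) (P : Pauli n) : PMF Bool :=
  PMF.ofFintype
    (fun b => ENNReal.ofReal ((1 + (if b then (-1 : ℝ) else 1) * ψ.expect P) / 2)) (by
    have h0 := ψ.expect_nonneg_aux P 1 (by norm_num)
    have h1 := ψ.expect_nonneg_aux P (-1) (by norm_num)
    rw [Fintype.sum_bool, ← ENNReal.ofReal_add (by simpa using by linarith)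
      (by simpa using by linarith), ← ENNReal.ofReal_one]
    congr 1
    simp only [if_true, Bool.false_eq_true, if_false]
    ring)

/-! ## The machine model: a word RAM with access to the unknown state

Words are natural numbers below `2 ^ w`. A program is a finite piece of code over finitely many
registers and arrays of words; every result is reduced modulo `2 ^ w` when it is written. -/

/-- The unit-cost word operations. -/
inductive WordOp
  | add | sub | mul | div | and | or | xor | shl | shr | lt | eq

/-- `sub` is truncated at zero, `lt` and `eq` return `1` for true and `0` for false. -/
def WordOp.eval : WordOp → ℕ → ℕ → ℕ
  | .add, a, b => a + b
  | .sub, a, b => a - b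
  | .mul, a, b => a * b
  | .div, a, b => a / b
  | .and, a, b => a &&& b
  | .or, a, b => a ||| b
  | .xor, a, b => a ^^^ b
  | .shl, a, b => a <<< b
  | .shr, a, b => a >>> b
  | .lt, a, b => if a < b then 1 else 0
  | .eq, a, b => if a = b then 1 else 0

/-- Programs. Registers and arrays are named by natural numbers. -/
inductive Prog
  /-- `r := c` -/
  | const (r c : ℕ)
  /-- `r := a op b` -/
  | op (o : WordOp) (r a b : ℕ)
  /-- `r := A[a]`, with the index in register `a` -/
  | load (r A a : ℕ)
  /-- `A[a] := b`, with the index in register `a` -/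
  | store (A a b : ℕ)
  /-- draw `P` from the characteristic distribution; `rx`, `rz` := bits of `P` -/
  | sample (rx rz : ℕ)
  /-- measure the Pauli string with bits in `rx`, `rz`; `r := 0` for outcome `+1`, `1` for `-1` -/
  | measure (r rx rz : ℕ)
  | seq (p q : Prog)
  /-- `if r ≠ 0 then p else q` -/
  | ite (r : ℕ) (p q : Prog)
  /-- repeat `p` as many times as register `r` says on entry -/
  | loop (r : ℕ) (p : Prog)

/-- Machine states, with counters for the classical steps, the `Ξ`-samples and the measurement
shots used so far; programs cannot read the counters. -/
structure RAM where
  reg : ℕ → ℕ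
  arr : ℕ → ℕ → ℕ
  steps : ℕ
  samples : ℕ
  shots : ℕ

namespace RAM

def tick (s : RAM) : RAM := { s with steps := s.steps + 1 }

def setReg (w : ℕ) (s : RAM) (r v : ℕ) : RAM :=
  { s with reg := Function.update s.reg r (v % 2 ^ w) }

def setArr (w : ℕ) (s : RAM) (A a v : ℕ) : RAM :=
  { s with arr := Function.update s.arr A (Function.update (s.arr A) a (v % 2 ^ w)) }

/-- Registers `0` and `1` hold the inputs `n` and `t`; everything else is zero. -/
def init (n t : ℕ) : RAM where
  reg := fun r => if r = 0 then n else if r = 1 then t else 0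
  arr := fun _ _ => 0
  steps := 0
  samples := 0
  shots := 0

end RAM

/-- The Pauli string whose bits are the `n` lowest bits of the words `x` and `z`. -/
def decodePauli (n x z : ℕ) : Pauli n :=
  fun i => (if x.testBit i then 1 else 0, if z.testBit i then 1 else 0)

/-- The word whose `i`-th bit is `b i`. -/
def encodeBits {n : ℕ} (b : Fin n → ZMod 2) : ℕ := ∑ i, (b i).val * 2 ^ (i : ℕ)

/-- The distribution of the final machine state when a program is run with words of `w` bits and
with access to samples from `ψ.charDist` and to measurement shots on copies of `ψ`. Each
operation, memory access, branch and loop iteration is one classical step; samples and shots are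
counted separately. -/
def Prog.run {n : ℕ} (w : ℕ) (ψ : PureState n) : Prog → RAM → PMF RAM
  | .const r c, s => PMF.pure (s.tick.setReg w r c)
  | .op o r a b, s => PMF.pure (s.tick.setReg w r (o.eval (s.reg a) (s.reg b)))
  | .load r A a, s => PMF.pure (s.tick.setReg w r (s.arr A (s.reg a)))
  | .store A a b, s => PMF.pure (s.tick.setArr w A (s.reg a) (s.reg b))
  | .sample rx rz, s => ψ.charDist.map fun P =>
      { (s.setReg w rx (encodeBits fun i => (P i).1)).setReg w rz
          (encodeBits fun i => (P i).2) with samples := s.samples + 1 }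
  | .measure r rx rz, s => (ψ.shotDist (decodePauli n (s.reg rx) (s.reg rz))).map fun b =>
      { s.setReg w r (if b then 1 else 0) with shots := s.shots + 1 }
  | .seq p q, s => (p.run w ψ s).bind fun s' => q.run w ψ s'
  | .ite r p q, s => if s.reg r ≠ 0 then p.run w ψ s.tick else q.run w ψ s.tick
  | .loop r p, s =>
      (fun μ : PMF RAM => μ.bind fun s' => p.run w ψ s'.tick)^[s.reg r] (PMF.pure s.tick)

/-! ## The learned description -/

/-- Generators `g` with phases `φ`, and bad generators `h` with expectation values `e`. -/
structure Description (n : ℕ) where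
  m : ℕ
  g : Fin m → Pauli n
  φ : Fin m → ℝ
  k : ℕ
  h : Fin k → Pauli n
  e : Fin k → ℝ

/-- How the description is read off the final machine state: register `0` holds `m`, register
`1` holds `k`; arrays `0`, `1`, `2` hold the bits and the phases (`0` for `+1`) of the `g j`;
arrays `3`, `4` hold the bits of the `h i`, and arrays `5` to `8` hold, in the exact form
`(a + b √2) / √2 ^ t` with integers `a = a₅ - a₆` and `b = b₇ - b₈`, their expectation values. -/
def RAM.output (n t : ℕ) (s : RAM) : Description n where
  m := s.reg 0
  g := fun j => decodePauli n (s.arr 0 j) (s.arr 1 j)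
  φ := fun j => if s.arr 2 j = 0 then 1 else -1
  k := s.reg 1
  h := fun i => decodePauli n (s.arr 3 i) (s.arr 4 i)
  e := fun i => (((s.arr 5 i : ℝ) - s.arr 6 i) + ((s.arr 7 i : ℝ) - s.arr 8 i) * √2) / √2 ^ t

namespace Description

variable {n : ℕ}

/-- The coset representatives `h_0 = 1, h_1, …, h_k`. -/
def rep (D : Description n) : Fin (D.k + 1) → Pauli n := Fin.cons 0 D.h

/-- The values `1, e_1, …, e_k`. -/
def val (D : Description n) : Fin (D.k + 1) → ℝ := Fin.cons 1 D.e

/-- The operator `2^{-n} ∑_{i=0}^k e_i h_i ∏_{j=1}^m (1 + φ_j g_j)` that `D` describes. -/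
def toOp (D : Description n) : Op n :=
  ((2 : ℂ) ^ n)⁻¹ • ∑ i, (D.val i : ℂ) •
    (pauliOp (D.rep i) * (List.ofFn fun j => 1 + (D.φ j : ℂ) • pauliOp (D.g j)).prod)

/-- `D` is the exact description of `ψ`: the `g j` are `m = log₂ |G_ψ|` generators of the
stabilizer group and the `φ j` their phases; the support of `ψ` is the disjoint union of the
cosets `h_i G_ψ`, `i = 0, …, k`; the `e i` are the expectation values of the bad generators;
and `D` reproduces the density matrix of `ψ`. -/
structure IsExact (D : Description n) (ψ : PureState n) : Prop where
  generates : (AddSubgroup.closure (Set.range D.g) : Set (Pauli n)) = ψ.stab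
  card : 2 ^ D.m = ψ.stab.ncard
  phase : ∀ j, pauliOp (D.g j) *ᵥ ψ.vec = (D.φ j : ℂ) • ψ.vec
  cosets : ψ.supp = ⋃ i, (fun Q => D.rep i + Q) '' ψ.stab
  disjoint : Pairwise fun i j =>
    Disjoint ((fun Q => D.rep i + Q) '' ψ.stab) ((fun Q => D.rep j + Q) '' ψ.stab)
  value : ∀ i, ψ.expect (D.h i) = D.e i
  density : ψ.density = D.toOp

end Description

end

/-! The proof rests on arithmetic of the expectation values, on a Fourier identity for the samples,
and on an algorithm whose loop lengths never depend on chance.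

Arithmetic. Conjugation by a `T`-gate sends `X`, `Y` to `(±X ± Y)/√2`, so after `t` such gates every
expectation value lies in `ℤ[√2]/√2^t`. The field automorphism `√2 ↦ -√2` that fixes `i` turns `T`
into `TZ`; hence the conjugates of the expectation values of `ψ` are the expectation values of
another state and have modulus at most `1`. Each `T`-gate halves the stabilizer group at worst, so
`|G_ψ| ≥ 2^(n-t)`. This package is `PureState.IsArithmetic`. Since the norm of a non-zero element of
`ℤ[√2]` is a non-zero integer, differences of possible values cannot be much smaller than `2^{-t}`
(`IsQuad.gap`).

The stabilizer group. A string sampled from `Ξ_ψ` commutes with all of `G_ψ`. The function `tr²(Pψ)`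
is its own symplectic Fourier transform, so a sample commutes with `Q` with probability `(1 +
tr²(Qψ))/2`, and the gap makes this at most `1 - 2^{-t}/4` for `Q ∉ G_ψ`. A union bound over the
`4^n` strings shows that `16·2^t·n` samples have `G_ψ` as their symplectic complement, except with
probability `2^{-n}` (`Learn.sampling_ensures`). Gaussian elimination on words keeps a reduced table
of the samples; its dual table is a basis of `G_ψ`, and one shot per basis element reveals the phase
with certainty.

The bad generators. The support lies in the commutant of `G_ψ` and is a union of cosets of `G_ψ`,
with `|tr(Pψ)|` constant on each coset. The commutant has order `4^n/|G_ψ|`, so there are at most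
`4^t` cosets (`IsStabTable.card_le`). They are listed by doubling, each by its unique representative
that vanishes at the pivots of the dual table. For every non-zero representative, `16384·4^t·n`
shots give accuracy `2^{-t}/32` except with probability `2e^{-4n}`. The value is `(a + b√2)/√2^t`
with `|a|, |b| ≤ √2^t`; all `O(2^t)` pairs are compared with the estimate in integer arithmetic,
with powers of `√2` replaced by Pell approximations, and the gap leaves exactly one pair
(`Approximates.near_iff`). There are at most `4^n` non-zero representatives, so the estimates fail
with probability at most `2·2^{-n}`. `IsStabTable.isExact` turns these data into an exact
description.

Machine. All loop lengths are fixed in registers by the setup, so resource bounds are syntactic and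
hold for every run, also for those where sampling failed (`Prog.used_le`). Correctness is proved in
a semantics without counters (`Prog.map_mem_run`). -/

noncomputable section

/-! ## The Pauli algebra -/

/-- The sign `(-1)^a`. -/
def sgn (a : ZMod 2) : ℝ := if a = 0 then 1 else -1

theorem zmod2_cases (a : ZMod 2) : a = 0 ∨ a = 1 := by
  revert a; decide

theorem sgn_zero : sgn 0 = 1 := by simp [sgn]

theorem sgn_one : sgn 1 = -1 := by simp [sgn]

theorem sgn_add (a b : ZMod 2) : sgn (a + b) = sgn a * sgn b := by
  rcases zmod2_cases a with rfl | rfl <;> rcases zmod2_cases b with rfl | rfl <;>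
    simp [sgn_zero, sgn_one, show (1 + 1 : ZMod 2) = 0 from rfl]

theorem sgn_sum {ι : Type*} (s : Finset ι) (f : ι → ZMod 2) :
    sgn (∑ i ∈ s, f i) = ∏ i ∈ s, sgn (f i) := by
  classical
  induction s using Finset.induction_on with
  | empty => simp [sgn_zero]
  | insert i s hi ih => rw [Finset.sum_insert hi, Finset.prod_insert hi, sgn_add, ih]

/-- The symplectic form that tells whether two Pauli strings commute. -/
def symp {n : ℕ} (P Q : Pauli n) : ZMod 2 := ∑ i, ((P i).1 * (Q i).2 + (P i).2 * (Q i).1)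

theorem symp_add_left {n : ℕ} (P P' Q : Pauli n) : symp (P + P') Q = symp P Q + symp P' Q := by
  simp only [symp, ← Finset.sum_add_distrib, Pi.add_apply, Prod.fst_add, Prod.snd_add]
  exact Finset.sum_congr rfl fun i _ => by ring

theorem symp_comm {n : ℕ} (P Q : Pauli n) : symp P Q = symp Q P := by
  simp only [symp]
  exact Finset.sum_congr rfl fun i _ => by ring

theorem symp_self {n : ℕ} (P : Pauli n) : symp P P = 0 := by
  simp only [symp]
  refine Finset.sum_eq_zero fun i _ => ?_
  rw [mul_comm (P i).2]
  exact CharTwo.add_self_eq_zero _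

theorem pauli_add_self {n : ℕ} (P : Pauli n) : P + P = 0 := by
  funext i
  exact Prod.ext (CharTwo.add_self_eq_zero _) (CharTwo.add_self_eq_zero _)

theorem pauliOne_mul (p q : ZMod 2 × ZMod 2) :
    ∃ c : ℂ, c ^ 4 = 1 ∧ pauliOne p * pauliOne q = c • pauliOne (p + q) := by
  have h10 : (1 : ZMod 2) ≠ 0 := by decide
  have h11 : (1 + 1 : ZMod 2) = 0 := rfl
  have hI : (-Complex.I) ^ 4 = 1 := by rw [neg_pow, Complex.I_pow_four]; norm_num
  have hI' := Complex.I_pow_four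
  obtain ⟨a, b⟩ := p
  obtain ⟨c, d⟩ := q
  rcases zmod2_cases a with rfl | rfl <;> rcases zmod2_cases b with rfl | rfl <;>
    rcases zmod2_cases c with rfl | rfl <;> rcases zmod2_cases d with rfl | rfl <;>
    first
    | (refine ⟨1, by norm_num, ?_⟩; simp [pauliOne, h11]; done)
    | (refine ⟨Complex.I, hI', ?_⟩; simp [pauliOne, h11]; done)
    | (refine ⟨-Complex.I, hI, ?_⟩; simp [pauliOne, h11])

theorem pauliOne_comm (p q : ZMod 2 × ZMod 2) :
    pauliOne p * pauliOne q = ((sgn (p.1 * q.2 + p.2 * q.1) : ℝ) : ℂ) • (pauliOne q * pauliOne p) := by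
  have h11 : (1 + 1 : ZMod 2) = 0 := rfl
  obtain ⟨a, b⟩ := p
  obtain ⟨c, d⟩ := q
  rcases zmod2_cases a with rfl | rfl <;> rcases zmod2_cases b with rfl | rfl <;>
    rcases zmod2_cases c with rfl | rfl <;> rcases zmod2_cases d with rfl | rfl <;>
    simp [pauliOne, sgn_zero, sgn_one, h11]

theorem pauliOp_mul_apply {n : ℕ} (P Q : Pauli n) (a b : Basis n) :
    (pauliOp P * pauliOp Q) a b = ∏ i, (pauliOne (P i) * pauliOne (Q i)) (a i) (b i) := by
  simp only [Matrix.mul_apply, pauliOp, Matrix.of_apply, ← Finset.prod_mul_distrib]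
  rw [← Fintype.piFinset_univ, ← Finset.prod_univ_sum
    (f := fun i c => pauliOne (P i) (a i) c * pauliOne (Q i) c (b i))]

/-- The exact phase is not tracked: a fourth root of unity has modulus `1`, and this is all that
comparisons of absolute values need. -/
theorem pauliOp_mul {n : ℕ} (P Q : Pauli n) :
    ∃ c : ℂ, c ^ 4 = 1 ∧ pauliOp P * pauliOp Q = c • pauliOp (P + Q) := by
  choose c hc h using fun i => pauliOne_mul (P i) (Q i)
  refine ⟨∏ i, c i, by rw [← Finset.prod_pow]; simp [hc], ?_⟩
  ext a b
  rw [pauliOp_mul_apply, Matrix.smul_apply, pauliOp, Matrix.of_apply, smul_eq_mul,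
    ← Finset.prod_mul_distrib]
  exact Finset.prod_congr rfl fun i _ => by rw [h, Matrix.smul_apply, smul_eq_mul, Pi.add_apply]

theorem pauliOp_comm {n : ℕ} (P Q : Pauli n) :
    pauliOp P * pauliOp Q = ((sgn (symp P Q) : ℝ) : ℂ) • (pauliOp Q * pauliOp P) := by
  ext a b
  rw [Matrix.smul_apply, pauliOp_mul_apply, pauliOp_mul_apply, symp, sgn_sum, smul_eq_mul,
    Complex.ofReal_prod, ← Finset.prod_mul_distrib]
  exact Finset.prod_congr rfl fun i _ => by
    rw [pauliOne_comm, Matrix.smul_apply, smul_eq_mul]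

theorem pauliOp_zero {n : ℕ} : pauliOp (0 : Pauli n) = 1 := by
  ext a b
  simp only [pauliOp, Matrix.of_apply, Pi.zero_apply, Matrix.one_apply, funext_iff]
  have h : ∀ i, pauliOne 0 (a i) (b i) = if a i = b i then 1 else 0 := by
    intro i
    rw [pauliOne, if_pos (by rfl)]
    generalize a i = x
    generalize b i = y
    fin_cases x <;> fin_cases y <;> simp
  simp only [h]
  by_cases h' : ∀ i, a i = b i
  · simp [h']
  · rw [if_neg h']
    obtain ⟨i, hi⟩ := not_forall.mp h'
    exact Finset.prod_eq_zero (Finset.mem_univ i) (if_neg hi)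

theorem pauliOp_conjTranspose {n : ℕ} (P : Pauli n) : (pauliOp P)ᴴ = pauliOp P := by
  ext a b
  rw [Matrix.conjTranspose_apply, pauliOp_conj]

theorem pauliOp_mem_unitary {n : ℕ} (P : Pauli n) :
    pauliOp P ∈ Matrix.unitaryGroup (Basis n) ℂ := by
  rw [Matrix.mem_unitaryGroup_iff, Matrix.star_eq_conjTranspose, pauliOp_conjTranspose, pauliOp_sq]

theorem trace_pauliOp {n : ℕ} (P : Pauli n) (hP : P ≠ 0) : Matrix.trace (pauliOp P) = 0 := by
  have h : Matrix.trace (pauliOp P) = ∏ i, Matrix.trace (pauliOne (P i)) := by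
    simp only [Matrix.trace, Matrix.diag, pauliOp, Matrix.of_apply]
    rw [← Fintype.piFinset_univ, ← Finset.prod_univ_sum (f := fun i c => pauliOne (P i) c c)]
  obtain ⟨i, hi⟩ := Function.ne_iff.mp hP
  rw [h]
  refine Finset.prod_eq_zero (Finset.mem_univ i) ?_
  generalize P i = p at hi
  obtain ⟨a, b⟩ := p
  rcases zmod2_cases a with rfl | rfl <;> rcases zmod2_cases b with rfl | rfl <;>
    simp_all [pauliOne, Matrix.trace]

/-- For `P ≠ Q` the product of the two strings is a phase times a traceless string, but under the
hypothesis it is a non-zero multiple of the identity. This serves to show that Clifford operators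
permute the strings. -/
theorem eq_of_pauliOp_eq_smul {n : ℕ} {P Q : Pauli n} {c : ℂ} (h : pauliOp P = c • pauliOp Q) :
    P = Q := by
  have hc : c ≠ 0 := by
    rintro rfl
    have := pauliOp_sq P
    rw [h, zero_smul, zero_mul] at this
    exact zero_ne_one this
  obtain ⟨d, -, hd⟩ := pauliOp_mul P Q
  rw [h, smul_mul_assoc, pauliOp_sq] at hd
  by_contra hne
  have hne' : P + Q ≠ 0 := by
    intro h0
    apply hne
    have := congrArg (· + Q) h0
    simpa [add_assoc, pauli_add_self] using this
  have := congrArg Matrix.trace hd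
  rw [Matrix.trace_smul, Matrix.trace_smul, trace_pauliOp _ hne'] at this
  simp [Matrix.trace, hc] at this

/-! ## Expectation values -/

namespace PureState

variable {n : ℕ} (ψ : PureState n)

theorem star_dotProduct_self : star ψ.vec ⬝ᵥ ψ.vec = 1 := by
  rw [← ψ.sum_normalized]
  exact Finset.sum_congr rfl fun a _ => mul_comm _ _

theorem expect_eq_dotProduct (P : Pauli n) :
    (ψ.expect P : ℂ) = star ψ.vec ⬝ᵥ (pauliOp P *ᵥ ψ.vec) := by
  rw [← ψ.trace_eq, ψ.trace_eq_sum]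
  simp only [dotProduct, Matrix.mulVec, Finset.mul_sum, Pi.star_apply]
  refine Finset.sum_congr rfl fun a _ => Finset.sum_congr rfl fun b _ => ?_
  ring

theorem expect_zero : ψ.expect 0 = 1 := by
  have := ψ.expect_eq_dotProduct 0
  rw [pauliOp_zero, Matrix.one_mulVec, star_dotProduct_self] at this
  exact_mod_cast this

theorem abs_expect_le (P : Pauli n) : |ψ.expect P| ≤ 1 := by
  have h0 := ψ.expect_nonneg_aux P 1 (by norm_num)
  have h1 := ψ.expect_nonneg_aux P (-1) (by norm_num)
  rw [abs_le]
  constructor <;> linarith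

-- The equality case of Cauchy–Schwarz: for a unit vector, `‖Pψ - sψ‖² = 1 - 2s² + s² = 0`.
open scoped ComplexOrder in
theorem eigen_of_expect {P : Pauli n} {s : ℝ} (hs : s ^ 2 = 1) (h : ψ.expect P = s) :
    pauliOp P *ᵥ ψ.vec = (s : ℂ) • ψ.vec := by
  have hs1 : star (pauliOp P *ᵥ ψ.vec) = star ψ.vec ᵥ* pauliOp P := by
    rw [Matrix.star_mulVec, pauliOp_conjTranspose]
  have hx := ψ.star_dotProduct_self
  have he : star ψ.vec ⬝ᵥ (pauliOp P *ᵥ ψ.vec) = (s : ℂ) := by rw [← ψ.expect_eq_dotProduct, h]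
  have hMM : star (pauliOp P *ᵥ ψ.vec) ⬝ᵥ (pauliOp P *ᵥ ψ.vec) = 1 := by
    rw [hs1, ← Matrix.dotProduct_mulVec, Matrix.mulVec_mulVec, pauliOp_sq, Matrix.one_mulVec, hx]
  have hM1 : star (pauliOp P *ᵥ ψ.vec) ⬝ᵥ ψ.vec = (s : ℂ) := by
    rw [hs1, ← Matrix.dotProduct_mulVec, he]
  have hsC : ((s : ℂ)) ^ 2 = 1 := by exact_mod_cast hs
  have hst : star (s : ℂ) = (s : ℂ) := Complex.conj_ofReal s
  have tot : star (pauliOp P *ᵥ ψ.vec - (s : ℂ) • ψ.vec) ⬝ᵥ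
      (pauliOp P *ᵥ ψ.vec - (s : ℂ) • ψ.vec) = 0 := by
    simp only [star_sub, star_smul, sub_dotProduct, dotProduct_sub, smul_dotProduct,
      dotProduct_smul, smul_eq_mul, hx, he, hM1, hMM, hst]
    linear_combination -hsC
  exact sub_eq_zero.mp (dotProduct_star_self_eq_zero.mp tot)

theorem expect_of_eigen {P : Pauli n} {s : ℝ} (h : pauliOp P *ᵥ ψ.vec = (s : ℂ) • ψ.vec) :
    ψ.expect P = s := by
  have := ψ.expect_eq_dotProduct P
  rw [h, dotProduct_smul, star_dotProduct_self, smul_eq_mul, mul_one] at this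
  exact_mod_cast this

theorem mem_stab_iff {P : Pauli n} : P ∈ ψ.stab ↔ ψ.expect P = 1 ∨ ψ.expect P = -1 := by
  constructor
  · rintro (h | h)
    · left; exact ψ.expect_of_eigen (by simpa using h)
    · right; exact ψ.expect_of_eigen (by simpa using h)
  · rintro (h | h)
    · left; simpa using ψ.eigen_of_expect (by norm_num) h
    · right; simpa using ψ.eigen_of_expect (by norm_num) h

theorem mem_stab_iff_sq {P : Pauli n} : P ∈ ψ.stab ↔ ψ.expect P ^ 2 = 1 := by
  rw [mem_stab_iff, sq_eq_one_iff]

theorem eigen_of_mem_stab {P : Pauli n} (hP : P ∈ ψ.stab) :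
    pauliOp P *ᵥ ψ.vec = (ψ.expect P : ℂ) • ψ.vec :=
  ψ.eigen_of_expect (ψ.mem_stab_iff_sq.mp hP) rfl

/-- For a stabilizer `g`, multiplication by `g` changes an expectation value by a phase. -/
theorem expect_mul_stab {g : Pauli n} (hg : g ∈ ψ.stab) (P : Pauli n) {c : ℂ}
    (h : pauliOp P * pauliOp g = c • pauliOp (P + g)) :
    c * ψ.expect (P + g) = ψ.expect g * ψ.expect P := by
  rw [expect_eq_dotProduct _ (P + g), ← smul_eq_mul, ← dotProduct_smul, ← Matrix.smul_mulVec, ← h,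
    ← Matrix.mulVec_mulVec, eigen_of_mem_stab _ hg, Matrix.mulVec_smul, dotProduct_smul,
    ← expect_eq_dotProduct, smul_eq_mul]

/-- Since `gψ = ±ψ`, multiplying by `g` costs only a phase. Hence the support is a union of cosets
of the stabilizer group, and one value per coset is enough. -/
theorem abs_expect_add_stab {g : Pauli n} (hg : g ∈ ψ.stab) (P : Pauli n) :
    |ψ.expect (P + g)| = |ψ.expect P| := by
  obtain ⟨c, hc, h⟩ := pauliOp_mul P g
  have h1 := congrArg norm (ψ.expect_mul_stab hg P h)
  have hc1 : ‖c‖ = 1 := by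
    have := congrArg norm hc
    rw [norm_pow, norm_one] at this
    exact (pow_eq_one_iff_of_nonneg (norm_nonneg c) (by norm_num)).mp this
  have hg1 : |ψ.expect g| = 1 := by
    rcases ψ.mem_stab_iff.mp hg with h | h <;> simp [h]
  rw [norm_mul, norm_mul, hc1, Complex.norm_real, Complex.norm_real, Complex.norm_real,
    Real.norm_eq_abs, Real.norm_eq_abs, Real.norm_eq_abs, hg1, one_mul, one_mul] at h1
  exact h1

/-- The stabilizer group as a subgroup. -/
def stabSubgroup : AddSubgroup (Pauli n) where
  carrier := ψ.stab
  add_mem' := by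
    intro P Q hP hQ
    have h := ψ.abs_expect_add_stab hQ P
    rw [mem_stab_iff_sq, ← sq_abs, h, sq_abs]
    exact ψ.mem_stab_iff_sq.mp hP
  zero_mem' := by
    rw [mem_stab_iff]; exact Or.inl ψ.expect_zero
  neg_mem' := by
    intro P hP
    have : -P = P := neg_eq_of_add_eq_zero_left (pauli_add_self P)
    rwa [this]

/-- A stabilizer commutes with every Pauli string in the support. -/
theorem symp_eq_zero_of_mem {g P : Pauli n} (hg : g ∈ ψ.stab) (hP : ψ.expect P ≠ 0) :
    symp P g = 0 := by
  have hgg := ψ.eigen_of_mem_stab hg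
  have hs1 : star (pauliOp g *ᵥ ψ.vec) = star ψ.vec ᵥ* pauliOp g := by
    rw [Matrix.star_mulVec, pauliOp_conjTranspose]
  -- Letting `g` act on the right vector, or, being Hermitian, on the left one, gives the same
  -- number. If `P` and `g` anticommuted, this non-zero number would be its own negative.
  have h1 : star ψ.vec ⬝ᵥ ((pauliOp P * pauliOp g) *ᵥ ψ.vec) = ψ.expect g * ψ.expect P := by
    rw [← Matrix.mulVec_mulVec, hgg, Matrix.mulVec_smul, dotProduct_smul, smul_eq_mul,
      ← expect_eq_dotProduct]
  have h2 : star ψ.vec ⬝ᵥ ((pauliOp g * pauliOp P) *ᵥ ψ.vec) = ψ.expect g * ψ.expect P := by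
    rw [← Matrix.mulVec_mulVec, Matrix.dotProduct_mulVec, ← hs1, hgg, star_smul, smul_dotProduct,
      smul_eq_mul, ← expect_eq_dotProduct]
    congr 1
    exact Complex.conj_ofReal _
  rw [pauliOp_comm, Matrix.smul_mulVec, dotProduct_smul, h2, smul_eq_mul] at h1
  have hg0 : ψ.expect g ≠ 0 := by
    rcases ψ.mem_stab_iff.mp hg with h | h <;> simp [h]
  rcases zmod2_cases (symp P g) with h | h
  · exact h
  · rw [h, sgn_one] at h1
    exfalso
    have : ψ.expect g * ψ.expect P = 0 := by
      have h3 : (-1 : ℝ) * (ψ.expect g * ψ.expect P) = ψ.expect g * ψ.expect P := by exact_mod_cast h1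
      linarith
    exact (mul_ne_zero hg0 hP) this

theorem stab_subset_supp {g : Pauli n} (hg : g ∈ ψ.stab) : ψ.expect g ≠ 0 := by
  rcases ψ.mem_stab_iff.mp hg with h | h <;> simp [h]

theorem density_apply (a b : Basis n) : ψ.density a b = ψ.vec a * star (ψ.vec b) := rfl

/-- The Pauli expansion of the density matrix. -/
theorem density_eq_sum :
    ψ.density = ((2 : ℂ) ^ n)⁻¹ • ∑ P, (ψ.expect P : ℂ) • pauliOp P := by
  ext c d
  rw [Matrix.smul_apply, Matrix.sum_apply, smul_eq_mul, eq_inv_mul_iff_mul_eq₀ (pow_ne_zero n two_ne_zero)]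
  simp only [Matrix.smul_apply, ← trace_eq, trace_eq_sum, smul_eq_mul, Finset.sum_mul]
  -- By `pauliOp_swap`, the sum of `P ⊗ P` over all strings is `2^n` times the swap operator, so
  -- only the term `a = d`, `b = c` survives.
  rw [Finset.sum_comm, Finset.sum_eq_single d]
  · rw [Finset.sum_comm, Finset.sum_eq_single c]
    · have : ∀ P : Pauli n, pauliOp P d c * (ψ.vec c * star (ψ.vec d)) * pauliOp P c d =
          (pauliOp P d c * pauliOp P c d) * (ψ.vec c * star (ψ.vec d)) := fun P => by ring
      simp only [this, ← Finset.sum_mul]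
      rw [pauliOp_swap, if_pos ⟨rfl, rfl⟩, density_apply]
    · intro b _ hb
      have : ∀ P : Pauli n, pauliOp P d b * (ψ.vec b * star (ψ.vec d)) * pauliOp P c d =
          (pauliOp P d b * pauliOp P c d) * (ψ.vec b * star (ψ.vec d)) := fun P => by ring
      simp only [this, ← Finset.sum_mul]
      rw [pauliOp_swap, if_neg (fun h => hb h.2), zero_mul]
    · simp
  · intro a _ ha
    rw [Finset.sum_comm]
    refine Finset.sum_eq_zero fun b _ => ?_
    have : ∀ P : Pauli n, pauliOp P a b * (ψ.vec b * star (ψ.vec a)) * pauliOp P c d =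
        (pauliOp P a b * pauliOp P c d) * (ψ.vec b * star (ψ.vec a)) := fun P => by ring
    simp only [this, ← Finset.sum_mul]
    rw [pauliOp_swap, if_neg (fun h => ha h.1), zero_mul]
  · simp

/-- The characteristic function is its own symplectic Fourier transform. -/
theorem sum_sgn_expect_sq (Q : Pauli n) :
    ∑ P, sgn (symp P Q) * ψ.expect P ^ 2 = 2 ^ n * ψ.expect Q ^ 2 := by
  have hconj : ∀ P, pauliOp Q * pauliOp P * pauliOp Q = ((sgn (symp P Q) : ℝ) : ℂ) • pauliOp P := by
    intro P
    rw [pauliOp_comm Q P, symp_comm, smul_mul_assoc, mul_assoc, pauliOp_sq, mul_one]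
  -- The trace of `QψQψ` is computed twice: here with `ψQψ = tr(Qψ)ψ`, because `ψ` has rank one; in
  -- `h2` with the Pauli expansion of the first `ψ` and `QPQ = ±P`.
  have h1 : Matrix.trace (pauliOp Q * ψ.density * pauliOp Q * ψ.density) = (ψ.expect Q : ℂ) ^ 2 := by
    have h : ψ.density * pauliOp Q * ψ.density = (ψ.expect Q : ℂ) • ψ.density := by
      rw [density, mul_assoc, Matrix.mul_vecMulVec, Matrix.vecMulVec_mul_vecMulVec,
        ← expect_eq_dotProduct]
      ext a b
      simp [Matrix.vecMulVec_apply]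
      ring
    rw [mul_assoc, mul_assoc, ← mul_assoc ψ.density, h, mul_smul_comm, Matrix.trace_smul, trace_eq,
      smul_eq_mul, sq]
  have h2 : Matrix.trace (pauliOp Q * ψ.density * pauliOp Q * ψ.density) =
      ((2 : ℂ) ^ n)⁻¹ * ∑ P, ((sgn (symp P Q) : ℝ) : ℂ) * (ψ.expect P : ℂ) ^ 2 := by
    nth_rewrite 1 [density_eq_sum]
    rw [Matrix.mul_smul, Matrix.smul_mul, Matrix.smul_mul, Matrix.trace_smul, smul_eq_mul,
      Finset.mul_sum, Finset.sum_mul, Finset.sum_mul, Matrix.trace_sum]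
    congr 1
    refine Finset.sum_congr rfl fun P _ => ?_
    rw [mul_smul_comm, smul_mul_assoc, hconj, smul_mul_assoc, smul_mul_assoc, Matrix.trace_smul,
      Matrix.trace_smul, trace_eq, smul_eq_mul, smul_eq_mul]
    ring
  rw [h1, eq_inv_mul_iff_mul_eq₀ (pow_ne_zero n two_ne_zero)] at h2
  exact_mod_cast h2.symm

/-- The indicator of commutation is `(1 + sgn)/2`, so the Fourier identity applies. After division
by `2^n` this is the probability that a sample fails to show that `Q` is no stabilizer. -/
theorem sum_commuting_expect_sq (Q : Pauli n) :
    ∑ P, (if symp P Q = 0 then ψ.expect P ^ 2 else 0) = 2 ^ n * ((1 + ψ.expect Q ^ 2) / 2) := by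
  have h : ∀ P, (if symp P Q = 0 then ψ.expect P ^ 2 else 0) =
      (ψ.expect P ^ 2 + sgn (symp P Q) * ψ.expect P ^ 2) / 2 := by
    intro P
    rcases zmod2_cases (symp P Q) with h | h <;> simp [h, sgn_zero, sgn_one]
  simp only [h]
  rw [← Finset.sum_div, Finset.sum_add_distrib, sum_expect_sq, sum_sgn_expect_sq]
  ring

end PureState
end

noncomputable section

/-! ## Expectation values of doped stabilizer states -/

namespace PureState

variable {n : ℕ}

/-- The image of a state under a unitary. -/
def apply (ψ : PureState n) (U : Op n) (hU : U ∈ Matrix.unitaryGroup (Basis n) ℂ) :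
    PureState n where
  vec := U *ᵥ ψ.vec
  normalized := by
    have h : star (U *ᵥ ψ.vec) ⬝ᵥ (U *ᵥ ψ.vec) = 1 := by
      rw [Matrix.star_mulVec, ← Matrix.dotProduct_mulVec, Matrix.mulVec_mulVec,
        ← Matrix.star_eq_conjTranspose, Matrix.mem_unitaryGroup_iff'.mp hU, Matrix.one_mulVec,
        star_dotProduct_self]
    have h' : ((∑ a, ‖(U *ᵥ ψ.vec) a‖ ^ 2 : ℝ) : ℂ) = 1 := by
      rw [← h]
      simp only [Complex.ofReal_sum, Complex.ofReal_pow, dotProduct]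
      refine Finset.sum_congr rfl fun a _ => ?_
      rw [← Complex.conj_mul']
      rfl
    exact_mod_cast h'

theorem expect_apply (ψ : PureState n) (U : Op n) (hU : U ∈ Matrix.unitaryGroup (Basis n) ℂ)
    (P : Pauli n) :
    ((ψ.apply U hU).expect P : ℂ) = star ψ.vec ⬝ᵥ ((Uᴴ * pauliOp P * U) *ᵥ ψ.vec) := by
  rw [expect_eq_dotProduct]
  change star (U *ᵥ ψ.vec) ⬝ᵥ (pauliOp P *ᵥ (U *ᵥ ψ.vec)) = _
  rw [Matrix.star_mulVec, ← Matrix.dotProduct_mulVec, Matrix.mulVec_mulVec, Matrix.mulVec_mulVec,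
    mul_assoc]

/-- The state `|0⟩^{⊗ n}`. -/
def zero (n : ℕ) : PureState n where
  vec := Pi.single 0 1
  normalized := by
    rw [Finset.sum_eq_single 0]
    · simp
    · intro b _ hb
      simp [Pi.single_eq_of_ne hb]
    · simp

theorem expect_zero_state (P : Pauli n) :
    (zero n).expect P = if ∀ i, (P i).1 = 0 then 1 else 0 := by
  have h : ((zero n).expect P : ℂ) = pauliOp P 0 0 := by
    rw [expect_eq_dotProduct]
    simp [zero]
  have h1 : ∀ i, pauliOne (P i) 0 0 = if (P i).1 = 0 then 1 else 0 := by
    intro i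
    generalize P i = p
    obtain ⟨a, b⟩ := p
    rcases zmod2_cases a with rfl | rfl <;> rcases zmod2_cases b with rfl | rfl <;> simp [pauliOne]
  have h2 : pauliOp P 0 0 = if ∀ i, (P i).1 = 0 then 1 else 0 := by
    simp only [pauliOp, Matrix.of_apply, Pi.zero_apply, h1]
    by_cases h' : ∀ i, (P i).1 = 0
    · simp [h']
    · rw [if_neg h']
      obtain ⟨i, hi⟩ := not_forall.mp h'
      exact Finset.prod_eq_zero (Finset.mem_univ i) (if_neg hi)
  rw [h2] at h
  split_ifs at h ⊢ <;> exact_mod_cast h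

end PureState

/-- The conjugated string squares to `1`, which leaves only the phases `±1`; invertibility of
conjugation gives injectivity. The sign is kept as an integer so that it can be absorbed into the
coefficients of `ℤ[√2]`. -/
theorem IsClifford.exists_action {n : ℕ} {C : Op n} (hC : IsClifford C) :
    ∃ (s : Pauli n → ℤ) (π : Pauli n → Pauli n), Function.Injective π ∧
      (∀ P, s P = 1 ∨ s P = -1) ∧ ∀ P, Cᴴ * pauliOp P * C = (s P : ℂ) • pauliOp (π P) := by
  obtain ⟨hU, hP⟩ := hC
  have hCC : C * Cᴴ = 1 := Matrix.mem_unitaryGroup_iff.mp hU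
  have hCC' : Cᴴ * C = 1 := Matrix.mem_unitaryGroup_iff'.mp hU
  have key : ∀ P : Pauli n, ∃ (s : ℤ) (Q : Pauli n), (s = 1 ∨ s = -1) ∧
      Cᴴ * pauliOp P * C = (s : ℂ) • pauliOp Q := by
    intro P
    obtain ⟨j, Q, h⟩ := hP P
    have hsq : (Cᴴ * pauliOp P * C) * (Cᴴ * pauliOp P * C) = 1 := by
      rw [show (Cᴴ * pauliOp P * C) * (Cᴴ * pauliOp P * C) =
        Cᴴ * pauliOp P * (C * Cᴴ) * pauliOp P * C by simp only [mul_assoc], hCC, mul_one,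
        mul_assoc Cᴴ, pauliOp_sq, mul_one, hCC']
    rw [h, smul_mul_smul_comm, pauliOp_sq] at hsq
    have h1 := congrFun (congrFun hsq 0) 0
    simp only [Matrix.smul_apply, Matrix.one_apply_eq, smul_eq_mul, mul_one] at h1
    rcases mul_self_eq_one_iff.mp h1 with h2 | h2
    · exact ⟨1, Q, Or.inl rfl, by rw [h, h2]; simp⟩
    · exact ⟨-1, Q, Or.inr rfl, by rw [h, h2]; simp⟩
  choose s π hs h using key
  refine ⟨s, π, ?_, hs, h⟩
  intro P Q hPQ
  have hinv : ∀ P, pauliOp P = (s P : ℂ) • (C * pauliOp (π P) * Cᴴ) := by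
    intro P
    rw [← smul_mul_assoc, ← mul_smul_comm, ← h]
    rw [show C * (Cᴴ * pauliOp P * C) * Cᴴ = (C * Cᴴ) * pauliOp P * (C * Cᴴ) by
      simp only [mul_assoc], hCC, one_mul, mul_one]
  have hss : ∀ P, (s P : ℂ) * s P = 1 := by
    intro P
    rcases hs P with h | h <;> simp [h]
  refine eq_of_pauliOp_eq_smul (c := (s P : ℂ) * s Q) ?_
  rw [hinv P, hinv Q, hPQ, smul_smul, mul_assoc (s P : ℂ), hss, mul_one]

/-- The Pauli string `Z` on qubit `q`. -/
def zAt {n : ℕ} (q : Fin n) : Pauli n := Pi.single q (0, 1)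

theorem symp_zAt {n : ℕ} (P : Pauli n) (q : Fin n) : symp P (zAt q) = (P q).1 := by
  rw [symp, Finset.sum_eq_single q]
  · simp [zAt]
  · intro i _ hi
    simp [zAt, Pi.single_eq_of_ne hi]
  · simp

theorem tGate_mem_unitary {n : ℕ} (q : Fin n) : tGate q ∈ Matrix.unitaryGroup (Basis n) ℂ := by
  rw [Matrix.mem_unitaryGroup_iff, Matrix.star_eq_conjTranspose, tGate,
    Matrix.diagonal_conjTranspose, Matrix.diagonal_mul_diagonal, ← Matrix.diagonal_one]
  congr 1
  funext a
  simp only [Pi.star_apply]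
  split_ifs
  · rw [Complex.star_def, Complex.mul_conj', Complex.norm_exp]
    simp
  · simp

theorem exp_pi_div_four : Complex.exp (Complex.I * Real.pi / 4) = (1 + Complex.I) / (√2 : ℝ) := by
  have h : Complex.I * Real.pi / 4 = ((Real.pi / 4 : ℝ) : ℂ) * Complex.I := by push_cast; ring
  rw [h, Complex.exp_mul_I, ← Complex.ofReal_cos, ← Complex.ofReal_sin, Real.cos_pi_div_four,
    Real.sin_pi_div_four]
  have h2 : ((√2 : ℝ) : ℂ) ≠ 0 := by
    exact_mod_cast (Real.sqrt_pos.mpr (by norm_num : (0:ℝ) < 2)).ne'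
  have h3 : ((√2 : ℝ) : ℂ) * (√2 : ℝ) = 2 := by
    exact_mod_cast Real.mul_self_sqrt (by norm_num : (0:ℝ) ≤ 2)
  field_simp
  push_cast
  linear_combination ((1 + Complex.I) / 2) * h3

/-- Conjugation by a `T`-gate fixes `I`, `Z` and rotates `X`, `Y`. -/
theorem tGate_conj {n : ℕ} (q : Fin n) (P : Pauli n) :
    (tGate q)ᴴ * pauliOp P * tGate q = if (P q).1 = 0 then pauliOp P else
      ((√2 : ℝ) : ℂ)⁻¹ • (pauliOp P + (((if (P q).2 = 0 then -1 else 1 : ℤ)) : ℂ) •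
        pauliOp (P + zAt q)) := by
  have hsplit : ∀ (Q : Pauli n) (a b : Basis n), pauliOp Q a b =
      pauliOne (Q q) (a q) (b q) * ∏ i ∈ Finset.univ.erase q, pauliOne (Q i) (a i) (b i) := by
    intro Q a b
    exact (Finset.mul_prod_erase Finset.univ (fun i => pauliOne (Q i) (a i) (b i))
      (Finset.mem_univ q)).symm
  ext a b
  have hL : ((tGate q)ᴴ * pauliOp P * tGate q) a b =
      star (if a q = 1 then Complex.exp (Complex.I * Real.pi / 4) else 1) * pauliOp P a b *
        (if b q = 1 then Complex.exp (Complex.I * Real.pi / 4) else 1) := by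
    rw [tGate, Matrix.diagonal_conjTranspose, Matrix.mul_diagonal, Matrix.diagonal_mul,
      Pi.star_apply]
  have hrest : ∏ i ∈ Finset.univ.erase q, pauliOne ((P + zAt q) i) (a i) (b i) =
      ∏ i ∈ Finset.univ.erase q, pauliOne (P i) (a i) (b i) := by
    refine Finset.prod_congr rfl fun i hi => ?_
    rw [Pi.add_apply, zAt, Pi.single_eq_of_ne (Finset.ne_of_mem_erase hi), add_zero]
  have hq : (P + zAt q) q = P q + (0, 1) := by simp [zAt]
  have hR : ∀ (c d : ℂ), (c • (pauliOp P + d • pauliOp (P + zAt q))) a b =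
      c * (pauliOp P a b + d * pauliOp (P + zAt q) a b) := by
    intro c d
    simp
  rw [hL]
  have h3 : ((√2 : ℝ) : ℂ) * (√2 : ℝ) = 2 := by
    exact_mod_cast Real.mul_self_sqrt (by norm_num : (0:ℝ) ≤ 2)
  have h2 : ((√2 : ℝ) : ℂ) ≠ 0 := by
    exact_mod_cast (Real.sqrt_pos.mpr (by norm_num : (0:ℝ) < 2)).ne'
  have h11 : (1 + 1 : ZMod 2) = 0 := rfl
  by_cases h1 : (P q).1 = 0
  · rw [if_pos h1, hsplit P]
    generalize ∏ i ∈ Finset.univ.erase q, pauliOne (P i) (a i) (b i) = R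
    generalize P q = p at h1
    generalize a q = x
    generalize b q = y
    obtain ⟨c, d⟩ := p
    simp only at h1
    subst h1
    have hee : (starRingEnd ℂ) (Complex.exp (Complex.I * Real.pi / 4)) *
        Complex.exp (Complex.I * Real.pi / 4) = 1 := by
      rw [Complex.conj_mul', Complex.norm_exp]
      simp
    rcases zmod2_cases d with rfl | rfl <;> fin_cases x <;> fin_cases y <;> simp [pauliOne] <;>
      linear_combination (R) * hee
  · rw [if_neg h1, hR, hsplit P, hsplit (P + zAt q), hrest, hq]
    generalize ∏ i ∈ Finset.univ.erase q, pauliOne (P i) (a i) (b i) = R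
    generalize P q = p at h1
    generalize a q = x
    generalize b q = y
    obtain ⟨c, d⟩ := p
    have hc : c = 1 := (zmod2_cases c).resolve_left h1
    subst hc
    rw [exp_pi_div_four]
    rcases zmod2_cases d with rfl | rfl <;> fin_cases x <;> fin_cases y <;>
      simp [pauliOne, h11] <;> field_simp <;> ring_nf <;> simp

/-- The structure of the expectation values of a state made with `t` `T`-gates: they lie in
`ℤ[√2] / √2 ^ t`, their algebraic conjugates are, up to a common sign, again expectation values
of a state, and the stabilizer group has dimension at least `n - t`. -/
def PureState.IsArithmetic {n : ℕ} (t : ℕ) (ψ : PureState n) : Prop :=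
  (∃ (φ : PureState n) (a b : Pauli n → ℤ), ∀ P,
    ψ.expect P = (a P + b P * √2) / √2 ^ t ∧
    φ.expect P = (-1) ^ t * ((a P - b P * √2) / √2 ^ t)) ∧
  2 ^ n ≤ 2 ^ t * ψ.stab.ncard

/-! ### Induction over the gates of a doped circuit -/

namespace PureState

variable {n : ℕ}

theorem isArithmetic_zero : (zero n).IsArithmetic 0 := by
  refine ⟨⟨zero n, fun P => if ∀ i, (P i).1 = 0 then 1 else 0, fun _ => 0, fun P => ?_⟩, ?_⟩
  · rw [expect_zero_state]
    split_ifs with h <;> simp [h]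
  · have hinj : Function.Injective fun (z : Fin n → ZMod 2) => (fun i => ((0 : ZMod 2), z i)) := by
      intro z z' h
      funext i
      exact congrArg Prod.snd (congrFun h i)
    have hsub : Set.range (fun (z : Fin n → ZMod 2) => (fun i => ((0 : ZMod 2), z i))) ⊆
        (zero n).stab := by
      rintro _ ⟨z, rfl⟩
      rw [mem_stab_iff, expect_zero_state]
      simp
    have := Set.ncard_le_ncard hsub (Set.toFinite _)
    rw [← Set.image_univ, Set.ncard_image_of_injective _ hinj, Set.ncard_univ] at this
    simpa [Nat.card_eq_fintype_card] using this

theorem IsArithmetic.clifford {t : ℕ} {ψ : PureState n} (h : ψ.IsArithmetic t) {C : Op n}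
    (hC : IsClifford C) : (ψ.apply C hC.1).IsArithmetic t := by
  obtain ⟨⟨φ, a, b, hab⟩, hcard⟩ := h
  obtain ⟨s, π, hπ, hs, hact⟩ := hC.exists_action
  have hE : ∀ (χ : PureState n) P, (χ.apply C hC.1).expect P = s P * χ.expect (π P) := by
    intro χ P
    have : ((χ.apply C hC.1).expect P : ℂ) = s P * χ.expect (π P) := by
      rw [expect_apply, hact, Matrix.smul_mulVec, dotProduct_smul, ← expect_eq_dotProduct,
        smul_eq_mul]
    exact_mod_cast this
  refine ⟨⟨φ.apply C hC.1, fun P => s P * a (π P), fun P => s P * b (π P), fun P => ?_⟩, ?_⟩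
  · rw [hE, hE, (hab _).1, (hab _).2]
    push_cast
    constructor <;> ring
  · have hst : (ψ.apply C hC.1).stab = π ⁻¹' ψ.stab := by
      ext P
      rw [mem_stab_iff_sq, Set.mem_preimage, mem_stab_iff_sq, hE]
      rcases hs P with h | h <;> simp [h]
    rw [hst, Set.ncard_preimage_of_injective_subset_range hπ]
    · exact hcard
    · rw [(Finite.injective_iff_surjective.mp hπ).range_eq]
      exact Set.subset_univ _

theorem expect_apply_pauli (ψ : PureState n) (Q P : Pauli n) :
    (ψ.apply (pauliOp Q) (pauliOp_mem_unitary Q)).expect P = sgn (symp P Q) * ψ.expect P := by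
  have : ((ψ.apply (pauliOp Q) (pauliOp_mem_unitary Q)).expect P : ℂ) =
      (sgn (symp P Q) : ℝ) * ψ.expect P := by
    rw [expect_apply, pauliOp_conjTranspose, pauliOp_comm Q P, symp_comm, smul_mul_assoc, mul_assoc,
      pauliOp_sq, mul_one, Matrix.smul_mulVec, dotProduct_smul, ← expect_eq_dotProduct, smul_eq_mul]
  exact_mod_cast this

theorem expect_apply_tGate (ψ : PureState n) (q : Fin n) (P : Pauli n) :
    (ψ.apply (tGate q) (tGate_mem_unitary q)).expect P = if (P q).1 = 0 then ψ.expect P else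
      (ψ.expect P + ((if (P q).2 = 0 then -1 else 1 : ℤ) : ℝ) * ψ.expect (P + zAt q)) / √2 := by
  have : ((ψ.apply (tGate q) (tGate_mem_unitary q)).expect P : ℂ) =
      if (P q).1 = 0 then (ψ.expect P : ℂ) else
      (ψ.expect P + ((if (P q).2 = 0 then -1 else 1 : ℤ) : ℂ) * ψ.expect (P + zAt q)) /
        (√2 : ℝ) := by
    rw [expect_apply, tGate_conj]
    by_cases h : (P q).1 = 0
    · rw [if_pos h, if_pos h, expect_eq_dotProduct]
    · rw [if_neg h, if_neg h, Matrix.smul_mulVec, Matrix.add_mulVec, Matrix.smul_mulVec,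
        dotProduct_smul, dotProduct_add, dotProduct_smul, ← expect_eq_dotProduct,
        ← expect_eq_dotProduct, smul_eq_mul, smul_eq_mul, div_eq_inv_mul]
  by_cases h : (P q).1 = 0
  · rw [if_pos h] at this ⊢
    exact_mod_cast this
  · rw [if_neg h] at this ⊢
    apply Complex.ofReal_injective
    rw [this]
    split_ifs <;> simp

/-- The automorphism `√2 ↦ -√2` fixing `i` maps `e^{iπ/4}` to its negative, hence `T` to `TZ`; so
the conjugate state receives `Z` on qubit `q` before the `T`-gate. That `Z` changes the sign of
exactly the strings with an `x`-bit at `q`, which are those that acquire a denominator `√2`. The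
factor `(-1)^t` in `IsArithmetic` comes from conjugating the denominator `√2^t`. -/
theorem IsArithmetic.tGate {t : ℕ} {ψ : PureState n} (h : ψ.IsArithmetic t) (q : Fin n) :
    (ψ.apply (tGate q) (tGate_mem_unitary q)).IsArithmetic (t + 1) := by
  obtain ⟨⟨φ, a, b, hab⟩, hcard⟩ := h
  have h2 : √2 * √2 = (2 : ℝ) := Real.mul_self_sqrt (by norm_num)
  have h0 : √2 ≠ 0 := by positivity
  let τ : Pauli n → ℤ := fun P => if (P q).2 = 0 then -1 else 1
  refine ⟨⟨(φ.apply (pauliOp (zAt q)) (pauliOp_mem_unitary _)).apply (_root_.tGate q)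
      (tGate_mem_unitary q),
    -- Strings without `x`-bit at `q` keep their value, but the denominator grows by `√2`; the
    -- numerator becomes `(a + b√2)√2 = 2b + a√2`.
    fun P => if (P q).1 = 0 then 2 * b P else a P + τ P * a (P + zAt q),
    fun P => if (P q).1 = 0 then a P else b P + τ P * b (P + zAt q), fun P => ?_⟩, ?_⟩
  · rw [expect_apply_tGate, expect_apply_tGate, expect_apply_pauli, expect_apply_pauli,
      symp_add_left, symp_self, add_zero, symp_zAt]
    by_cases h : (P q).1 = 0
    · simp only [if_pos h]
      rw [(hab P).1, (hab P).2, h, sgn_zero, pow_succ √2, pow_succ (-1 : ℝ)]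
      push_cast
      constructor
      · rw [div_eq_div_iff (by positivity) (by positivity)]
        linear_combination (b P : ℝ) * √2 ^ t * h2
      · field_simp
        linear_combination -(b P : ℝ) * h2
    · simp only [if_neg h]
      rw [(hab P).1, (hab P).2, (hab _).1, (hab _).2, (zmod2_cases _).resolve_left h, sgn_one,
        pow_succ √2, pow_succ (-1 : ℝ)]
      simp only [τ]
      push_cast
      constructor <;> field_simp <;> ring
  -- Stabilizers without `x`-bit at `q` commute with the gate and survive. They form a subgroup of
  -- index at most two, as translation by one stabilizer outside maps its complement into it.
  · have hsub : ψ.stab ∩ {P | (P q).1 = 0} ⊆ (ψ.apply (_root_.tGate q) (tGate_mem_unitary q)).stab := by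
      rintro P ⟨hP, hq⟩
      rw [mem_stab_iff_sq, expect_apply_tGate, if_pos (show (P q).1 = 0 from hq)]
      exact ψ.mem_stab_iff_sq.mp hP
    have hle := Set.ncard_le_ncard hsub (Set.toFinite _)
    have hhalf : (ψ.stab \ {P | (P q).1 = 0}).ncard ≤ (ψ.stab ∩ {P | (P q).1 = 0}).ncard := by
      by_cases hne : (ψ.stab \ {P | (P q).1 = 0}).Nonempty
      · obtain ⟨P₀, hP₀, hq₀⟩ := hne
        refine Set.ncard_le_ncard_of_injOn (fun P => P + P₀) ?_ ?_ (Set.toFinite _)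
        · rintro P ⟨hP, hq⟩
          refine ⟨ψ.stabSubgroup.add_mem hP hP₀, ?_⟩
          have h1 : (P q).1 = 1 := (zmod2_cases _).resolve_left hq
          have h2 : (P₀ q).1 = 1 := (zmod2_cases _).resolve_left hq₀
          simp only [Set.mem_ofPred_eq, Pi.add_apply, Prod.fst_add, h1, h2]
          rfl
        · intro P _ P' _ h
          exact add_right_cancel h
      · rw [Set.not_nonempty_iff_eq_empty.mp hne]
        simp
    have hsum := Set.ncard_inter_add_ncard_sdiff_eq_ncard ψ.stab {P | (P q).1 = 0} (Set.toFinite _)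
    calc 2 ^ n ≤ 2 ^ t * ψ.stab.ncard := hcard
      _ ≤ 2 ^ t * (2 * (ψ.apply (_root_.tGate q) (tGate_mem_unitary q)).stab.ncard) := by
        gcongr
        omega
      _ = _ := by ring

theorem IsArithmetic.congr {t : ℕ} {ψ φ : PureState n} (h : ψ.IsArithmetic t)
    (hv : φ.vec = ψ.vec) : φ.IsArithmetic t := by
  obtain rfl : φ = ψ := by
    cases φ; cases ψ; simp only at hv; subst hv; rfl
  exact h

theorem isArithmetic_of_isDopedClifford {t : ℕ} {U : Op n} (hU : IsDopedClifford t U) :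
    ∃ ψ : PureState n, ψ.vec = U *ᵥ Pi.single 0 1 ∧ ψ.IsArithmetic t := by
  induction hU with
  | clifford C hC => exact ⟨_, rfl, isArithmetic_zero.clifford hC⟩
  | doped t U C q _ hC ih =>
    obtain ⟨ψ, hψ, h⟩ := ih
    refine ⟨_, ?_, (h.tGate q).clifford hC⟩
    change C *ᵥ (_root_.tGate q *ᵥ ψ.vec) = _
    rw [hψ, Matrix.mulVec_mulVec, Matrix.mulVec_mulVec, mul_assoc]

theorem IsDoped.isArithmetic {t : ℕ} {ψ : PureState n} (h : ψ.IsDoped t) : ψ.IsArithmetic t := by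
  obtain ⟨U, hU, hv⟩ := h
  obtain ⟨φ, hφ, h⟩ := isArithmetic_of_isDopedClifford hU
  exact h.congr (by rw [hv, hφ])

end PureState
end

noncomputable section

/-! ## Separation of the possible expectation values -/

/-- `x` lies in `ℤ[√2] / √2 ^ t` and its algebraic conjugate has absolute value at most `M`. -/
def IsQuad (t : ℕ) (M x : ℝ) : Prop :=
  ∃ a b : ℤ, x = (a + b * √2) / √2 ^ t ∧ |(a - b * √2) / √2 ^ t| ≤ M

theorem IsQuad.sub {t : ℕ} {M N x y : ℝ} (hx : IsQuad t M x) (hy : IsQuad t N y) :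
    IsQuad t (M + N) (x - y) := by
  obtain ⟨a, b, rfl, h⟩ := hx
  obtain ⟨c, d, rfl, h'⟩ := hy
  refine ⟨a - c, b - d, by push_cast; ring, ?_⟩
  calc _ = |(a - b * √2) / √2 ^ t - (c - d * √2) / √2 ^ t| := by
        congr 1; push_cast; ring
    _ ≤ |(a - b * √2) / √2 ^ t| + |(c - d * √2) / √2 ^ t| := abs_sub _ _
    _ ≤ M + N := add_le_add h h'

theorem IsQuad.neg {t : ℕ} {M x : ℝ} (hx : IsQuad t M x) : IsQuad t M (-x) := by
  obtain ⟨a, b, rfl, h⟩ := hx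
  refine ⟨-a, -b, by push_cast; ring, ?_⟩
  rw [← abs_neg]
  convert h using 2
  push_cast
  ring

/-- The product of `x` and its conjugate is `(a² - 2b²)/2^t`, where the numerator is an integer,
non-zero because `√2` is irrational. All separation of values, both for finding stabilizers and for
recognizing expectation values, comes from here. -/
theorem IsQuad.gap {t : ℕ} {M x : ℝ} (hx : IsQuad t M x) (h0 : x ≠ 0) :
    (2 : ℝ)⁻¹ ^ t ≤ M * |x| := by
  obtain ⟨a, b, rfl, h⟩ := hx
  have h2 : √2 * √2 = (2 : ℝ) := Real.mul_self_sqrt (by norm_num)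
  have hint : a ^ 2 - 2 * b ^ 2 ≠ 0 := by
    intro h'
    have h'' : ((a : ℝ) + b * √2) * (a - b * √2) = 0 := by
      have : (a : ℝ) ^ 2 - 2 * b ^ 2 = 0 := by exact_mod_cast h'
      linear_combination this - (b : ℝ) ^ 2 * h2
    rcases mul_eq_zero.mp h'' with h1 | h1
    · exact h0 (by rw [h1, zero_div])
    · by_cases hb : b = 0
      · subst hb
        simp only [Int.cast_zero, zero_mul, sub_zero] at h1
        exact h0 (by simp [h1])
      · refine irrational_sqrt_two ⟨(a : ℚ) / b, ?_⟩
        have hb' : (b : ℝ) ≠ 0 := by exact_mod_cast hb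
        push_cast
        rw [div_eq_iff hb']
        linear_combination h1
  have habs : (1 : ℝ) ≤ |((a : ℝ) + b * √2) * (a - b * √2)| := by
    have : ((a : ℝ) + b * √2) * (a - b * √2) = ((a ^ 2 - 2 * b ^ 2 : ℤ) : ℝ) := by
      push_cast
      linear_combination -(b : ℝ) ^ 2 * h2
    rw [this]
    exact_mod_cast Int.one_le_abs hint
  have hpow : √2 ^ t * √2 ^ t = (2 : ℝ) ^ t := by rw [← mul_pow, h2]
  calc (2 : ℝ)⁻¹ ^ t = 1 / (√2 ^ t * √2 ^ t) := by rw [hpow, inv_pow, one_div]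
    _ ≤ |((a : ℝ) + b * √2) * (a - b * √2)| / (√2 ^ t * √2 ^ t) := by gcongr
    _ = |(a - b * √2) / √2 ^ t| * |((a : ℝ) + b * √2) / √2 ^ t| := by
        rw [← abs_mul, ← abs_of_pos (show (0 : ℝ) < √2 ^ t * √2 ^ t by positivity), ← abs_div]
        congr 1
        ring
    _ ≤ M * |((a : ℝ) + b * √2) / √2 ^ t| := by gcongr

namespace PureState

variable {n t : ℕ} {ψ : PureState n}

/-- The exact form of an expectation value, with bounds for the two integers. -/
theorem IsArithmetic.exists_form (h : ψ.IsArithmetic t) (P : Pauli n) :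
    ∃ a b : ℤ, ψ.expect P = (a + b * √2) / √2 ^ t ∧ |(a - b * √2) / √2 ^ t| ≤ 1 ∧
      |(a : ℝ)| ≤ √2 ^ t ∧ |(b : ℝ)| ≤ √2 ^ t := by
  obtain ⟨⟨φ, a, b, hab⟩, -⟩ := h
  have h1 := ψ.abs_expect_le P
  have h2 := φ.abs_expect_le P
  rw [(hab P).2, abs_mul, abs_pow, abs_neg, abs_one, one_pow, one_mul] at h2
  have h1' := h1
  have h2' := h2
  have hp : (0 : ℝ) < √2 ^ t := by positivity
  rw [(hab P).1, abs_div, abs_of_pos hp, div_le_one hp, abs_le] at h1'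
  rw [abs_div, abs_of_pos hp, div_le_one hp, abs_le] at h2'
  -- `a` is half the sum and `b√2` half the difference of two numbers of modulus at most `√2^t`. The
  -- possible pairs therefore lie in a finite grid.
  refine ⟨a P, b P, (hab P).1, h2, abs_le.mpr ⟨by linarith, by linarith⟩, ?_⟩
  have h3 : |(b P : ℝ)| * 1 ≤ |(b P : ℝ)| * √2 := by
    gcongr
    exact Real.one_le_sqrt.mpr (by norm_num)
  have h4 : |(b P : ℝ) * √2| ≤ √2 ^ t := abs_le.mpr ⟨by linarith, by linarith⟩
  rw [abs_mul, abs_of_pos (by positivity : (0:ℝ) < √2)] at h4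
  linarith

theorem IsArithmetic.isQuad (h : ψ.IsArithmetic t) (P : Pauli n) : IsQuad t 1 (ψ.expect P) := by
  obtain ⟨a, b, h1, h2, -⟩ := h.exists_form P
  exact ⟨a, b, h1, h2⟩

/-- With `x = tr(Qψ)`, both `1 - x` and `1 + x` are non-zero with conjugates of modulus at most `2`,
hence at least `2^{-t}/2`. One of them is at least `1`, so `1 - x² ≥ 2^{-t}/2`. -/
theorem IsArithmetic.expect_sq_le (h : ψ.IsArithmetic t) {Q : Pauli n} (hQ : Q ∉ ψ.stab) :
    (1 + ψ.expect Q ^ 2) / 2 ≤ 1 - (2 : ℝ)⁻¹ ^ t / 4 := by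
  have hv : IsQuad t 1 1 := by
    have := h.isQuad 0
    rwa [ψ.expect_zero] at this
  have hq := h.isQuad Q
  rw [mem_stab_iff, not_or] at hQ
  have h1 := (hv.sub hq).gap (sub_ne_zero.mpr (Ne.symm hQ.1))
  have h2 := (hv.sub hq.neg).gap (by intro h0; apply hQ.2; linarith)
  have hle := abs_le.mp (ψ.abs_expect_le Q)
  rw [abs_of_nonneg (by linarith)] at h1 h2
  nlinarith [mul_nonneg (sub_nonneg.mpr hle.1) (sub_nonneg.mpr hle.2)]

theorem toOuterMeasure_charDist_commuting (ψ : PureState n) (Q : Pauli n) :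
    ψ.charDist.toOuterMeasure {P | symp P Q = 0} = ENNReal.ofReal ((1 + ψ.expect Q ^ 2) / 2) := by
  have hd : ∀ P, ψ.charDist P = ENNReal.ofReal (ψ.expect P ^ 2 / 2 ^ n) := fun P => rfl
  rw [PMF.toOuterMeasure_apply_fintype]
  have h1 : ∀ P, Set.indicator {P | symp P Q = 0} ψ.charDist P =
      ENNReal.ofReal ((if symp P Q = 0 then ψ.expect P ^ 2 else 0) / 2 ^ n) := by
    intro P
    by_cases h : symp P Q = 0
    · rw [Set.indicator_of_mem (by exact h), hd, if_pos h]
    · rw [Set.indicator_of_notMem (by exact h), if_neg h, zero_div, ENNReal.ofReal_zero]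
  simp only [h1]
  rw [← ENNReal.ofReal_sum_of_nonneg (fun P _ => by positivity), ← Finset.sum_div,
    sum_commuting_expect_sq, mul_div_cancel_left₀ _ (by positivity)]

theorem expect_ne_zero_of_mem_support {P : Pauli n} (h : P ∈ ψ.charDist.support) :
    ψ.expect P ≠ 0 := by
  rintro h0
  rw [PMF.mem_support_iff] at h
  apply h
  change ENNReal.ofReal (ψ.expect P ^ 2 / 2 ^ n) = 0
  simp [h0]

/-! ## The density matrix in terms of the description -/

/-- Strings weighted by their expectation values multiply by stabilizers without phases. Up to the
phase `c` of the product, `tr((P+g)ψ)` is `tr(gψ)tr(Pψ)`; both are real with equal modulus, so `c`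
is a sign and cancels, unless both vanish. -/
theorem expect_smul_mul_stab (ψ : PureState n) {g : Pauli n} (hg : g ∈ ψ.stab) (P : Pauli n) :
    ((ψ.expect P : ℂ) • pauliOp P) * ((ψ.expect g : ℂ) • pauliOp g) =
      (ψ.expect (P + g) : ℂ) • pauliOp (P + g) := by
  obtain ⟨c, -, h⟩ := pauliOp_mul P g
  have h1 := ψ.expect_mul_stab hg P h
  rw [smul_mul_smul_comm, h, smul_smul]
  congr 1
  by_cases h0 : ψ.expect (P + g) = 0
  · have h2 : ψ.expect P = 0 := by
      have := ψ.abs_expect_add_stab hg P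
      rw [h0, abs_zero] at this
      exact abs_eq_zero.mp this.symm
    simp [h0, h2]
  · have h2 := ψ.abs_expect_add_stab hg P
    have hg2 := ψ.mem_stab_iff_sq.mp hg
    have h3 : (ψ.expect (P + g) : ℂ) ^ 2 = (ψ.expect P : ℂ) ^ 2 := by
      have : ψ.expect (P + g) ^ 2 = ψ.expect P ^ 2 := by rw [← sq_abs, h2, sq_abs]
      exact_mod_cast this
    have hg3 : (ψ.expect g : ℂ) ^ 2 = 1 := by exact_mod_cast hg2
    have h0' : (ψ.expect (P + g) : ℂ) ≠ 0 := by exact_mod_cast h0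
    have h4 : (ψ.expect P * ψ.expect g * c : ℂ) * ψ.expect (P + g) =
        ψ.expect (P + g) * ψ.expect (P + g) := by
      linear_combination (ψ.expect P * ψ.expect g : ℂ) * h1 - h3 + (ψ.expect P : ℂ) ^ 2 * hg3
    exact mul_right_cancel₀ h0' h4

theorem prod_stab_eq_sum (ψ : PureState n) : ∀ (m : ℕ) (g : Fin m → Pauli n),
    (∀ j, g j ∈ ψ.stab) →
    (List.ofFn fun j => 1 + (ψ.expect (g j) : ℂ) • pauliOp (g j)).prod =
      ∑ ε : Fin m → ZMod 2, (ψ.expect (∑ j, ε j • g j) : ℂ) • pauliOp (∑ j, ε j • g j) := by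
  intro m
  induction m with
  | zero =>
    intro g _
    simp [expect_zero, pauliOp_zero]
  | succ m ih =>
    intro g hg
    rw [List.ofFn_succ, List.prod_cons, ih (fun j => g j.succ) (fun j => hg _),
      ← (Fin.consEquiv fun _ => ZMod 2).sum_comp, Fintype.sum_prod_type]
    have h2 : ∀ f : ZMod 2 → Op n, ∑ x, f x = f 0 + f 1 := fun f => Fin.sum_univ_two f
    rw [h2, add_mul, one_mul, Finset.mul_sum]
    simp only [Fin.consEquiv_apply, Fin.sum_univ_succ, Fin.cons_zero, Fin.cons_succ, zero_smul,
      zero_add, one_smul]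
    congr 1
    refine Finset.sum_congr rfl fun ε _ => ?_
    refine ψ.expect_smul_mul_stab ?_ (g 0)
    change _ ∈ ψ.stabSubgroup
    refine sum_mem fun j _ => ?_
    rcases zmod2_cases (ε j) with h | h
    · rw [h, zero_smul]; exact zero_mem _
    · rw [h, one_smul]; exact hg _

/-- This is the Pauli expansion of `ψ` grouped by cosets: the product over the generators expands to
the weighted sum over the stabilizer group, and multiplication by a weighted representative yields
the weighted sum over its coset. -/
theorem density_eq_toOp (ψ : PureState n) (D : Description n)
    (generates : (AddSubgroup.closure (Set.range D.g) : Set (Pauli n)) = ψ.stab)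
    (card : 2 ^ D.m = ψ.stab.ncard)
    (phase : ∀ j, ψ.expect (D.g j) = D.φ j)
    (cosets : ψ.supp = ⋃ i, (fun Q => D.rep i + Q) '' ψ.stab)
    (disjoint : Pairwise fun i j =>
      Disjoint ((fun Q => D.rep i + Q) '' ψ.stab) ((fun Q => D.rep j + Q) '' ψ.stab))
    (value : ∀ i, ψ.expect (D.h i) = D.e i) : ψ.density = D.toOp := by
  classical
  have hg : ∀ j, D.g j ∈ ψ.stab := fun j => by
    rw [← generates]
    exact AddSubgroup.subset_closure ⟨j, rfl⟩
  have hval : ∀ i, D.val i = ψ.expect (D.rep i) := by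
    intro i
    refine Fin.cases ?_ (fun i => ?_) i
    · simp [Description.val, Description.rep, expect_zero]
    · simp [Description.val, Description.rep, value]
  let _ : Fintype ψ.stabSubgroup := Fintype.ofFinite _
  let Φ : (Fin D.m → ZMod 2) → ψ.stabSubgroup := fun ε => ⟨∑ j, ε j • D.g j, sum_mem fun j _ => by
    rcases zmod2_cases (ε j) with h | h
    · rw [h, zero_smul]; exact zero_mem _
    · rw [h, one_smul]; exact hg _⟩
  have hsurj : Function.Surjective Φ := by
    let R : AddSubgroup (Pauli n) := (AddMonoidHom.mk' (fun ε : Fin D.m → ZMod 2 => ∑ j, ε j • D.g j)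
      (fun ε ε' => by simp [add_smul, Finset.sum_add_distrib])).range
    have hle : AddSubgroup.closure (Set.range D.g) ≤ R := by
      rw [AddSubgroup.closure_le]
      rintro _ ⟨j, rfl⟩
      refine ⟨Pi.single j 1, ?_⟩
      simp only [AddMonoidHom.mk'_apply]
      rw [Finset.sum_eq_single j]
      · simp
      · intro i _ hi
        simp [Pi.single_eq_of_ne hi]
      · simp
    rintro ⟨P, hP⟩
    have hP' : P ∈ AddSubgroup.closure (Set.range D.g) := by
      rw [← SetLike.mem_coe, generates]; exact hP
    obtain ⟨ε, hε⟩ := hle hP'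
    exact ⟨ε, Subtype.ext hε⟩
  -- There are `m` generators for a group of order `2^m`, so counting upgrades generation to
  -- independence.
  have hbij : Function.Bijective Φ := by
    refine (Nat.bijective_iff_surjective_and_card Φ).mpr ⟨hsurj, ?_⟩
    have : Nat.card ψ.stabSubgroup = ψ.stab.ncard := rfl
    rw [this, ← card]
    simp
  have hprod : (List.ofFn fun j => 1 + (D.φ j : ℂ) • pauliOp (D.g j)).prod =
      ∑ g : ψ.stabSubgroup, (ψ.expect (g : Pauli n) : ℂ) • pauliOp (g : Pauli n) := by
    simp only [← phase]
    rw [ψ.prod_stab_eq_sum _ _ hg]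
    exact hbij.sum_comp fun g : ψ.stabSubgroup => (ψ.expect (g : Pauli n) : ℂ) • pauliOp (g : Pauli n)
  rw [density_eq_sum, Description.toOp, hprod]
  congr 1
  have hinj : Function.Injective fun x : Fin (D.k + 1) × ψ.stabSubgroup =>
      D.rep x.1 + (x.2 : Pauli n) := by
    rintro ⟨i, g⟩ ⟨j, g'⟩ h
    simp only at h
    by_cases hij : i = j
    · subst hij
      exact Prod.ext rfl (Subtype.ext (add_left_cancel h))
    · exfalso
      exact Set.disjoint_left.mp (disjoint hij) ⟨g, g.2, rfl⟩ ⟨g', g'.2, h.symm⟩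
  simp only [hval]
  have hF : ∀ i, (ψ.expect (D.rep i) : ℂ) • (pauliOp (D.rep i) *
      ∑ g : ψ.stabSubgroup, (ψ.expect (g : Pauli n) : ℂ) • pauliOp (g : Pauli n)) =
      ∑ g : ψ.stabSubgroup, (ψ.expect (D.rep i + (g : Pauli n)) : ℂ) •
        pauliOp (D.rep i + (g : Pauli n)) := by
    intro i
    rw [← smul_mul_assoc, Finset.mul_sum]
    exact Finset.sum_congr rfl fun g _ => ψ.expect_smul_mul_stab g.2 _
  simp only [hF]
  rw [← Fintype.sum_prod_type']
  symm
  refine Fintype.sum_of_injective _ hinj _ _ ?_ (fun _ => rfl)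
  intro P hP
  have : P ∉ ψ.supp := by
    rw [cosets]
    intro h
    obtain ⟨i, g, hg, rfl⟩ := Set.mem_iUnion.mp h
    exact hP ⟨(i, ⟨g, hg⟩), rfl⟩
  have h0 : ψ.expect P = 0 := by
    by_contra h
    exact this h
  simp [h0]

end PureState
end

noncomputable section

/-! ## Failure probabilities and potentials -/

namespace PMF

variable {α β : Type*}

open scoped ENNReal

/-- `Q` holds except with probability at most `ε`. -/
def Ensures (μ : PMF α) (ε : ℝ≥0∞) (Q : α → Prop) : Prop := μ.toOuterMeasure {a | ¬ Q a} ≤ ε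

/-- The expectation of a non-negative function. -/
def mean (μ : PMF α) (Φ : α → ℝ≥0∞) : ℝ≥0∞ := ∑' a, μ a * Φ a

theorem ensures_zero_iff {μ : PMF α} {Q : α → Prop} : μ.Ensures 0 Q ↔ ∀ a ∈ μ.support, Q a := by
  rw [Ensures, nonpos_iff_eq_zero, toOuterMeasure_apply_eq_zero_iff, Set.disjoint_left]
  simp

theorem Ensures.mono {μ : PMF α} {ε δ : ℝ≥0∞} {Q R : α → Prop} (h : μ.Ensures ε Q) (hεδ : ε ≤ δ)
    (hQR : ∀ a ∈ μ.support, Q a → R a) : μ.Ensures δ R := by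
  refine le_trans (μ.toOuterMeasure_mono ?_) (le_trans h hεδ)
  rintro a ⟨ha, hs⟩ hQ
  exact ha (hQR a hs hQ)

theorem ensures_pure {a : α} {Q : α → Prop} (h : Q a) : (PMF.pure a).Ensures 0 Q := by
  rw [ensures_zero_iff]
  intro b hb
  rw [mem_support_pure_iff] at hb
  rwa [hb]

/-- The union bound along a computation: outcomes outside `R` are charged with their whole mass, the
others with `δ`. -/
theorem Ensures.bind {μ : PMF α} {f : α → PMF β} {ε δ : ℝ≥0∞} {R : α → Prop} {Q : β → Prop}
    (h : μ.Ensures ε R) (hf : ∀ a ∈ μ.support, R a → (f a).Ensures δ Q) :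
    (μ.bind f).Ensures (ε + δ) Q := by
  classical
  rw [Ensures, toOuterMeasure_bind_apply]
  calc ∑' a, μ a * (f a).toOuterMeasure {b | ¬ Q b}
      ≤ ∑' a, (Set.indicator {a | ¬ R a} μ a + μ a * δ) := by
        refine ENNReal.tsum_le_tsum fun a => ?_
        by_cases hs : a ∈ μ.support
        · by_cases hR : R a
          · exact le_add_left (mul_le_mul_right (hf a hs hR) _)
          · rw [Set.indicator_of_mem (by exact hR)]
            refine le_add_right ?_
            calc μ a * (f a).toOuterMeasure {b | ¬ Q b} ≤ μ a * 1 := by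
                  gcongr
                  rw [toOuterMeasure_apply]
                  calc _ ≤ ∑' b, f a b := ENNReal.tsum_le_tsum fun b => Set.indicator_le_self _ _ _
                    _ = 1 := (f a).tsum_coe
              _ = μ a := mul_one _
        · rw [(μ.apply_eq_zero_iff a).mpr hs, zero_mul]
          exact zero_le
    _ = μ.toOuterMeasure {a | ¬ R a} + δ := by
        rw [ENNReal.tsum_add, ENNReal.tsum_mul_right, μ.tsum_coe, one_mul, toOuterMeasure_apply]
    _ ≤ ε + δ := by gcongr; exact h

theorem toOuterMeasure_map_le {μ : PMF α} {f : α → β} {ε : ℝ≥0∞} {Q : β → Prop}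
    (h : (μ.map f).Ensures ε Q) : μ.Ensures ε fun a => Q (f a) := by
  rw [Ensures, toOuterMeasure_map_apply] at h
  exact h

/-- Markov's inequality at level `1`, for a potential that is at least `1` on failure. -/
theorem ensures_of_mean {μ : PMF α} {Φ : α → ℝ≥0∞} {Q : α → Prop} {ε : ℝ≥0∞} (h : μ.mean Φ ≤ ε)
    (hQ : ∀ a ∈ μ.support, ¬ Q a → 1 ≤ Φ a) : μ.Ensures ε Q := by
  refine le_trans ?_ h
  rw [toOuterMeasure_apply, mean]
  refine ENNReal.tsum_le_tsum fun a => ?_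
  by_cases hs : a ∈ μ.support
  · by_cases ha : Q a
    · rw [Set.indicator_of_notMem (by simpa using ha)]
      exact zero_le
    · rw [Set.indicator_of_mem (by exact ha)]
      calc μ a = μ a * 1 := (mul_one _).symm
        _ ≤ μ a * Φ a := by gcongr; exact hQ a hs ha
  · calc _ ≤ μ a := Set.indicator_le_self _ _ _
      _ = 0 := (μ.apply_eq_zero_iff a).mpr hs
      _ ≤ _ := zero_le

theorem mean_pure (a : α) (Φ : α → ℝ≥0∞) : (PMF.pure a).mean Φ = Φ a := by
  rw [mean, tsum_eq_single a]
  · simp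
  · intro b hb
    simp [hb]

theorem mean_bind (μ : PMF α) (f : α → PMF β) (Φ : β → ℝ≥0∞) :
    (μ.bind f).mean Φ = ∑' a, μ a * (f a).mean Φ := by
  simp only [mean, bind_apply, ← ENNReal.tsum_mul_right, ← ENNReal.tsum_mul_left]
  rw [ENNReal.tsum_comm]
  simp only [mul_assoc]

theorem mean_map (μ : PMF α) (f : α → β) (Φ : β → ℝ≥0∞) :
    (μ.map f).mean Φ = μ.mean fun a => Φ (f a) := by
  have : μ.map f = μ.bind fun a => PMF.pure (f a) := rfl
  rw [this, mean_bind, mean]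
  simp only [mean_pure]

theorem mean_bind_le {μ : PMF α} {f : α → PMF β} {Φ : β → ℝ≥0∞} {Ψ : α → ℝ≥0∞}
    (h : ∀ a ∈ μ.support, (f a).mean Φ ≤ Ψ a) : (μ.bind f).mean Φ ≤ μ.mean Ψ := by
  rw [mean_bind]
  refine ENNReal.tsum_le_tsum fun a => ?_
  by_cases hs : a ∈ μ.support
  · gcongr; exact h a hs
  · rw [(μ.apply_eq_zero_iff a).mpr hs, zero_mul, zero_mul]

theorem mean_const_mul (μ : PMF α) (κ : ℝ≥0∞) (Φ : α → ℝ≥0∞) :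
    (μ.mean fun a => κ * Φ a) = κ * μ.mean Φ := by
  simp only [mean, ← ENNReal.tsum_mul_left]
  exact tsum_congr fun a => by ring

/-- Iterated random steps. -/
def iter (f : α → PMF α) (N : ℕ) (a : α) : PMF α :=
  (fun μ : PMF α => μ.bind f)^[N] (PMF.pure a)

theorem iter_zero (f : α → PMF α) (a : α) : iter f 0 a = PMF.pure a := rfl

theorem iter_succ (f : α → PMF α) (N : ℕ) (a : α) : iter f (N + 1) a = (iter f N a).bind f := by
  rw [iter, Function.iterate_succ_apply']
  rfl

theorem iter_ensures {f : α → PMF α} {a : α} {I : ℕ → α → Prop} {ε : ℕ → ℝ≥0∞} {N : ℕ}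
    (h0 : I 0 a) (hs : ∀ i < N, ∀ b, I i b → (f b).Ensures (ε i) (I (i + 1))) :
    (iter f N a).Ensures (∑ i ∈ Finset.range N, ε i) (I N) := by
  induction N with
  | zero => simpa [iter_zero] using ensures_pure h0
  | succ N ih =>
    rw [iter_succ, Finset.sum_range_succ]
    exact (ih fun i hi => hs i (by omega)).bind fun b _ hb => hs N (by omega) b hb

theorem iter_support {f : α → PMF α} {a : α} {I : ℕ → α → Prop} {N : ℕ}
    (h0 : I 0 a) (hs : ∀ i < N, ∀ b, I i b → ∀ c ∈ (f b).support, I (i + 1) c) :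
    ∀ c ∈ (iter f N a).support, I N c := by
  have := iter_ensures (ε := fun _ => 0) h0 fun i hi b hb => ensures_zero_iff.mpr (hs i hi b hb)
  rw [Finset.sum_const_zero] at this
  exact ensures_zero_iff.mp this

/-- Combined with Markov's inequality this replaces independence of the samples and shots. It is
used for the indicator that a string has not yet been excluded and for exponential moments of the
outcome count. -/
theorem iter_mean_le {f : α → PMF α} {a : α} {I : ℕ → α → Prop} {Φ : α → ℝ≥0∞} {κ : ℝ≥0∞} {N : ℕ}
    (h0 : I 0 a) (hs : ∀ i < N, ∀ b, I i b → ∀ c ∈ (f b).support, I (i + 1) c)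
    (hΦ : ∀ i < N, ∀ b, I i b → (f b).mean Φ ≤ κ * Φ b) : (iter f N a).mean Φ ≤ κ ^ N * Φ a := by
  induction N with
  | zero => rw [iter_zero, mean_pure, pow_zero, one_mul]
  | succ N ih =>
    rw [iter_succ]
    calc _ ≤ (iter f N a).mean fun b => κ * Φ b := mean_bind_le fun b hb =>
          hΦ N (by omega) b (iter_support h0 (fun i hi => hs i (by omega)) b hb)
      _ = κ * (iter f N a).mean Φ := mean_const_mul _ _ _
      _ ≤ κ * (κ ^ N * Φ a) := by
          gcongr
          exact ih (fun i hi => hs i (by omega)) fun i hi => hΦ i (by omega)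
      _ = κ ^ (N + 1) * Φ a := by ring

end PMF

/-! ## Programs without counters -/

/-- The memory of a machine. -/
@[ext] structure Mem where
  reg : ℕ → ℕ
  arr : ℕ → ℕ → ℕ

namespace Mem

/-- Write a register. -/
def setReg (w : ℕ) (m : Mem) (r v : ℕ) : Mem := { m with reg := Function.update m.reg r (v % 2 ^ w) }

/-- Write an array cell. -/
def setArr (w : ℕ) (m : Mem) (A a v : ℕ) : Mem :=
  { m with arr := Function.update m.arr A (Function.update (m.arr A) a (v % 2 ^ w)) }

end Mem

/-- The memory of a machine state. -/
def RAM.mem (s : RAM) : Mem := ⟨s.reg, s.arr⟩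

namespace Prog

/-- The effect of a program on the memory. -/
def sem {n : ℕ} (w : ℕ) (ψ : PureState n) : Prog → Mem → PMF Mem
  | .const r c, m => PMF.pure (m.setReg w r c)
  | .op o r a b, m => PMF.pure (m.setReg w r (o.eval (m.reg a) (m.reg b)))
  | .load r A a, m => PMF.pure (m.setReg w r (m.arr A (m.reg a)))
  | .store A a b, m => PMF.pure (m.setArr w A (m.reg a) (m.reg b))
  | .sample rx rz, m => ψ.charDist.map fun P =>
      (m.setReg w rx (encodeBits fun i => (P i).1)).setReg w rz (encodeBits fun i => (P i).2)
  | .measure r rx rz, m => (ψ.shotDist (decodePauli n (m.reg rx) (m.reg rz))).map fun b =>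
      m.setReg w r (if b then 1 else 0)
  | .seq p q, m => (p.sem w ψ m).bind fun m' => q.sem w ψ m'
  | .ite r p q, m => if m.reg r ≠ 0 then p.sem w ψ m else q.sem w ψ m
  | .loop r p, m => PMF.iter (p.sem w ψ) (m.reg r) m

/-- No instruction reads the counters, so forgetting them commutes with every step. Correctness can
then be proved on the memory alone. -/
theorem map_mem_run {n : ℕ} (w : ℕ) (ψ : PureState n) (p : Prog) :
    ∀ s : RAM, (p.run w ψ s).map RAM.mem = p.sem w ψ s.mem := by
  induction p with
  | const r c => intro s; simp only [run, PMF.pure_map]; rfl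
  | op o r a b => intro s; simp only [run, PMF.pure_map]; rfl
  | load r A a => intro s; simp only [run, PMF.pure_map]; rfl
  | store A a b => intro s; simp only [run, PMF.pure_map]; rfl
  | sample rx rz => intro s; simp only [run, PMF.map_comp]; rfl
  | measure r rx rz => intro s; simp only [run, PMF.map_comp]; rfl
  | seq p q ihp ihq =>
    intro s
    simp only [run, sem, PMF.map_bind, ihq]
    rw [← ihp, PMF.bind_map]
    rfl
  | ite r p q ihp ihq =>
    intro s
    simp only [run, sem]
    by_cases h : s.reg r ≠ 0
    · rw [if_pos h, if_pos (by exact h), ihp]; rfl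
    · rw [if_neg h, if_neg (by exact h), ihq]; rfl
  | loop r p ih =>
    intro s
    simp only [run, sem]
    change _ = PMF.iter (p.sem w ψ) (s.reg r) s.mem
    generalize s.reg r = N
    induction N with
    | zero => simp only [Function.iterate_zero, id, PMF.pure_map, PMF.iter_zero]; rfl
    | succ N ihN =>
      rw [Function.iterate_succ_apply', PMF.iter_succ, PMF.map_bind, ← ihN, PMF.bind_map]
      simp only [ih]
      rfl

/-- The effect of a program without samples and measurements. -/
def exec (w : ℕ) : Prog → Mem → Mem
  | .const r c, m => m.setReg w r c
  | .op o r a b, m => m.setReg w r (o.eval (m.reg a) (m.reg b))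
  | .load r A a, m => m.setReg w r (m.arr A (m.reg a))
  | .store A a b, m => m.setArr w A (m.reg a) (m.reg b)
  | .sample _ _, m => m
  | .measure _ _ _, m => m
  | .seq p q, m => q.exec w (p.exec w m)
  | .ite r p q, m => if m.reg r ≠ 0 then p.exec w m else q.exec w m
  | .loop r p, m => (p.exec w)^[m.reg r] m

/-- Programs without samples and measurements. -/
def isDet : Prog → Bool
  | .sample _ _ => false
  | .measure _ _ _ => false
  | .seq p q => p.isDet && q.isDet
  | .ite _ p q => p.isDet && q.isDet
  | .loop _ p => p.isDet
  | _ => true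

theorem sem_of_isDet {n : ℕ} (w : ℕ) (ψ : PureState n) (p : Prog) (hp : p.isDet = true) :
    ∀ m, p.sem w ψ m = PMF.pure (p.exec w m) := by
  induction p with
  | const r c => intro m; rfl
  | op o r a b => intro m; rfl
  | load r A a => intro m; rfl
  | store A a b => intro m; rfl
  | sample rx rz => simp [isDet] at hp
  | measure r rx rz => simp [isDet] at hp
  | seq p q ihp ihq =>
    intro m
    simp only [isDet, Bool.and_eq_true] at hp
    simp only [sem, exec, ihp hp.1, ihq hp.2, PMF.pure_bind]
  | ite r p q ihp ihq =>
    intro m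
    simp only [isDet, Bool.and_eq_true] at hp
    simp only [sem, exec, ihp hp.1, ihq hp.2]
    split_ifs <;> rfl
  | loop r p ih =>
    intro m
    simp only [sem, exec]
    generalize m.reg r = N
    induction N with
    | zero => rfl
    | succ N ihN =>
      rw [PMF.iter_succ, ihN, PMF.pure_bind, ih hp, Function.iterate_succ_apply']

/-- The registers that a program may write. -/
def wregs : Prog → List ℕ
  | .const r _ => [r]
  | .op _ r _ _ => [r]
  | .load r _ _ => [r]
  | .store _ _ _ => []
  | .sample rx rz => [rx, rz]
  | .measure r _ _ => [r]
  | .seq p q => p.wregs ++ q.wregs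
  | .ite _ p q => p.wregs ++ q.wregs
  | .loop _ p => p.wregs

/-- The arrays that a program may write. -/
def warrs : Prog → List ℕ
  | .store A _ _ => [A]
  | .seq p q => p.warrs ++ q.warrs
  | .ite _ p q => p.warrs ++ q.warrs
  | .loop _ p => p.warrs
  | _ => []

/-- The registers that control loops. -/
def lregs : Prog → List ℕ
  | .seq p q => p.lregs ++ q.lregs
  | .ite _ p q => p.lregs ++ q.lregs
  | .loop r p => r :: p.lregs
  | _ => []

/-- The frame rule. For a concrete program the side conditions are decidable, so invariants about
untouched registers cost one `decide`. -/
theorem sem_frame {n : ℕ} (w : ℕ) (ψ : PureState n) (p : Prog) :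
    ∀ m, ∀ m' ∈ (p.sem w ψ m).support, (∀ r ∉ p.wregs, m'.reg r = m.reg r) ∧
      ∀ A ∉ p.warrs, m'.arr A = m.arr A := by
  induction p with
  | const r c =>
    intro m m' hm
    simp only [sem, PMF.mem_support_pure_iff] at hm
    subst hm
    exact ⟨fun x hx => by simp [Mem.setReg, Function.update_of_ne (by simpa [wregs] using hx)],
      fun A _ => rfl⟩
  | op o r a b =>
    intro m m' hm
    simp only [sem, PMF.mem_support_pure_iff] at hm
    subst hm
    exact ⟨fun x hx => by simp [Mem.setReg, Function.update_of_ne (by simpa [wregs] using hx)],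
      fun A _ => rfl⟩
  | load r A a =>
    intro m m' hm
    simp only [sem, PMF.mem_support_pure_iff] at hm
    subst hm
    exact ⟨fun x hx => by simp [Mem.setReg, Function.update_of_ne (by simpa [wregs] using hx)],
      fun A _ => rfl⟩
  | store A a b =>
    intro m m' hm
    simp only [sem, PMF.mem_support_pure_iff] at hm
    subst hm
    exact ⟨fun x hx => rfl,
      fun B hB => by simp [Mem.setArr, Function.update_of_ne (by simpa [warrs] using hB)]⟩
  | sample rx rz =>
    intro m m' hm
    simp only [sem, PMF.support_map] at hm
    obtain ⟨P, -, rfl⟩ := hm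
    refine ⟨fun x hx => ?_, fun A _ => rfl⟩
    simp only [wregs, List.mem_cons, List.not_mem_nil, or_false, not_or] at hx
    simp [Mem.setReg, Function.update_of_ne hx.1, Function.update_of_ne hx.2]
  | measure r rx rz =>
    intro m m' hm
    simp only [sem, PMF.support_map] at hm
    obtain ⟨b, -, rfl⟩ := hm
    exact ⟨fun x hx => by simp [Mem.setReg, Function.update_of_ne (by simpa [wregs] using hx)],
      fun A _ => rfl⟩
  | seq p q ihp ihq =>
    intro m m' hm
    simp only [sem, PMF.mem_support_bind_iff] at hm
    obtain ⟨m₁, h1, h2⟩ := hm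
    obtain ⟨hr, ha⟩ := ihp m m₁ h1
    obtain ⟨hr', ha'⟩ := ihq m₁ m' h2
    simp only [wregs, warrs, List.mem_append, not_or]
    exact ⟨fun r h => by rw [hr' r h.2, hr r h.1], fun A h => by rw [ha' A h.2, ha A h.1]⟩
  | ite r p q ihp ihq =>
    intro m m' hm
    simp only [wregs, warrs, List.mem_append, not_or]
    simp only [sem] at hm
    split_ifs at hm
    · obtain ⟨hr, ha⟩ := ihp m m' hm
      exact ⟨fun r h => hr r h.1, fun A h => ha A h.1⟩
    · obtain ⟨hr, ha⟩ := ihq m m' hm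
      exact ⟨fun r h => hr r h.2, fun A h => ha A h.2⟩
  | loop r p ih =>
    intro m
    simp only [sem, wregs, warrs]
    refine PMF.iter_support (I := fun _ (m' : Mem) => (∀ r ∉ p.wregs, m'.reg r = m.reg r) ∧
      ∀ A ∉ p.warrs, m'.arr A = m.arr A) ⟨fun _ _ => rfl, fun _ _ => rfl⟩ ?_
    rintro - - b ⟨hr, ha⟩ c hc
    obtain ⟨hr', ha'⟩ := ih b c hc
    exact ⟨fun r h => by rw [hr' r h, hr r h], fun A h => by rw [ha' A h, ha A h]⟩

theorem exec_reg (w : ℕ) (p : Prog) : ∀ m, ∀ r ∉ p.wregs, (p.exec w m).reg r = m.reg r := by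
  induction p with
  | const r c =>
    intro m x hx
    simp [exec, Mem.setReg, Function.update_of_ne (by simpa [wregs] using hx)]
  | op o r a b =>
    intro m x hx
    simp [exec, Mem.setReg, Function.update_of_ne (by simpa [wregs] using hx)]
  | load r A a =>
    intro m x hx
    simp [exec, Mem.setReg, Function.update_of_ne (by simpa [wregs] using hx)]
  | store A a b => intro m x hx; rfl
  | sample rx rz => intro m x hx; rfl
  | measure r rx rz => intro m x hx; rfl
  | seq p q ihp ihq =>
    intro m x hx
    simp only [wregs, List.mem_append, not_or] at hx
    simp only [exec]
    rw [ihq _ x hx.2, ihp _ x hx.1]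
  | ite r p q ihp ihq =>
    intro m x hx
    simp only [wregs, List.mem_append, not_or] at hx
    simp only [exec]
    split_ifs
    · exact ihp m x hx.1
    · exact ihq m x hx.2
  | loop r p ih =>
    intro m x hx
    simp only [exec]
    generalize m.reg r = N
    induction N with
    | zero => rfl
    | succ N ihN => rw [Function.iterate_succ_apply', ih _ x hx, ihN]

theorem exec_arr (w : ℕ) (p : Prog) : ∀ m, ∀ A ∉ p.warrs, (p.exec w m).arr A = m.arr A := by
  induction p with
  | const r c => intro m x hx; rfl
  | op o r a b => intro m x hx; rfl
  | load r A a => intro m x hx; rfl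
  | store A a b =>
    intro m x hx
    simp [exec, Mem.setArr, Function.update_of_ne (by simpa [warrs] using hx)]
  | sample rx rz => intro m x hx; rfl
  | measure r rx rz => intro m x hx; rfl
  | seq p q ihp ihq =>
    intro m x hx
    simp only [warrs, List.mem_append, not_or] at hx
    simp only [exec]
    rw [ihq _ x hx.2, ihp _ x hx.1]
  | ite r p q ihp ihq =>
    intro m x hx
    simp only [warrs, List.mem_append, not_or] at hx
    simp only [exec]
    split_ifs
    · exact ihp m x hx.1
    · exact ihq m x hx.2
  | loop r p ih =>
    intro m x hx
    simp only [exec]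
    generalize m.reg r = N
    induction N with
    | zero => rfl
    | succ N ihN => rw [Function.iterate_succ_apply', ih _ x hx, ihN]

/-! ## Static resource bounds -/

/-- A bound for the resources of a program: `c` is the cost of a basic step, `dsample` and `dshot` are those of the two kinds of
oracle calls, and `v r` is the value of the loop register `r`. -/
def cost (c dsample dshot : ℕ) (v : ℕ → ℕ) : Prog → ℕ
  | .sample _ _ => dsample
  | .measure _ _ _ => dshot
  | .seq p q => p.cost c dsample dshot v + q.cost c dsample dshot v
  -- The sum of both branches bounds either one and keeps the cost a polynomial in the loop lengths.
  | .ite _ p q => c + p.cost c dsample dshot v + q.cost c dsample dshot v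
  | .loop r p => c + v r * (c + p.cost c dsample dshot v)
  | _ => c

/-- The resources that are counted by `cost c dsample dshot`. -/
def _root_.RAM.used (c dsample dshot : ℕ) (s : RAM) : ℕ :=
  c * s.steps + dsample * s.samples + dshot * s.shots

theorem run_frame {n : ℕ} (w : ℕ) (ψ : PureState n) (p : Prog) (s : RAM) :
    ∀ s' ∈ (p.run w ψ s).support, ∀ r ∉ p.wregs, s'.reg r = s.reg r := by
  intro s' hs' r hr
  refine (sem_frame w ψ p s.mem s'.mem ?_).1 r hr
  rw [← map_mem_run, PMF.support_map]
  exact ⟨s', hs', rfl⟩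

/-- A program that never writes its loop registers runs each loop, also a nested one, as often as
their initial values say, whatever the oracles answer. The weights `(1,0,0)`, `(0,1,0)`, `(0,0,1)`
single out one of the three counters. -/
theorem used_le {n : ℕ} (w : ℕ) (ψ : PureState n) (c dsample dshot : ℕ) (v : ℕ → ℕ) (p : Prog)
    (hp : ∀ r ∈ p.lregs, r ∉ p.wregs) :
    ∀ s : RAM, (∀ r ∈ p.lregs, s.reg r = v r) → ∀ s' ∈ (p.run w ψ s).support,
      s'.used c dsample dshot ≤ s.used c dsample dshot + p.cost c dsample dshot v := by
  have htick : ∀ s : RAM, s.tick.used c dsample dshot = s.used c dsample dshot + c := by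
    intro s
    simp only [RAM.used, RAM.tick]
    ring
  induction p with
  | const r x =>
    intro s _ s' hs'
    simp only [run, PMF.mem_support_pure_iff] at hs'
    subst hs'
    exact (htick s).le
  | op o r a b =>
    intro s _ s' hs'
    simp only [run, PMF.mem_support_pure_iff] at hs'
    subst hs'
    exact (htick s).le
  | load r A a =>
    intro s _ s' hs'
    simp only [run, PMF.mem_support_pure_iff] at hs'
    subst hs'
    exact (htick s).le
  | store A a b =>
    intro s _ s' hs'
    simp only [run, PMF.mem_support_pure_iff] at hs'
    subst hs'
    exact (htick s).le
  | sample rx rz =>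
    intro s _ s' hs'
    simp only [run, PMF.support_map] at hs'
    obtain ⟨P, -, rfl⟩ := hs'
    simp only [RAM.used, cost, RAM.setReg]
    apply le_of_eq
    ring
  | measure r rx rz =>
    intro s _ s' hs'
    simp only [run, PMF.support_map] at hs'
    obtain ⟨P, -, rfl⟩ := hs'
    simp only [RAM.used, cost, RAM.setReg]
    apply le_of_eq
    ring
  | seq p q ihp ihq =>
    intro s hv s' hs'
    simp only [lregs, wregs, List.mem_append, not_or] at hp hv
    simp only [run, PMF.mem_support_bind_iff] at hs'
    obtain ⟨s₁, h1, h2⟩ := hs'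
    have a1 := ihp (fun r hr => (hp r (Or.inl hr)).1) s (fun r hr => hv r (Or.inl hr)) s₁ h1
    have a2 := ihq (fun r hr => (hp r (Or.inr hr)).2) s₁ (fun r hr => by
      rw [run_frame w ψ p s s₁ h1 r (hp r (Or.inr hr)).1, hv r (Or.inr hr)]) s' h2
    simp only [cost]
    omega
  | ite r p q ihp ihq =>
    intro s hv s' hs'
    simp only [lregs, wregs, List.mem_append, not_or] at hp hv
    simp only [run] at hs'
    simp only [cost]
    split_ifs at hs'
    · have := ihp (fun r hr => (hp r (Or.inl hr)).1) s.tick (fun r hr => hv r (Or.inl hr)) s' hs'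
      rw [htick] at this
      omega
    · have := ihq (fun r hr => (hp r (Or.inr hr)).2) s.tick (fun r hr => hv r (Or.inr hr)) s' hs'
      rw [htick] at this
      omega
  | loop r p ih =>
    intro s hv s' hs'
    simp only [lregs, wregs, List.mem_cons] at hp hv
    simp only [run] at hs'
    rw [hv r (Or.inl rfl)] at hs'
    simp only [cost]
    have key := PMF.iter_support (f := fun s' => p.run w ψ s'.tick) (a := s.tick) (N := v r)
      (I := fun i b => (∀ r ∈ p.lregs, b.reg r = v r) ∧ b.used c dsample dshot ≤
        s.used c dsample dshot + (c + i * (c + p.cost c dsample dshot v)))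
      ⟨fun r hr => hv r (Or.inr hr), by rw [htick]; omega⟩ (by
        rintro i - b ⟨hb, hu⟩ b' hb'
        have := ih (fun r hr => hp r (Or.inr hr)) b.tick hb b' hb'
        refine ⟨fun r hr => ?_, ?_⟩
        · rw [run_frame w ψ p _ b' hb' r (hp r (Or.inr hr))]
          exact hb r hr
        · rw [htick] at this
          rw [add_mul]
          omega) s' hs'
    exact key.2

end Prog
end

noncomputable section

/-! ## Reduced tables of binary vectors -/

/-- Binary vectors, of which the first `N` entries matter. -/
abbrev Vec : Type := ℕ → ZMod 2

theorem vec_add_self (y : Vec) : y + y = 0 := by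
  funext i
  exact CharTwo.add_self_eq_zero _

/-- The inner product of the first `N` entries. -/
def dot (N : ℕ) (x y : Vec) : ZMod 2 := ∑ p ∈ Finset.range N, x p * y p

theorem dot_add_left (N : ℕ) (x x' y : Vec) : dot N (x + x') y = dot N x y + dot N x' y := by
  simp [dot, add_mul, Finset.sum_add_distrib]

theorem dot_comm (N : ℕ) (x y : Vec) : dot N x y = dot N y x := by
  simp [dot, mul_comm]

theorem dot_smul_left (N : ℕ) (c : ZMod 2) (x y : Vec) : dot N (c • x) y = c * dot N x y := by
  simp [dot, Finset.mul_sum, mul_assoc]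

theorem dot_zero_left (N : ℕ) (y : Vec) : dot N 0 y = 0 := by simp [dot]

theorem dot_sum_left {ι : Type*} (N : ℕ) (s : Finset ι) (f : ι → Vec) (y : Vec) :
    dot N (∑ i ∈ s, f i) y = ∑ i ∈ s, dot N (f i) y := by
  classical
  induction s using Finset.induction_on with
  | empty => simp [dot_zero_left]
  | insert i s hi ih => rw [Finset.sum_insert hi, Finset.sum_insert hi, dot_add_left, ih]

/-- A table of vectors `T p` such that the entry `p` of the table is `1` in `T p` and `0` in the
other vectors, unless `T p = 0`. -/
def IsReducedTable (T : ℕ → Vec) : Prop := ∀ p p', T p' ≠ 0 → T p p' = if p = p' then 1 else 0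

/-- Add to `y` the vectors of the table that clear its entries. -/
def reduceBy (N : ℕ) (T : ℕ → Vec) (y : Vec) : Vec := y + ∑ p ∈ Finset.range N, y p • T p

/-- `y` is orthogonal to the table. -/
def Orth (N : ℕ) (T : ℕ → Vec) (y : Vec) : Prop := ∀ p < N, dot N (T p) y = 0

/-- `y` has no entries from `N` on. -/
def Short (N : ℕ) (y : Vec) : Prop := ∀ p, N ≤ p → y p = 0

variable {N : ℕ} {T : ℕ → Vec}

theorem reduceBy_add (y y' : Vec) : reduceBy N T (y + y') = reduceBy N T y + reduceBy N T y' := by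
  simp only [reduceBy, Pi.add_apply, add_smul, Finset.sum_add_distrib]
  abel

theorem reduceBy_zero : reduceBy N T 0 = 0 := by simp [reduceBy]

theorem reduceBy_sum {ι : Type*} (s : Finset ι) (f : ι → Vec) :
    reduceBy N T (∑ i ∈ s, f i) = ∑ i ∈ s, reduceBy N T (f i) := by
  classical
  induction s using Finset.induction_on with
  | empty => simp [reduceBy_zero]
  | insert i s hi ih => rw [Finset.sum_insert hi, Finset.sum_insert hi, reduceBy_add, ih]

theorem short_add {y y' : Vec} (h : Short N y) (h' : Short N y') : Short N (y + y') :=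
  fun p hp => by rw [Pi.add_apply, h p hp, h' p hp, add_zero]

theorem short_zero : Short N 0 := fun _ _ => rfl

theorem short_smul {y : Vec} (c : ZMod 2) (h : Short N y) : Short N (c • y) :=
  fun p hp => by rw [Pi.smul_apply, h p hp, smul_zero]

theorem short_sum {ι : Type*} (s : Finset ι) (f : ι → Vec) (h : ∀ i ∈ s, Short N (f i)) :
    Short N (∑ i ∈ s, f i) := fun p hp => by
  rw [Finset.sum_apply]
  exact Finset.sum_eq_zero fun i hi => h i hi p hp

theorem short_reduceBy (hT : ∀ p, Short N (T p)) {y : Vec} (hy : Short N y) :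
    Short N (reduceBy N T y) :=
  short_add hy (short_sum _ _ fun p _ => short_smul _ (hT p))

theorem reduceBy_apply_pivot (hT : IsReducedTable T) (y : Vec) {p : ℕ} (hp : p < N) (h : T p ≠ 0) :
    reduceBy N T y p = 0 := by
  rw [reduceBy, Pi.add_apply, Finset.sum_apply, Finset.sum_eq_single p]
  · rw [Pi.smul_apply, hT p p h, if_pos rfl, smul_eq_mul, mul_one]
    exact CharTwo.add_self_eq_zero _
  · intro b _ hb
    rw [Pi.smul_apply, hT b p h, if_neg hb, smul_zero]
  · intro h'
    exact absurd (Finset.mem_range.mpr hp) h'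

/-- Vectors that vanish at the pivots are not changed. -/
theorem reduceBy_of_vanish {y : Vec} (h : ∀ p < N, T p ≠ 0 → y p = 0) : reduceBy N T y = y := by
  rw [reduceBy, Finset.sum_eq_zero, add_zero]
  intro p hp
  by_cases h0 : T p = 0
  · rw [h0, smul_zero]
  · rw [h p (Finset.mem_range.mp hp) h0, zero_smul]

/-- The values of `reduceBy` after the first `j` table entries. -/
theorem partial_reduce_apply (hT : IsReducedTable T) (y : Vec) {j : ℕ} :
    (y + ∑ p ∈ Finset.range j, y p • T p) j • T j = y j • T j := by
  by_cases h : T j = 0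
  · rw [h, smul_zero, smul_zero]
  · rw [Pi.add_apply, Finset.sum_apply, Finset.sum_eq_zero, add_zero]
    intro p hp
    rw [Pi.smul_apply, hT p j h, if_neg (Finset.mem_range.mp hp).ne, smul_zero]

/-- Inserting the reduced vector thus imposes the same new condition on the orthogonal complement as
inserting the vector itself. -/
theorem dot_reduceBy (y z : Vec) (h : Orth N T z) : dot N (reduceBy N T y) z = dot N y z := by
  rw [reduceBy, dot_add_left, dot_sum_left, Finset.sum_eq_zero, add_zero]
  intro p hp
  rw [dot_smul_left, h p (Finset.mem_range.mp hp), mul_zero]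

/-- Insert the reduced vector `y` with pivot `q` into the table. -/
def insertAt (T : ℕ → Vec) (y : Vec) (q : ℕ) : ℕ → Vec :=
  fun p => if p = q then y else T p + T p q • y

theorem insertAt_isReduced (hT : IsReducedTable T) {y : Vec} {q : ℕ} (hy : ∀ p, T p ≠ 0 → y p = 0)
    (hq : y q = 1) : IsReducedTable (insertAt T y q) := by
  have hTq : T q = 0 := by
    by_contra h
    rw [hy q h] at hq
    exact zero_ne_one hq
  intro p p' hp'
  by_cases h1 : p' = q
  · subst h1
    by_cases h2 : p = p'
    · simp [insertAt, h2, hq]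
    · simp [insertAt, h2, hq, CharTwo.add_self_eq_zero]
  · have hTp' : T p' ≠ 0 := by
      intro h
      apply hp'
      simp [insertAt, h1, h]
    by_cases h2 : p = q
    · subst h2
      simp [insertAt, hy p' hTp', Ne.symm h1]
    · simp [insertAt, h2, hy p' hTp', hT p p' hTp']

theorem orth_insertAt {y z : Vec} {q : ℕ} (hqN : q < N) (hTq : T q = 0) :
    Orth N (insertAt T y q) z ↔ Orth N T z ∧ dot N y z = 0 := by
  constructor
  · intro h
    have hy : dot N y z = 0 := by simpa [insertAt] using h q hqN
    refine ⟨fun p hp => ?_, hy⟩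
    by_cases hpq : p = q
    · rw [hpq, hTq, dot_zero_left]
    · have := h p hp
      rwa [insertAt, if_neg hpq, dot_add_left, dot_smul_left, hy, mul_zero, add_zero] at this
  · rintro ⟨h, hy⟩ p hp
    by_cases hpq : p = q
    · rw [insertAt, if_pos hpq, hy]
    · rw [insertAt, if_neg hpq, dot_add_left, dot_smul_left, hy, h p hp, mul_zero, add_zero]

/-! ### The orthogonal complement of a reduced table -/

/-- The unit vectors. -/
def unitVec (p : ℕ) : Vec := Pi.single p 1

theorem unitVec_apply (p q : ℕ) : unitVec p q = if q = p then 1 else 0 := by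
  simp [unitVec, Pi.single_apply]

theorem sum_smul_unitVec_apply (c : ℕ → ZMod 2) (q : ℕ) :
    (∑ p ∈ Finset.range N, c p • unitVec p) q = if q < N then c q else 0 := by
  rw [Finset.sum_apply]
  simp only [Pi.smul_apply, unitVec_apply, smul_eq_mul, mul_ite, mul_one, mul_zero]
  rw [Finset.sum_ite_eq]
  simp

open Classical in
/-- The table of the orthogonal complement. -/
def dualTable (N : ℕ) (T : ℕ → Vec) (f : ℕ) : Vec :=
  -- The usual kernel basis: if the table reads `(1 | A)` with the pivot columns first, then the
  -- columns of `A` stacked on `1` span the kernel, one vector per free entry `f`.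
  if f < N ∧ T f = 0 then unitVec f + ∑ p ∈ Finset.range N, T p f • unitVec p else 0

theorem dualTable_apply {f : ℕ} (hf : f < N) (h : T f = 0) (q : ℕ) :
    dualTable N T f q = (if q = f then 1 else 0) + if q < N then T q f else 0 := by
  rw [dualTable, if_pos ⟨hf, h⟩, Pi.add_apply, unitVec_apply, sum_smul_unitVec_apply]

theorem dualTable_ne_zero_iff {f : ℕ} : dualTable N T f ≠ 0 ↔ f < N ∧ T f = 0 := by
  constructor
  · intro h
    by_contra h'
    exact h (if_neg h')
  · rintro ⟨h1, h2⟩ h0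
    have := congrFun h0 f
    rw [dualTable_apply h1 h2, if_pos rfl, if_pos h1, h2] at this
    simp at this

/-- The pivots of the dual table are the free entries of `T`. At a free entry `f'` the sum
contributes `T f' f`, which vanishes because `T f' = 0`. -/
theorem dualTable_isReduced : IsReducedTable (dualTable N T) := by
  intro f f' hf'
  obtain ⟨h1, h2⟩ := dualTable_ne_zero_iff.mp hf'
  by_cases hf : f < N ∧ T f = 0
  · rw [dualTable_apply hf.1 hf.2, h2]
    simp [eq_comm]
  · rw [dualTable, if_neg hf, if_neg]
    · rfl
    · rintro rfl
      exact hf ⟨h1, h2⟩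

theorem short_dualTable (f : ℕ) : Short N (dualTable N T f) := by
  intro p hp
  by_cases hf : f < N ∧ T f = 0
  · rw [dualTable_apply hf.1 hf.2, if_neg (by omega), if_neg (by omega), add_zero]
  · rw [dualTable, if_neg hf]
    rfl

/-- For `z` that vanishes at the free entries, the inner product with `T p` is `z p`. -/
theorem dot_table_of_vanish (hT : IsReducedTable T) {z : Vec} (hz : ∀ f < N, T f = 0 → z f = 0) {p : ℕ}
    (hp : p < N) (h : T p ≠ 0) : dot N (T p) z = z p := by
  rw [dot, Finset.sum_eq_single p]
  · rw [hT p p h, if_pos rfl, one_mul]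
  · intro q hq hqp
    by_cases h0 : T q = 0
    · rw [hz q (Finset.mem_range.mp hq) h0, mul_zero]
    · rw [hT p q h0, if_neg (Ne.symm hqp), zero_mul]
  · intro h'
    exact absurd (Finset.mem_range.mpr hp) h'

theorem dot_dualTable {f : ℕ} (hf : f < N) (h : T f = 0) (z : Vec) :
    dot N (dualTable N T f) z = z f + ∑ p ∈ Finset.range N, T p f * z p := by
  rw [dualTable, if_pos ⟨hf, h⟩, dot_add_left, dot_sum_left]
  have hu : ∀ p < N, dot N (unitVec p) z = z p := by
    intro p hp
    simp [dot, unitVec_apply, hp]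
  rw [hu f hf]
  congr 1
  refine Finset.sum_congr rfl fun p hp => ?_
  rw [dot_smul_left, hu p (Finset.mem_range.mp hp)]

theorem orth_dualTable (hT : IsReducedTable T) (f : ℕ) : Orth N T (dualTable N T f) := by
  intro p hp
  by_cases hf : f < N ∧ T f = 0
  · by_cases h0 : T p = 0
    · rw [h0, dot_zero_left]
    · rw [dot_comm, dot_dualTable hf.1 hf.2, Finset.sum_eq_single p]
      · rw [hT p p h0, if_pos rfl, mul_one]
        exact CharTwo.add_self_eq_zero _
      · intro q _ hqp
        by_cases hq0 : T q = 0
        · rw [hq0, Pi.zero_apply, zero_mul]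
        · rw [hT p q hq0, if_neg (Ne.symm hqp), mul_zero]
      · intro h'
        exact absurd (Finset.mem_range.mpr hp) h'
  · rw [dualTable, if_neg hf, dot_comm, dot_zero_left]

/-- Every vector orthogonal to a reduced table is a combination of the dual table. -/
theorem reduceBy_dualTable_eq_zero (hT : IsReducedTable T) {y : Vec} (hy : Short N y) (h : Orth N T y) :
    reduceBy N (dualTable N T) y = 0 := by
  set z := reduceBy N (dualTable N T) y with hz
  -- After reduction `z` vanishes at the free entries. There is then no other contribution to its
  -- inner product with a row `T p` than `z p`, so orthogonality kills the pivot entries too.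
  have hfree : ∀ f < N, T f = 0 → z f = 0 := fun f hf h0 =>
    reduceBy_apply_pivot dualTable_isReduced y hf (dualTable_ne_zero_iff.mpr ⟨hf, h0⟩)
  funext p
  by_cases hp : p < N
  · by_cases h0 : T p = 0
    · exact hfree p hp h0
    · rw [← dot_table_of_vanish hT hfree hp h0, dot_comm, hz, reduceBy, dot_add_left, dot_sum_left,
        Finset.sum_eq_zero, add_zero, dot_comm, h p hp]
      · rfl
      · intro f _
        rw [dot_smul_left, dot_comm, orth_dualTable hT f p hp, mul_zero]
  · exact short_reduceBy (fun f => short_dualTable f) hy p (by omega)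

/-- Every vector orthogonal to the dual table is a combination of the table. -/
theorem reduceBy_eq_zero_of_orth_dualTable (hT : IsReducedTable T) (hs : ∀ p, Short N (T p)) {y : Vec}
    (hy : Short N y) (h : Orth N (dualTable N T) y) : reduceBy N T y = 0 := by
  set z := reduceBy N T y with hz
  have hpiv : ∀ p < N, T p ≠ 0 → z p = 0 := fun p hp h0 => reduceBy_apply_pivot hT y hp h0
  funext f
  by_cases hf : f < N
  · by_cases h0 : T f = 0
    · have h1 : dot N (dualTable N T f) z = z f := by
        rw [dot_dualTable hf h0, Finset.sum_eq_zero, add_zero]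
        intro p hp
        by_cases hp0 : T p = 0
        · rw [hp0, Pi.zero_apply, zero_mul]
        · rw [hpiv p (Finset.mem_range.mp hp) hp0, mul_zero]
      rw [← h1, dot_comm, hz, dot_reduceBy _ _ (orth_dualTable hT f), dot_comm, h f hf]
      rfl
    · exact hpiv f hf h0
  · exact short_reduceBy hs hy f (by omega)

theorem eq_sum_of_reduceBy_eq_zero {y : Vec} (h : reduceBy N T y = 0) :
    y = ∑ p ∈ Finset.range N, y p • T p := by
  rw [reduceBy] at h
  have := congrArg (· + ∑ p ∈ Finset.range N, y p • T p) h
  simpa [add_assoc, vec_add_self] using this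

/-! ## Words as vectors -/

/-- The bits of a word. -/
def bits (v : ℕ) : Vec := fun p => if v.testBit p then 1 else 0

theorem bits_injective : Function.Injective bits := by
  intro v v' h
  refine Nat.eq_of_testBit_eq fun i => ?_
  have := congrFun h i
  simp only [bits] at this
  cases h1 : v.testBit i <;> cases h2 : v'.testBit i <;> simp_all

theorem bits_xor (v v' : ℕ) : bits (v ^^^ v') = bits v + bits v' := by
  funext i
  simp only [bits, Nat.testBit_xor, Pi.add_apply]
  cases v.testBit i <;> cases v'.testBit i <;> simp [CharTwo.add_self_eq_zero]

theorem bits_zero : bits 0 = 0 := by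
  funext i
  simp [bits]

theorem bits_eq_zero_iff {v : ℕ} : bits v = 0 ↔ v = 0 := by
  rw [← bits_zero]
  exact bits_injective.eq_iff

theorem bits_one_shiftLeft (p : ℕ) : bits (1 <<< p) = unitVec p := by
  funext i
  rw [unitVec_apply, Nat.one_shiftLeft]
  simp only [bits, Nat.testBit_two_pow]
  by_cases h : p = i
  · simp [h]
  · simp [h, Ne.symm h]

theorem short_bits_iff {v : ℕ} : Short N (bits v) ↔ v < 2 ^ N := by
  constructor
  · intro h
    refine Nat.lt_pow_two_of_testBit v fun i hi => ?_
    have := h i hi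
    by_contra h'
    simp [bits, h'] at this
  · intro h p hp
    simp [bits, Nat.testBit_lt_two_pow (lt_of_lt_of_le h (Nat.pow_le_pow_right (by norm_num) hp))]

theorem shiftRight_mod_two (v p : ℕ) : v >>> p % 2 = if v.testBit p then 1 else 0 := by
  rw [Nat.testBit_eq_decide_div_mod_eq, Nat.shiftRight_eq_div_pow]
  have := Nat.mod_two_eq_zero_or_one (v / 2 ^ p)
  rcases this with h | h <;> simp [h]

theorem bits_apply_eq_one {v p : ℕ} : bits v p = 1 ↔ v.testBit p = true := by
  simp [bits]

/-- The Pauli string with the given bits, the `x`-bits first. -/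
def toPauli (n : ℕ) (y : Vec) : Pauli n := fun i => (y i, y (i + n))

theorem toPauli_add (n : ℕ) (y y' : Vec) : toPauli n (y + y') = toPauli n y + toPauli n y' := rfl

theorem toPauli_zero (n : ℕ) : toPauli n 0 = 0 := rfl

theorem toPauli_smul (n : ℕ) (c : ZMod 2) (y : Vec) : toPauli n (c • y) = c • toPauli n y := rfl

theorem toPauli_sum {ι : Type*} (n : ℕ) (s : Finset ι) (f : ι → Vec) :
    toPauli n (∑ i ∈ s, f i) = ∑ i ∈ s, toPauli n (f i) := by
  classical
  induction s using Finset.induction_on with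
  | empty => simp [toPauli_zero]
  | insert i s hi ih => rw [Finset.sum_insert hi, Finset.sum_insert hi, toPauli_add, ih]

/-- The bits of a Pauli string, the `x`-bits first. -/
def ofPauli {n : ℕ} (P : Pauli n) : Vec := fun p =>
  if h : p < n then (P ⟨p, h⟩).1 else if h : p - n < n then (P ⟨p - n, h⟩).2 else 0

theorem toPauli_ofPauli {n : ℕ} (P : Pauli n) : toPauli n (ofPauli P) = P := by
  funext i
  simp [toPauli, ofPauli]

theorem short_ofPauli {n : ℕ} (P : Pauli n) : Short (2 * n) (ofPauli P) := by
  intro p hp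
  rw [ofPauli, dif_neg (by omega), dif_neg (by omega)]

theorem toPauli_injOn {n : ℕ} {y y' : Vec} (h : Short (2 * n) y) (h' : Short (2 * n) y')
    (heq : toPauli n y = toPauli n y') : y = y' := by
  funext p
  by_cases hp : p < n
  · exact congrArg Prod.fst (congrFun heq ⟨p, hp⟩)
  · by_cases hp' : p < 2 * n
    · have := congrArg Prod.snd (congrFun heq ⟨p - n, by omega⟩)
      simp only [toPauli] at this
      rwa [show p - n + n = p by omega] at this
    · rw [h p (by omega), h' p (by omega)]

theorem ofPauli_toPauli {n : ℕ} {y : Vec} (h : Short (2 * n) y) : ofPauli (toPauli n y) = y :=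
  toPauli_injOn (short_ofPauli _) h (toPauli_ofPauli _)

/-- Exchange the `x`-bits and the `z`-bits. -/
def swapHalves (n : ℕ) (y : Vec) : Vec := fun p =>
  if p < n then y (p + n) else if p < 2 * n then y (p - n) else 0

theorem swapHalves_add (n : ℕ) (y y' : Vec) :
    swapHalves n (y + y') = swapHalves n y + swapHalves n y' := by
  funext p
  simp only [swapHalves, Pi.add_apply]
  split_ifs <;> simp

theorem short_swapHalves (n : ℕ) (y : Vec) : Short (2 * n) (swapHalves n y) := by
  intro p hp
  rw [swapHalves, if_neg (by omega), if_neg (by omega)]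

theorem swapHalves_swapHalves {n : ℕ} {y : Vec} (h : Short (2 * n) y) :
    swapHalves n (swapHalves n y) = y := by
  funext p
  simp only [swapHalves]
  split_ifs with h1 h2 h3 h4 h5 h6
  · omega
  · congr 1; omega
  · omega
  · congr 1; omega
  · omega
  · omega
  · rw [h p (by omega)]

/-- With samples stored in swapped form, the symplectic complement becomes an ordinary orthogonal
complement, and the dual table directly consists of Pauli strings that commute with all samples. -/
theorem dot_swapHalves {n : ℕ} (y z : Vec) :
    dot (2 * n) (swapHalves n y) z = symp (toPauli n y) (toPauli n z) := by
  rw [dot, two_mul, Finset.sum_range_add, symp, Finset.sum_range, Finset.sum_range,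
    ← Finset.sum_add_distrib]
  refine Finset.sum_congr rfl fun i _ => ?_
  have h1 : swapHalves n y i = y (i + n) := if_pos i.2
  have h2 : swapHalves n y (n + i) = y i := by
    rw [swapHalves, if_neg (by omega), if_pos (by omega)]
    congr 1
    omega
  rw [h1, h2, toPauli, toPauli, add_comm n]
  ring

theorem decodePauli_eq (n v : ℕ) : decodePauli n v (v >>> n) = toPauli n (bits v) := by
  funext i
  simp [decodePauli, toPauli, bits, Nat.testBit_shiftRight, add_comm]

end

noncomputable section

/-! ## Reading off the exact description from a table of the stabilizer group -/

theorem sum_smul_congr_table {N : ℕ} {T : ℕ → Vec} {y z : Vec}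
    (h : ∀ p < N, T p ≠ 0 → y p = z p) :
    ∑ p ∈ Finset.range N, y p • T p = ∑ p ∈ Finset.range N, z p • T p := by
  refine Finset.sum_congr rfl fun p hp => ?_
  by_cases h0 : T p = 0
  · rw [h0, smul_zero, smul_zero]
  · rw [h p (Finset.mem_range.mp hp) h0]

/-- A reduced table whose orthogonal complement is the stabilizer group of `ψ`. -/
structure IsStabTable {n : ℕ} (ψ : PureState n) (T : ℕ → Vec) : Prop where
  reduced : IsReducedTable T
  short : ∀ p, Short (2 * n) (T p)
  orth_iff : ∀ Q, Orth (2 * n) T (ofPauli Q) ↔ Q ∈ ψ.stab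

namespace IsStabTable

variable {n : ℕ} {ψ : PureState n} {T : ℕ → Vec}

theorem toPauli_dual_mem (h : IsStabTable ψ T) (f : ℕ) :
    toPauli n (dualTable (2 * n) T f) ∈ ψ.stab := by
  rw [← h.orth_iff, ofPauli_toPauli (short_dualTable f)]
  exact orth_dualTable h.reduced f

theorem ofPauli_eq_sum (h : IsStabTable ψ T) {Q : Pauli n} (hQ : Q ∈ ψ.stab) :
    ofPauli Q = ∑ f ∈ Finset.range (2 * n), ofPauli Q f • dualTable (2 * n) T f :=
  eq_sum_of_reduceBy_eq_zero
    (reduceBy_dualTable_eq_zero h.reduced (short_ofPauli Q) ((h.orth_iff Q).mpr hQ))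

theorem smul_mem_stab {Q : Pauli n} (hQ : Q ∈ ψ.stab) (c : ZMod 2) : c • Q ∈ ψ.stabSubgroup := by
  rcases zmod2_cases c with rfl | rfl
  · rw [zero_smul]; exact zero_mem _
  · rw [one_smul]; exact hQ

theorem sum_dual_mem (h : IsStabTable ψ T) (c : ℕ → ZMod 2) :
    toPauli n (∑ f ∈ Finset.range (2 * n), c f • dualTable (2 * n) T f) ∈ ψ.stab := by
  rw [toPauli_sum]
  change _ ∈ ψ.stabSubgroup
  exact sum_mem fun f _ => smul_mem_stab (h.toPauli_dual_mem f) _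

/-- A stabilizer that vanishes at the free entries is trivial. -/
theorem eq_zero_of_vanish (h : IsStabTable ψ T) {y : Vec} (hy : Short (2 * n) y)
    (hQ : toPauli n y ∈ ψ.stab) (hv : ∀ f < 2 * n, T f = 0 → y f = 0) : y = 0 := by
  have h1 := h.ofPauli_eq_sum hQ
  rw [ofPauli_toPauli hy] at h1
  rw [h1]
  refine Finset.sum_eq_zero fun f hf => ?_
  by_cases h0 : T f = 0
  · rw [hv f (Finset.mem_range.mp hf) h0, zero_smul]
  · have : dualTable (2 * n) T f = 0 := by
      by_contra h'
      exact h0 (dualTable_ne_zero_iff.mp h').2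
    rw [this, smul_zero]

open Classical in
/-- The free entries. -/
def freeSet (n : ℕ) (T : ℕ → Vec) : Finset ℕ := (Finset.range (2 * n)).filter fun f => T f = 0

theorem mem_freeSet {f : ℕ} : f ∈ freeSet n T ↔ f < 2 * n ∧ T f = 0 := by
  simp [freeSet]

/-- A stabilizer is a combination of the dual table with its own entries at the free positions as
coefficients, and these can be prescribed at will. -/
theorem ncard_stab (h : IsStabTable ψ T) : ψ.stab.ncard = 2 ^ (freeSet n T).card := by
  classical
  have hb : Function.Bijective fun (Q : ψ.stab) (f : freeSet n T) => ofPauli (Q : Pauli n) f := by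
    constructor
    · rintro ⟨Q, hQ⟩ ⟨Q', hQ'⟩ heq
      apply Subtype.ext
      change Q = Q'
      rw [← toPauli_ofPauli Q, ← toPauli_ofPauli Q', h.ofPauli_eq_sum hQ, h.ofPauli_eq_sum hQ']
      congr 1
      refine sum_smul_congr_table fun f hf h0 => ?_
      exact congrFun heq ⟨f, mem_freeSet.mpr (dualTable_ne_zero_iff.mp h0)⟩
    · intro c
      let c' : ℕ → ZMod 2 := fun f => if hf : f ∈ freeSet n T then c ⟨f, hf⟩ else 0
      refine ⟨⟨_, h.sum_dual_mem c'⟩, ?_⟩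
      funext f
      obtain ⟨f, hf⟩ := f
      simp only
      rw [ofPauli_toPauli (short_sum _ _ fun f _ => short_smul _ (short_dualTable f)),
        Finset.sum_apply, Finset.sum_eq_single f]
      · rw [Pi.smul_apply, dualTable_isReduced f f (dualTable_ne_zero_iff.mpr (mem_freeSet.mp hf)),
          if_pos rfl, smul_eq_mul, mul_one]
        simp [c', hf]
      · intro b _ hb
        rw [Pi.smul_apply, dualTable_isReduced b f (dualTable_ne_zero_iff.mpr (mem_freeSet.mp hf)),
          if_neg hb, smul_zero]
      · intro h'
        exact absurd (Finset.mem_range.mpr (mem_freeSet.mp hf).1) h'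
  have := Nat.card_eq_of_bijective _ hb
  rw [Set.ncard_def, Set.encard, ENat.card_eq_coe_natCard, ENat.toNat_natCast, this]
  simp

/-! ### The commutant of the stabilizer group and its cosets -/

theorem symp_stab {g g' : Pauli n} (hg : g ∈ ψ.stab) (hg' : g' ∈ ψ.stab) : symp g g' = 0 :=
  ψ.symp_eq_zero_of_mem hg' (ψ.stab_subset_supp hg)

/-- A Pauli string that commutes with the stabilizer group is a combination of the table. -/
theorem eq_sum_swap (h : IsStabTable ψ T) {y : Vec}
    (hc : ∀ g ∈ ψ.stab, symp (toPauli n y) g = 0) :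
    swapHalves n y = ∑ p ∈ Finset.range (2 * n), swapHalves n y p • T p := by
  refine eq_sum_of_reduceBy_eq_zero (reduceBy_eq_zero_of_orth_dualTable h.reduced h.short
    (short_swapHalves n y) fun f _ => ?_)
  rw [dot_comm, dot_swapHalves]
  exact hc _ (h.toPauli_dual_mem f)

/-- There are at most `4 ^ t` reduced Pauli strings that commute with the stabilizer group. -/
theorem card_le (h : IsStabTable ψ T) {t : ℕ} (ht : ψ.IsArithmetic t) (S : Finset Vec)
    (hshort : ∀ y ∈ S, Short (2 * n) y) (hv : ∀ y ∈ S, ∀ f < 2 * n, T f = 0 → y f = 0)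
    (hc : ∀ y ∈ S, ∀ g ∈ ψ.stab, symp (toPauli n y) g = 0) : S.card ≤ 4 ^ t := by
  classical
  set F := freeSet n T with hF
  set Pv := (Finset.range (2 * n)) \ F with hPv
  -- The string `y + g` commutes with the stabilizer group, so its swapped vector is a combination
  -- of the table and is determined by its entries at the pivots. Reduction by the dual table then
  -- recovers `y`, and hence `g`.
  have hinj : Function.Injective fun (x : S × ψ.stab) (p : Pv) =>
      swapHalves n ((x.1 : Vec) + ofPauli (x.2 : Pauli n)) p := by
    rintro ⟨⟨y, hy⟩, ⟨g, hg⟩⟩ ⟨⟨y', hy'⟩, ⟨g', hg'⟩⟩ heq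
    simp only at heq
    have hcomm : ∀ y ∈ S, ∀ g ∈ ψ.stab, ∀ g' ∈ ψ.stab, symp (toPauli n (y + ofPauli g)) g' = 0 := by
      intro y hy g hg g' hg'
      rw [toPauli_add, symp_add_left, hc y hy g' hg', toPauli_ofPauli, symp_stab hg hg', add_zero]
    have hs : ∀ y ∈ S, ∀ g : Pauli n, Short (2 * n) (y + ofPauli g) := fun y hy g =>
      short_add (hshort y hy) (short_ofPauli g)
    have e1 : y + ofPauli g = y' + ofPauli g' := by
      rw [← swapHalves_swapHalves (hs y hy g), ← swapHalves_swapHalves (hs y' hy' g'),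
        h.eq_sum_swap (hcomm y hy g hg), h.eq_sum_swap (hcomm y' hy' g' hg')]
      congr 1
      refine sum_smul_congr_table fun p hp h0 => ?_
      exact congrFun heq ⟨p, Finset.mem_sdiff.mpr ⟨Finset.mem_range.mpr hp, fun hf =>
        h0 (mem_freeSet.mp hf).2⟩⟩
    have e2 : ∀ y ∈ S, ∀ g ∈ ψ.stab, reduceBy (2 * n) (dualTable (2 * n) T) (y + ofPauli g) = y := by
      intro y hy g hg
      rw [reduceBy_add, reduceBy_dualTable_eq_zero h.reduced (short_ofPauli g)
        ((h.orth_iff g).mpr hg), add_zero]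
      exact reduceBy_of_vanish fun f hf h0 => hv y hy f hf (dualTable_ne_zero_iff.mp h0).2
    have e3 : y = y' := by rw [← e2 y hy g hg, e1, e2 y' hy' g' hg']
    subst e3
    have e4 : g = g' := by
      rw [← toPauli_ofPauli g, add_left_cancel e1, toPauli_ofPauli]
    subst e4
    rfl
  have hle := Nat.card_le_card_of_injective _ hinj
  have hFcard : F.card ≤ 2 * n := by
    have := Finset.card_filter_le (Finset.range (2 * n)) fun f => T f = 0
    rwa [Finset.card_range] at this
  have hPc : Pv.card = 2 * n - F.card := by
    rw [hPv, Finset.card_sdiff_of_subset (by rw [hF]; exact Finset.filter_subset _ _),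
      Finset.card_range]
  have hst : Nat.card ψ.stab = 2 ^ F.card := h.ncard_stab
  rw [Nat.card_prod, hst] at hle
  simp only [Nat.card_eq_fintype_card, Fintype.card_coe, Fintype.card_fun, ZMod.card] at hle
  rw [hPc] at hle
  have h2 := ht.2
  rw [h.ncard_stab, ← hF] at h2
  -- Injectivity gives `|S|·2^f ≤ 2^(2n-f)` with `2^f = |G_ψ|`; the bound `n ≤ t + f` turns this
  -- into `|S| ≤ 4^t`.
  have h3 : S.card * 4 ^ F.card ≤ 4 ^ n := by
    calc S.card * 4 ^ F.card = (S.card * 2 ^ F.card) * 2 ^ F.card := by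
          rw [show (4 : ℕ) = 2 * 2 from rfl, mul_pow]; ring
      _ ≤ 2 ^ (2 * n - F.card) * 2 ^ F.card := by gcongr
      _ = 4 ^ n := by
          rw [← pow_add, Nat.sub_add_cancel hFcard, pow_mul]
          norm_num
  have h4 : 4 ^ n ≤ 4 ^ t * 4 ^ F.card := by
    calc 4 ^ n = (2 ^ n) ^ 2 := by rw [← pow_mul, mul_comm, pow_mul]; norm_num
      _ ≤ (2 ^ t * 2 ^ F.card) ^ 2 := by gcongr
      _ = 4 ^ t * 4 ^ F.card := by
        rw [show (4 : ℕ) = 2 ^ 2 from rfl, ← pow_mul, ← pow_mul]; ring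
  exact Nat.le_of_mul_le_mul_right (h3.trans h4) (by positivity)

/-- The representatives of the cosets of the stabilizer group that were generated by the table. -/
def cosetVec (n : ℕ) (T : ℕ → Vec) (p : ℕ) : Vec :=
  reduceBy (2 * n) (dualTable (2 * n) T) (swapHalves n (T p))

theorem swapHalves_smul (n : ℕ) (c : ZMod 2) (y : Vec) :
    swapHalves n (c • y) = c • swapHalves n y := by
  funext p
  simp only [swapHalves, Pi.smul_apply]
  split_ifs <;> simp

theorem swapHalves_sum {ι : Type*} (n : ℕ) (s : Finset ι) (f : ι → Vec) :
    swapHalves n (∑ i ∈ s, f i) = ∑ i ∈ s, swapHalves n (f i) := by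
  classical
  induction s using Finset.induction_on with
  | empty => funext p; simp [swapHalves]
  | insert i s hi ih => rw [Finset.sum_insert hi, Finset.sum_insert hi, swapHalves_add, ih]

theorem reduceBy_smul {N : ℕ} {U : ℕ → Vec} (c : ZMod 2) (y : Vec) :
    reduceBy N U (c • y) = c • reduceBy N U y := by
  rcases zmod2_cases c with rfl | rfl
  · rw [zero_smul, zero_smul, reduceBy_zero]
  · rw [one_smul, one_smul]

/-- Every Pauli string in the support is, up to a stabilizer, a combination of the
coset vectors. -/
theorem exists_coset (h : IsStabTable ψ T) {P : Pauli n} (hP : ψ.expect P ≠ 0) :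
    ∃ c : ℕ → ZMod 2, ∃ g ∈ ψ.stab,
      P = toPauli n (∑ p ∈ Finset.range (2 * n), c p • cosetVec n T p) + g := by
  set y := ofPauli P with hy
  have hys : Short (2 * n) y := short_ofPauli P
  -- A string in the support commutes with the stabilizer group, so it is a combination of the
  -- swapped table rows; reduction is linear and changes it only by a stabilizer.
  have h1 := h.eq_sum_swap (y := y) (fun g hg => by
    rw [hy, toPauli_ofPauli]
    exact ψ.symp_eq_zero_of_mem hg hP)
  refine ⟨swapHalves n y, _, h.sum_dual_mem y, ?_⟩
  have h2 : ∑ p ∈ Finset.range (2 * n), swapHalves n y p • cosetVec n T p =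
      reduceBy (2 * n) (dualTable (2 * n) T) y := by
    conv_rhs => rw [← swapHalves_swapHalves hys, h1, swapHalves_sum, reduceBy_sum]
    refine Finset.sum_congr rfl fun p _ => ?_
    rw [swapHalves_smul, reduceBy_smul, cosetVec]
  rw [h2, ← toPauli_add, reduceBy, add_assoc, vec_add_self, add_zero, hy, toPauli_ofPauli]

/-- The interface between algebra and program: the hypotheses are what the memory provides, and `l`
may contain repeated zeros. The cosets are disjoint because two representatives of one coset differ
by a stabilizer that vanishes at the free entries, which is trivial. -/
theorem isExact (h : IsStabTable ψ T) (D : Description n) (M : ℕ) (l : ℕ → Vec)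
    (hg₁ : ∀ j, ∃ f < 2 * n, T f = 0 ∧ D.g j = toPauli n (dualTable (2 * n) T f))
    (hg₂ : ∀ f < 2 * n, T f = 0 → ∃ j, D.g j = toPauli n (dualTable (2 * n) T f))
    (hm : D.m = (freeSet n T).card)
    (hφ : ∀ j, ψ.expect (D.g j) = D.φ j)
    (hshort : ∀ i < M, Short (2 * n) (l i))
    (hv : ∀ i < M, ∀ f < 2 * n, T f = 0 → l i f = 0)
    (hspan : ∀ c : ℕ → ZMod 2, ∃ i < M, l i = ∑ p ∈ Finset.range (2 * n), c p • cosetVec n T p)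
    (hh₁ : ∀ j, ∃ i < M, l i ≠ 0 ∧ D.h j = toPauli n (l i) ∧ ψ.expect (D.h j) ≠ 0)
    (hh₂ : ∀ i < M, l i ≠ 0 → ψ.expect (toPauli n (l i)) ≠ 0 → ∃ j, D.h j = toPauli n (l i))
    (hinj : Function.Injective D.h)
    (he : ∀ j, ψ.expect (D.h j) = D.e j) : D.IsExact ψ := by
  have generates : (AddSubgroup.closure (Set.range D.g) : Set (Pauli n)) = ψ.stab := by
    refine Set.Subset.antisymm ?_ ?_
    · change (AddSubgroup.closure (Set.range D.g) : Set (Pauli n)) ⊆ ψ.stabSubgroup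
      rw [SetLike.coe_subset_coe, AddSubgroup.closure_le]
      rintro _ ⟨j, rfl⟩
      obtain ⟨f, -, -, hf⟩ := hg₁ j
      rw [hf]
      exact h.toPauli_dual_mem f
    · intro Q hQ
      rw [SetLike.mem_coe, ← toPauli_ofPauli Q, h.ofPauli_eq_sum hQ, toPauli_sum]
      refine sum_mem fun f hf => ?_
      rw [toPauli_smul]
      rcases zmod2_cases (ofPauli Q f) with h0 | h0
      · rw [h0, zero_smul]; exact zero_mem _
      · rw [h0, one_smul]
        by_cases hT : T f = 0
        · obtain ⟨j, hj⟩ := hg₂ f (Finset.mem_range.mp hf) hT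
          rw [← hj]
          exact AddSubgroup.subset_closure ⟨j, rfl⟩
        · have : dualTable (2 * n) T f = 0 := by
            by_contra h'
            exact hT (dualTable_ne_zero_iff.mp h').2
          rw [this]
          exact zero_mem _
  have card : 2 ^ D.m = ψ.stab.ncard := by rw [hm, h.ncard_stab]
  have hrep : ∀ i, ∃ y, Short (2 * n) y ∧ (∀ f < 2 * n, T f = 0 → y f = 0) ∧
      D.rep i = toPauli n y ∧ ψ.expect (D.rep i) ≠ 0 := by
    intro i
    refine Fin.cases ?_ (fun j => ?_) i
    · refine ⟨0, short_zero, fun _ _ _ => rfl, rfl, ?_⟩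
      simp [Description.rep, PureState.expect_zero]
    · obtain ⟨i, hi, -, h1, h2⟩ := hh₁ j
      refine ⟨l i, hshort i hi, hv i hi, ?_, ?_⟩ <;> simpa [Description.rep]
  have hrepinj : Function.Injective D.rep := by
    intro i j
    refine Fin.cases ?_ (fun i => ?_) i <;> refine Fin.cases ?_ (fun j => ?_) j
    · intro _; rfl
    · intro h0
      exfalso
      obtain ⟨i, hi, h1, h2, -⟩ := hh₁ j
      simp only [Description.rep, Fin.cons_zero, Fin.cons_succ] at h0
      rw [h2, ← toPauli_zero] at h0
      exact h1 (toPauli_injOn short_zero (hshort i hi) h0).symm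
    · intro h0
      exfalso
      obtain ⟨i, hi, h1, h2, -⟩ := hh₁ i
      simp only [Description.rep, Fin.cons_zero, Fin.cons_succ] at h0
      rw [h2, ← toPauli_zero] at h0
      exact h1 (toPauli_injOn (hshort i hi) short_zero h0)
    · intro h0
      simp only [Description.rep, Fin.cons_succ] at h0
      rw [hinj h0]
  have cosets : ψ.supp = ⋃ i, (fun Q => D.rep i + Q) '' ψ.stab := by
    ext P
    rw [Set.mem_iUnion]
    constructor
    · intro hP
      obtain ⟨c, g, hg, hPg⟩ := h.exists_coset hP
      obtain ⟨i, hi, hli⟩ := hspan c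
      rw [← hli] at hPg
      have hex : ψ.expect (toPauli n (l i)) ≠ 0 := by
        have h1 := ψ.abs_expect_add_stab hg (toPauli n (l i))
        rw [← hPg] at h1
        have h2 : ψ.expect P ≠ 0 := hP
        rw [← abs_ne_zero, ← h1]
        exact abs_ne_zero.mpr h2
      by_cases h0 : l i = 0
      · refine ⟨0, g, hg, ?_⟩
        rw [hPg, h0]
        simp [Description.rep, toPauli_zero]
      · obtain ⟨j, hj⟩ := hh₂ i hi h0 hex
        refine ⟨j.succ, g, hg, ?_⟩
        rw [hPg]
        simp [Description.rep, hj]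
    · rintro ⟨i, g, hg, rfl⟩
      obtain ⟨-, -, -, -, hne⟩ := hrep i
      change ψ.expect (D.rep i + g) ≠ 0
      rw [← abs_ne_zero, ψ.abs_expect_add_stab hg]
      exact abs_ne_zero.mpr hne
  have disjoint : Pairwise fun i j =>
      Disjoint ((fun Q => D.rep i + Q) '' ψ.stab) ((fun Q => D.rep j + Q) '' ψ.stab) := by
    intro i j hij
    rw [Set.disjoint_left]
    rintro _ ⟨g, hg, rfl⟩ ⟨g', hg', heq⟩
    simp only at heq
    apply hij
    apply hrepinj
    obtain ⟨y, hy, hyv, hyi, -⟩ := hrep i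
    obtain ⟨z, hz, hzv, hzj, -⟩ := hrep j
    have hsum : D.rep i + D.rep j = g + g' := by
      calc D.rep i + D.rep j = (D.rep i + g) + (D.rep j + g') + (g + g') + (g + g + (g' + g'))  := by
            simp only [pauli_add_self, add_zero]
            rw [show D.rep i + g + (D.rep j + g') + (g + g') =
              D.rep i + D.rep j + (g + g) + (g' + g') by abel]
            simp only [pauli_add_self, add_zero]
        _ = g + g' := by
            rw [heq]
            simp only [pauli_add_self, add_zero, zero_add]
    have h0 : y + z = 0 := by
      refine h.eq_zero_of_vanish (short_add hy hz) ?_ fun f hf hT => by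
        rw [Pi.add_apply, hyv f hf hT, hzv f hf hT, add_zero]
      rw [toPauli_add, ← hyi, ← hzj, hsum]
      exact ψ.stabSubgroup.add_mem hg hg'
    have h1 : y = z := by
      have := congrArg (· + z) h0
      simpa [add_assoc, vec_add_self] using this
    rw [hyi, hzj, h1]
  have hstab : ∀ j, D.g j ∈ ψ.stab := fun j => by
    rw [← generates]
    exact AddSubgroup.subset_closure ⟨j, rfl⟩
  exact ⟨generates, card, fun j => by rw [ψ.eigen_of_mem_stab (hstab j), hφ], cosets, disjoint, he,
    ψ.density_eq_toOp D generates card hφ cosets disjoint he⟩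

end IsStabTable
end

noncomputable section

/-! ## The program -/

infixr:60 " ⨾ " => Prog.seq

namespace Learn

open Prog

/-- An instruction that only changes a scratch register. -/
def skip : Prog := .const 45 0

/-- The constants that control the loops: from the inputs `n`, `t` compute `n`, `t`, `2n`, `1`,
`2^t`, the number of samples, `4^t`, the number of shots, the range of the coefficients, the
precision, and a mask. -/
def setup : Prog :=
  -- Register `13` is never written and stays `0`, so adding it copies a register. The inputs leave
  -- registers `0` and `1`, which are cleared at the end to count the output.
  .const 14 1 ⨾ .op .add 10 0 13 ⨾ .op .add 11 1 13 ⨾ .op .add 12 10 10 ⨾ .op .shl 29 14 11 ⨾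
  .const 38 16 ⨾ .op .mul 15 29 10 ⨾ .op .mul 15 15 38 ⨾ .op .mul 16 29 29 ⨾
  .op .mul 17 16 10 ⨾ .const 31 16384 ⨾ .op .mul 17 17 31 ⨾
  .op .add 32 11 14 ⨾ .const 33 2 ⨾ .op .div 32 32 33 ⨾ .op .shl 19 14 32 ⨾
  .op .add 18 19 19 ⨾ .op .add 18 18 14 ⨾ .const 34 5 ⨾ .op .add 20 11 34 ⨾
  .op .shl 21 14 12 ⨾ .op .sub 21 21 14 ⨾ .const 0 0 ⨾ .const 1 0

/-- The step `(q, p) ↦ (q + p, 2q + p)` changes the sign of `p² - 2q²`; from `(1, 1)` it runs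
through the convergents `p/q` of `√2`. -/
def pellStep : Prog :=
  .op .add 35 22 22 ⨾ .op .add 35 35 25 ⨾ .op .add 22 22 25 ⨾ .op .add 25 35 13

/-- The step `(u, v) ↦ (v, 2u)` mirrors `√2^(i+2) = 2√2^i`, so relative errors do not grow. -/
def scaleStep : Prog := .op .add 35 23 23 ⨾ .op .add 23 24 13 ⨾ .op .add 24 35 13

/-- Rational approximations `u / q`, `v / q` of `√2 ^ t`, `√2 ^ (t + 1)`. -/
def approx : Prog :=
  .const 22 1 ⨾ .const 25 1 ⨾ .loop 20 pellStep ⨾ .op .add 23 22 13 ⨾ .op .add 24 25 13 ⨾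
  .loop 11 scaleStep

/-- Constants for the comparison of an estimate with a candidate value. -/
def thresholds : Prog :=
  .op .add 36 23 24 ⨾ .op .mul 36 36 19 ⨾ .op .mul 37 29 22 ⨾ .op .add 36 36 37 ⨾
  .op .mul 36 36 17 ⨾ .op .mul 26 36 38 ⨾ .op .mul 27 17 22 ⨾ .op .add 28 37 37

def reduceStep (A : ℕ) : Prog :=
  .op .shr 44 42 43 ⨾ .op .and 44 44 14 ⨾ .load 45 A 43 ⨾ .op .mul 45 45 44 ⨾
  .op .xor 42 42 45 ⨾ .op .add 43 43 14

/-- Reduce the vector in register `42` by the table in array `A`. -/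
def reduce (A : ℕ) : Prog := .const 43 0 ⨾ .loop 12 (reduceStep A)

def pivotStep : Prog :=
  .op .shr 44 42 43 ⨾ .op .and 44 44 14 ⨾ .ite 44 (.op .add 46 43 13) skip ⨾ .op .add 43 43 14

/-- Find a non-zero entry of the vector in register `42`. -/
def findPivot : Prog := .const 43 0 ⨾ .loop 12 pivotStep

def updateStep : Prog :=
  .load 45 10 43 ⨾ .op .shr 44 45 46 ⨾ .op .and 44 44 14 ⨾ .op .mul 44 44 42 ⨾
  .op .xor 45 45 44 ⨾ .store 10 43 45 ⨾ .op .add 43 43 14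

/-- Clear the entry in register `46` of the table. -/
def update : Prog := .const 43 0 ⨾ .loop 12 updateStep

/-- Insert the vector in register `42` into the table. -/
def insertVec : Prog := reduce 10 ⨾ .ite 42 (findPivot ⨾ update ⨾ .store 10 46 42) skip

/-- The `z`-bits go to the low half and the `x`-bits to the high half: the sample is stored with its
halves exchanged. -/
def combine : Prog := .op .shl 40 40 10 ⨾ .op .xor 42 41 40

def sampleStep : Prog := .sample 40 41 ⨾ combine ⨾ insertVec

/-- Collect the span of the samples in array `10`. -/
def sampling : Prog := .loop 15 sampleStep

def dualStep : Prog :=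
  .load 45 10 43 ⨾ .op .shr 44 45 47 ⨾ .op .and 44 44 14 ⨾ .op .shl 44 44 43 ⨾
  .op .xor 42 42 44 ⨾ .op .add 43 43 14

/-- The vector of the dual table for the free entry in register `47`. -/
def dualVec : Prog := .op .shl 42 14 47 ⨾ .const 43 0 ⨾ .loop 12 dualStep

def generator : Prog :=
  dualVec ⨾ .store 11 47 42 ⨾ .store 0 0 42 ⨾ .op .shr 48 42 10 ⨾ .store 1 0 48

def recordPhase : Prog := .store 2 0 49 ⨾ .op .add 0 0 14

def generatorStep : Prog :=
  .load 45 10 47 ⨾ .ite 45 skip (generator ⨾ .measure 49 42 48 ⨾ recordPhase) ⨾ .op .add 47 47 14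

/-- The generators of the stabilizer group and their phases. -/
def generators : Prog := .const 47 0 ⨾ .loop 12 generatorStep

def scanStep : Prog :=
  .load 45 12 43 ⨾ .op .eq 45 45 42 ⨾ .op .or 51 51 45 ⨾ .op .add 43 43 14

/-- Is the vector in register `42` in the list? -/
def scan : Prog := .const 51 0 ⨾ .const 43 0 ⨾ .loop 16 scanStep

/-- The loop runs over the full capacity `4^t`, because loop registers may not change; entries
beyond the current length are skipped. -/
def doubleStep : Prog :=
  .op .lt 44 43 50 ⨾ .ite 44 (.load 45 12 43 ⨾ .op .xor 45 45 42 ⨾ .op .add 46 43 50 ⨾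
    .store 12 46 45) skip ⨾ .op .add 43 43 14

/-- Add the vector in register `42` to all entries of the list, and append the results. -/
def double : Prog := .const 43 0 ⨾ .loop 16 doubleStep ⨾ .op .add 50 50 50

/-- The halves of a `2n`-bit word are exchanged by a left and a right shift; the mask removes the
overhang of the left shift. -/
def loadRow : Prog :=
  .load 42 10 47 ⨾ .op .shr 48 42 10 ⨾ .op .shl 42 42 10 ⨾ .op .xor 42 42 48 ⨾ .op .and 42 42 21

def cosetStep : Prog :=
  loadRow ⨾ reduce 11 ⨾ scan ⨾
  .ite 51 skip (.op .lt 52 50 16 ⨾ .ite 52 double skip) ⨾ .op .add 47 47 14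

/-- The list of the coset representatives. -/
def cosets : Prog := .const 47 0 ⨾ .const 50 1 ⨾ .loop 12 cosetStep

def shotStep : Prog := .measure 49 42 48 ⨾ .op .add 53 53 49

/-- Measure the Pauli string in register `42`. -/
def estimate : Prog := .op .shr 48 42 10 ⨾ .const 53 0 ⨾ .loop 17 shotStep

/-- Compare the candidate in registers `60`, `61` with the estimate. -/
def testCandidate : Prog :=
  .op .mul 63 60 23 ⨾ .op .mul 64 61 24 ⨾ .op .add 63 63 64 ⨾ .op .mul 63 63 17 ⨾
  -- One of the two truncated differences is zero, so their sum is the absolute difference.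
  .op .add 63 63 54 ⨾ .op .mul 63 63 38 ⨾ .op .sub 64 63 26 ⨾ .op .sub 65 26 63 ⨾
  .op .add 64 64 65 ⨾ .op .lt 62 64 27

def candidateStep : Prog :=
  testCandidate ⨾ .ite 62 (.op .add 55 60 13 ⨾ .op .add 56 61 13) skip ⨾ .op .add 61 61 14

def candidateRow : Prog := .const 61 0 ⨾ .loop 18 candidateStep ⨾ .op .add 60 60 14

/-- Find the candidate that is close to the estimate. -/
def search : Prog :=
  .op .mul 54 53 28 ⨾ .op .add 55 19 13 ⨾ .op .add 56 19 13 ⨾ .const 60 0 ⨾ .loop 18 candidateRow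

/-- The integers are stored with the offset `2^⌈t/2⌉` in register `19`, which is also written to
arrays `6` and `8`. Two coefficients equal to the offset mean expectation value zero, hence no bad
generator. -/
def record : Prog :=
  .op .eq 57 55 19 ⨾ .op .eq 58 56 19 ⨾ .op .and 57 57 58 ⨾
  .ite 57 skip (.store 3 1 42 ⨾ .store 4 1 48 ⨾ .store 5 1 55 ⨾ .store 6 1 19 ⨾ .store 7 1 56 ⨾
    .store 8 1 19 ⨾ .op .add 1 1 14)

def valueStep : Prog :=
  .load 42 12 47 ⨾ .ite 42 (estimate ⨾ search ⨾ record) skip ⨾ .op .add 47 47 14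

/-- The bad generators and their expectation values. -/
def values : Prog := .const 47 0 ⨾ .loop 16 valueStep

/-- Everything after the setup. -/
def body : Prog := approx ⨾ thresholds ⨾ sampling ⨾ generators ⨾ cosets ⨾ values

/-- The learning algorithm. -/
def algorithm : Prog := setup ⨾ body

/-! ## Its resources -/

/-- The values of the loop registers after the setup. -/
def loopVal (n t : ℕ) (r : ℕ) : ℕ :=
  if r = 11 then t else if r = 12 then 2 * n else if r = 15 then 16 * (2 ^ t * n)
  else if r = 16 then 4 ^ t else if r = 17 then 16384 * (4 ^ t * n)
  else if r = 18 then 2 * 2 ^ ((t + 1) / 2) + 1 else t + 5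

/-- The setup is separated from `body` because it writes the loop registers; afterwards they are
constants, as `used_le` requires. -/
theorem body_lregs : ∀ r ∈ body.lregs, r ∉ body.wregs := by decide

theorem body_lregs_subset : ∀ r ∈ body.lregs, r = 11 ∨ r = 12 ∨ r = 15 ∨ r = 16 ∨ r = 17 ∨ r = 18 ∨ r = 20 := by
  decide

theorem body_cost_samples (n t : ℕ) : body.cost 0 1 0 (loopVal n t) = 16 * (2 ^ t * n) := by
  simp [body, approx, thresholds, sampling, generators, cosets, values, pellStep, scaleStep,
    sampleStep, combine, insertVec, reduce, reduceStep, findPivot, pivotStep, update, updateStep,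
    generatorStep, generator, dualVec, dualStep, recordPhase, cosetStep, loadRow, scan, scanStep,
    double, doubleStep, valueStep, estimate, shotStep, search, candidateRow, candidateStep,
    testCandidate, record, skip, cost, loopVal]

theorem body_cost_shots (n t : ℕ) :
    body.cost 0 0 1 (loopVal n t) = 2 * n + 4 ^ t * (16384 * (4 ^ t * n)) := by
  simp [body, approx, thresholds, sampling, generators, cosets, values, pellStep, scaleStep,
    sampleStep, combine, insertVec, reduce, reduceStep, findPivot, pivotStep, update, updateStep,
    generatorStep, generator, dualVec, dualStep, recordPhase, cosetStep, loadRow, scan, scanStep,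
    double, doubleStep, valueStep, estimate, shotStep, search, candidateRow, candidateStep,
    testCandidate, record, skip, cost, loopVal]

/-- With `a = 2^t` and `h = 2^⌈t/2⌉` the cost is a polynomial in `a`, `h`, `n`, `t`. Since `h² ≤ 2a`
and `t ≤ a`, each monomial is at most a constant times `a⁴n²`; shots contribute order `a⁴n`,
elimination order `an²`, and the search order `a²h²`. -/
theorem body_cost_steps {n : ℕ} (hn : 1 ≤ n) (t : ℕ) :
    body.cost 1 0 0 (loopVal n t) ≤ 40000 * (4 ^ (2 * t) * n ^ 2) := by
  have h4 : 4 ^ t = (2 ^ t) ^ 2 := by rw [← pow_mul, mul_comm, pow_mul]; norm_num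
  have h42 : 4 ^ (2 * t) = (2 ^ t) ^ 4 := by rw [mul_comm, pow_mul, h4]; ring
  have hh : 2 ^ ((t + 1) / 2) * 2 ^ ((t + 1) / 2) ≤ 2 * 2 ^ t := by
    rw [← pow_add, ← pow_succ']
    exact Nat.pow_le_pow_right (by norm_num) (by omega)
  have hh1 : 1 ≤ 2 ^ ((t + 1) / 2) := Nat.one_le_two_pow
  have ha : 1 ≤ 2 ^ t := Nat.one_le_two_pow
  have hta : t ≤ 2 ^ t := Nat.lt_two_pow_self.le
  simp only [body, approx, thresholds, sampling, generators, cosets, values, pellStep, scaleStep,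
    sampleStep, combine, insertVec, reduce, reduceStep, findPivot, pivotStep, update, updateStep,
    generatorStep, generator, dualVec, dualStep, recordPhase, cosetStep, loadRow, scan, scanStep,
    double, doubleStep, valueStep, estimate, shotStep, search, candidateRow, candidateStep,
    testCandidate, record, skip, cost, loopVal, h4, h42, Nat.reduceEqDiff,
    if_true, if_false]
  generalize 2 ^ ((t + 1) / 2) = h at *
  generalize 2 ^ t = a at *
  have m1 : 1 ≤ a ^ 4 * n ^ 2 := Nat.mul_pos (by positivity) (by positivity)
  have p1 : ∀ i ≤ 4, a ^ i ≤ a ^ 4 := fun i hi => Nat.pow_le_pow_right ha hi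
  have p2 : ∀ i ≤ 2, n ^ i ≤ n ^ 2 := fun i hi => Nat.pow_le_pow_right hn hi
  have p3 : ∀ i ≤ 4, ∀ j ≤ 2, a ^ i * n ^ j ≤ a ^ 4 * n ^ 2 := fun i hi j hj =>
    Nat.mul_le_mul (p1 i hi) (p2 j hj)
  have m2 : t ≤ a ^ 4 * n ^ 2 := hta.trans (by simpa using p3 1 (by norm_num) 0 (by norm_num))
  have hha : h ≤ 2 * a := (Nat.le_mul_of_pos_left h hh1).trans hh
  have m3 : h * a ^ 2 ≤ 2 * (a ^ 4 * n ^ 2) := by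
    calc h * a ^ 2 ≤ 2 * a * a ^ 2 := by gcongr
      _ = 2 * (a ^ 3 * n ^ 0) := by ring
      _ ≤ _ := by gcongr 2 * ?_; exact p3 3 (by norm_num) 0 (by norm_num)
  have m4 : h * h * a ^ 2 ≤ 2 * (a ^ 4 * n ^ 2) := by
    calc h * h * a ^ 2 ≤ 2 * a * a ^ 2 := by gcongr
      _ = 2 * (a ^ 3 * n ^ 0) := by ring
      _ ≤ _ := by gcongr 2 * ?_; exact p3 3 (by norm_num) 0 (by norm_num)
  have q1 := p3 0 (by norm_num) 1 (by norm_num)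
  have q2 := p3 1 (by norm_num) 1 (by norm_num)
  have q3 := p3 2 (by norm_num) 1 (by norm_num)
  have q4 := p3 4 (by norm_num) 1 (by norm_num)
  have q5 := p3 0 (by norm_num) 2 (by norm_num)
  have q6 := p3 1 (by norm_num) 2 (by norm_num)
  have q7 := p3 2 (by norm_num) 0 (by norm_num)
  nlinarith only [m1, m2, m3, m4, q1, q2, q3, q4, q5, q6, q7]

/-! ## The setup -/

/-- The constants after the setup. -/
structure Consts (n t : ℕ) (m : Mem) : Prop where
  r10 : m.reg 10 = n
  r11 : m.reg 11 = t
  r12 : m.reg 12 = 2 * n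
  r13 : m.reg 13 = 0
  r14 : m.reg 14 = 1
  r15 : m.reg 15 = 16 * (2 ^ t * n)
  r16 : m.reg 16 = 4 ^ t
  r17 : m.reg 17 = 16384 * (4 ^ t * n)
  r18 : m.reg 18 = 2 * 2 ^ ((t + 1) / 2) + 1
  r19 : m.reg 19 = 2 ^ ((t + 1) / 2)
  r20 : m.reg 20 = t + 5
  r21 : m.reg 21 = 2 ^ (2 * n) - 1
  r29 : m.reg 29 = 2 ^ t
  r38 : m.reg 38 = 16

theorem Consts.of_eq {n t : ℕ} {m m' : Mem} (h : Consts n t m)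
    (heq : ∀ r ∈ [10, 11, 12, 13, 14, 15, 16, 17, 18, 19, 20, 21, 29, 38], m'.reg r = m.reg r) :
    Consts n t m' := by
  simp only [List.forall_mem_cons, List.not_mem_nil, false_imp_iff, implies_true, and_true] at heq
  obtain ⟨a, b, c, d, e, f, g, i, j, k, l, o, p, q⟩ := heq
  exact ⟨a ▸ h.r10, b ▸ h.r11, c ▸ h.r12, d ▸ h.r13, e ▸ h.r14, f ▸ h.r15, g ▸ h.r16, i ▸ h.r17,
    j ▸ h.r18, k ▸ h.r19, l ▸ h.r20, o ▸ h.r21, p ▸ h.r29, q ▸ h.r38⟩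

theorem Consts.exec {n t : ℕ} {m : Mem} (h : Consts n t m) (w : ℕ) (p : Prog)
    (hp : ∀ r ∈ [10, 11, 12, 13, 14, 15, 16, 17, 18, 19, 20, 21, 29, 38], r ∉ p.wregs) :
    Consts n t (p.exec w m) :=
  h.of_eq fun r hr => exec_reg w p m r (hp r hr)

theorem Consts.sem {n t : ℕ} {m m' : Mem} (h : Consts n t m) {w : ℕ} {ψ : PureState n} {p : Prog}
    (hm : m' ∈ (p.sem w ψ m).support)
    (hp : ∀ r ∈ [10, 11, 12, 13, 14, 15, 16, 17, 18, 19, 20, 21, 29, 38], r ∉ p.wregs) :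
    Consts n t m' :=
  h.of_eq fun r hr => (sem_frame w ψ p m m' hm).1 r (hp r hr)

theorem pow_lt_word {n t : ℕ} {a : ℕ} (x : ℕ) (hx : x ≤ 2 ^ a)
    (ha : a < 64 * (n + t)) : x < 2 ^ (64 * (n + t)) :=
  lt_of_le_of_lt hx (Nat.pow_lt_pow_right (by norm_num) ha)

theorem exec_setup {n t : ℕ} (hn : 1 ≤ n) :
    Consts n t (setup.exec (64 * (n + t)) (RAM.init n t).mem) ∧
    (setup.exec (64 * (n + t)) (RAM.init n t).mem).reg 0 = 0 ∧
    (setup.exec (64 * (n + t)) (RAM.init n t).mem).reg 1 = 0 ∧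
    (setup.exec (64 * (n + t)) (RAM.init n t).mem).arr = fun _ _ => 0 := by
  have hnn : n < 2 ^ n := Nat.lt_two_pow_self
  have htt : t < 2 ^ t := Nat.lt_two_pow_self
  have h4 : 4 ^ t = 2 ^ t * 2 ^ t := by rw [← mul_pow]; norm_num
  have e1 : 1 < 2 ^ (64 * (n + t)) := pow_lt_word 1 (a := 0) (by norm_num) (by omega)
  have e2 : n < 2 ^ (64 * (n + t)) := pow_lt_word n hnn.le (by omega)
  have e3 : t < 2 ^ (64 * (n + t)) := pow_lt_word t htt.le (by omega)
  have e4 : n + n < 2 ^ (64 * (n + t)) := pow_lt_word _ (a := n + 1) (by rw [pow_succ]; omega) (by omega)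
  have e5 : 2 ^ t < 2 ^ (64 * (n + t)) := pow_lt_word _ le_rfl (by omega)
  have e6 : 2 ^ t * n * 16 < 2 ^ (64 * (n + t)) := pow_lt_word _ (a := t + n + 4) (by
    rw [pow_add, pow_add]; gcongr; norm_num) (by omega)
  have e7 : 2 ^ t * 2 ^ t < 2 ^ (64 * (n + t)) := by
    rw [← pow_add]; exact pow_lt_word _ le_rfl (by omega)
  have e8 : 2 ^ t * 2 ^ t * n * 16384 < 2 ^ (64 * (n + t)) := pow_lt_word _ (a := t + t + n + 14) (by
    rw [pow_add, pow_add, pow_add]; gcongr; norm_num) (by omega)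
  have e9 : t + 1 < 2 ^ (64 * (n + t)) := pow_lt_word _ (a := t + 1) (by rw [pow_succ]; omega) (by omega)
  have e10 : 2 < 2 ^ (64 * (n + t)) := pow_lt_word _ (a := 1) (by norm_num) (by omega)
  have e11 : (t + 1) / 2 < 2 ^ (64 * (n + t)) := lt_of_le_of_lt (Nat.div_le_self _ _) e9
  have e12 : 2 ^ ((t + 1) / 2) < 2 ^ (64 * (n + t)) := pow_lt_word _ le_rfl (by omega)
  have e13 : 2 ^ ((t + 1) / 2) + 2 ^ ((t + 1) / 2) + 1 < 2 ^ (64 * (n + t)) :=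
    pow_lt_word _ (a := (t + 1) / 2 + 2) (by
      have := Nat.one_le_two_pow (n := (t + 1) / 2); rw [pow_add]; omega) (by omega)
  have e14 : t + 5 < 2 ^ (64 * (n + t)) := pow_lt_word _ (a := t + 3) (by
    rw [pow_add]; omega) (by omega)
  have e15 : 2 ^ (n + n) < 2 ^ (64 * (n + t)) := pow_lt_word _ le_rfl (by omega)
  have e16 : 2 ^ (n + n) - 1 < 2 ^ (64 * (n + t)) := by omega
  have e17 : 16 < 2 ^ (64 * (n + t)) := pow_lt_word _ (a := 4) (by norm_num) (by omega)
  refine ⟨⟨?_, ?_, ?_, ?_, ?_, ?_, ?_, ?_, ?_, ?_, ?_, ?_, ?_, ?_⟩, ?_, ?_, ?_⟩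
  all_goals
    simp [setup, Prog.exec, Mem.setReg, WordOp.eval, RAM.init, RAM.mem,
      Nat.one_shiftLeft, Nat.mod_eq_of_lt e1, Nat.mod_eq_of_lt e2, Nat.mod_eq_of_lt e3,
      Nat.mod_eq_of_lt e4, Nat.mod_eq_of_lt e5, Nat.mod_eq_of_lt e6, Nat.mod_eq_of_lt e7,
      Nat.mod_eq_of_lt e8, Nat.mod_eq_of_lt e9, Nat.mod_eq_of_lt e10, Nat.mod_eq_of_lt e11,
      Nat.mod_eq_of_lt e12, Nat.mod_eq_of_lt e13, Nat.mod_eq_of_lt e14, Nat.mod_eq_of_lt e15,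
      Nat.mod_eq_of_lt e16, Nat.mod_eq_of_lt e17, h4]
  all_goals try ring_nf

theorem algorithm_used_le {n t : ℕ} (hn : 1 ≤ n) (ψ : PureState n) (c dsample dshot : ℕ) (s : RAM)
    (hs : s ∈ (algorithm.run (64 * (n + t)) ψ (RAM.init n t)).support) :
    s.used c dsample dshot ≤
      setup.cost c dsample dshot (loopVal n t) + body.cost c dsample dshot (loopVal n t) := by
  simp only [algorithm, Prog.run, PMF.mem_support_bind_iff] at hs
  obtain ⟨s₁, h1, h2⟩ := hs
  have hu1 := used_le _ ψ c dsample dshot (loopVal n t) setup (by decide) _ (by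
    intro r hr
    exact absurd hr (by revert r; decide)) s₁ h1
  have hm : s₁.mem = setup.exec (64 * (n + t)) (RAM.init n t).mem := by
    have : s₁.mem ∈ (setup.sem (64 * (n + t)) ψ (RAM.init n t).mem).support := by
      rw [← map_mem_run, PMF.support_map]
      exact ⟨s₁, h1, rfl⟩
    rwa [sem_of_isDet _ ψ setup rfl, PMF.mem_support_pure_iff] at this
  have hc := (exec_setup (t := t) hn).1
  rw [← hm] at hc
  have hu2 := used_le _ ψ c dsample dshot (loopVal n t) body body_lregs s₁ (by
    intro r hr
    change s₁.mem.reg r = _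
    rcases body_lregs_subset r hr with rfl | rfl | rfl | rfl | rfl | rfl | rfl
    · exact hc.r11
    · exact hc.r12
    · exact hc.r15
    · exact hc.r16
    · exact hc.r17
    · exact hc.r18
    · exact hc.r20) s h2
  have h0 : (RAM.init n t).used c dsample dshot = 0 := by simp [RAM.used, RAM.init]
  omega

theorem algorithm_resources {n t : ℕ} (hn : 1 ≤ n) (ψ : PureState n) (s : RAM)
    (hs : s ∈ (algorithm.run (64 * (n + t)) ψ (RAM.init n t)).support) :
    s.samples ≤ 16 * (2 ^ t * n) ∧ s.shots ≤ 2 * n + 4 ^ t * (16384 * (4 ^ t * n)) ∧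
      s.steps ≤ 24 + 40000 * (4 ^ (2 * t) * n ^ 2) := by
  have h1 := algorithm_used_le hn ψ 0 1 0 s hs
  have h2 := algorithm_used_le hn ψ 0 0 1 s hs
  have h3 := algorithm_used_le hn ψ 1 0 0 s hs
  rw [body_cost_samples] at h1
  rw [body_cost_shots] at h2
  have h4 := body_cost_steps hn t
  simp only [RAM.used, setup, cost] at h1 h2 h3
  refine ⟨by omega, by omega, by omega⟩

end Learn
end

noncomputable section

/-! ## Correctness of the linear algebra -/

theorem iterate_inv {α : Type*} {f : α → α} {I : ℕ → α → Prop} {N : ℕ} {a : α} (h0 : I 0 a)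
    (hs : ∀ i < N, ∀ b, I i b → I (i + 1) (f b)) : I N (f^[N] a) := by
  induction N with
  | zero => exact h0
  | succ N ih =>
    rw [Function.iterate_succ_apply']
    exact hs N (by omega) _ (ih fun i hi => hs i (by omega))

/-- The table of vectors stored in an array. -/
def tableOf (T : ℕ → ℕ) : ℕ → Vec := fun p => bits (T p)

/-- An array that holds a reduced table of vectors with `N` entries. -/
structure TableOK (N : ℕ) (T : ℕ → ℕ) : Prop where
  reduced : IsReducedTable (tableOf T)
  lt : ∀ p, T p < 2 ^ N
  zero : ∀ p, N ≤ p → T p = 0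

namespace Learn

open Prog

theorem exec_reduceStep {w A i : ℕ} {m : Mem} (h14 : m.reg 14 = 1) (h43 : m.reg 43 = i)
    (hi : i + 1 < 2 ^ w) (hv : m.reg 42 < 2 ^ w) (hT : m.arr A i < 2 ^ w) :
    ((reduceStep A).exec w m).reg 42 =
      m.reg 42 ^^^ (if (m.reg 42).testBit i then m.arr A i else 0) ∧
    ((reduceStep A).exec w m).reg 43 = i + 1 := by
  have e1 : m.reg 42 >>> i % 2 ^ w = m.reg 42 >>> i :=
    Nat.mod_eq_of_lt (lt_of_le_of_lt (Nat.shiftRight_le _ _) hv)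
  have e2 : 1 < 2 ^ w := by omega
  have e3 : (m.reg 42 ^^^ m.arr A i) % 2 ^ w = m.reg 42 ^^^ m.arr A i :=
    Nat.mod_eq_of_lt (Nat.xor_lt_two_pow hv hT)
  constructor
  · by_cases h : (m.reg 42).testBit i <;>
      simp [reduceStep, exec, Mem.setReg, WordOp.eval, h14, h43, e1, shiftRight_mod_two, h,
        Nat.mod_eq_of_lt e2, e3, Nat.mod_eq_of_lt hT, Nat.mod_eq_of_lt hv]
  · simp [reduceStep, exec, Mem.setReg, WordOp.eval, h14, h43, Nat.mod_eq_of_lt hi]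

theorem lt_two_pow_of_le {N w : ℕ} (h : N ≤ w) {v : ℕ} (hv : v < 2 ^ N) : v < 2 ^ w :=
  lt_of_lt_of_le hv (Nat.pow_le_pow_right (by norm_num) h)

theorem succ_lt_word {N w i : ℕ} (h : N ≤ w) (hi : i < N) : i + 1 < 2 ^ w :=
  lt_two_pow_of_le h (lt_of_le_of_lt hi Nat.lt_two_pow_self)

theorem bits_ite (c : Prop) [Decidable c] (v : ℕ) :
    bits (if c then v else 0) = (if c then (1 : ZMod 2) else 0) • bits v := by
  split_ifs
  · rw [one_smul]
  · rw [zero_smul, bits_zero]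

theorem exec_reduce {w N A : ℕ} {m : Mem} (h12 : m.reg 12 = N) (h14 : m.reg 14 = 1) (hN : N ≤ w)
    (hT : TableOK N (m.arr A)) (hv : m.reg 42 < 2 ^ N) :
    ((reduce A).exec w m).reg 42 < 2 ^ N ∧
    bits (((reduce A).exec w m).reg 42) = reduceBy N (tableOf (m.arr A)) (bits (m.reg 42)) := by
  have key := iterate_inv (f := (reduceStep A).exec w) (a := m.setReg w 43 0) (N := N)
    (I := fun i m' => m'.reg 14 = 1 ∧ m'.arr = m.arr ∧ m'.reg 43 = i ∧ m'.reg 42 < 2 ^ N ∧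
      bits (m'.reg 42) = bits (m.reg 42) +
        ∑ p ∈ Finset.range i, bits (m.reg 42) p • tableOf (m.arr A) p)
    ⟨by simp [Mem.setReg, h14], rfl, by simp [Mem.setReg], by simpa [Mem.setReg] using hv,
      by simp [Mem.setReg]⟩ (by
      rintro i hi b ⟨b14, barr, b43, blt, bv⟩
      have hTi : b.arr A i < 2 ^ N := by rw [barr]; exact hT.lt i
      obtain ⟨h1, h2⟩ := exec_reduceStep (A := A) b14 b43 (succ_lt_word hN hi)
        (lt_two_pow_of_le hN blt) (lt_two_pow_of_le hN hTi)
      refine ⟨?_, ?_, h2, ?_, ?_⟩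
      · rw [exec_reg _ _ _ _ (by simp [reduceStep, wregs]), b14]
      · rw [← barr]
        funext B
        rw [exec_arr _ _ _ _ (by simp [reduceStep, warrs])]
      · rw [h1]
        split_ifs
        · exact Nat.xor_lt_two_pow blt hTi
        · simpa using blt
      · rw [h1, bits_xor, bits_ite, Finset.sum_range_succ, ← add_assoc, ← bv]
        congr 1
        -- The program reads entry `i` of the partially reduced vector, while `reduceBy` uses that
        -- of the original one. In a reduced table the earlier rows vanish at the pivot `i`, so the
        -- two agree whenever row `i` is non-zero.
        have := partial_reduce_apply hT.reduced (bits (m.reg 42)) (j := i)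
        rw [← bv] at this
        rw [← this, barr]
        rfl)
  have hx : (reduce A).exec w m = ((reduceStep A).exec w)^[N] (m.setReg w 43 0) := by
    simp [reduce, exec, Mem.setReg, h12]
  rw [hx]
  exact ⟨key.2.2.2.1, key.2.2.2.2⟩

theorem exec_pivotStep {w i : ℕ} {m : Mem} (h13 : m.reg 13 = 0) (h14 : m.reg 14 = 1)
    (h43 : m.reg 43 = i) (hi : i + 1 < 2 ^ w) (hv : m.reg 42 < 2 ^ w) :
    (pivotStep.exec w m).reg 46 = (if (m.reg 42).testBit i then i else m.reg 46) ∧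
    (pivotStep.exec w m).reg 43 = i + 1 := by
  have e1 : m.reg 42 >>> i % 2 ^ w = m.reg 42 >>> i :=
    Nat.mod_eq_of_lt (lt_of_le_of_lt (Nat.shiftRight_le _ _) hv)
  have e2 : 1 < 2 ^ w := by omega
  have e3 : i < 2 ^ w := by omega
  by_cases h : (m.reg 42).testBit i <;>
      simp [pivotStep, skip, exec, Mem.setReg, WordOp.eval, h13, h14, h43, e1, shiftRight_mod_two,
        h, Nat.mod_eq_of_lt e2, Nat.mod_eq_of_lt e3, Nat.mod_eq_of_lt hi]

theorem exec_findPivot {w N : ℕ} {m : Mem} (h12 : m.reg 12 = N) (h13 : m.reg 13 = 0)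
    (h14 : m.reg 14 = 1) (hN : N ≤ w) (hv : m.reg 42 < 2 ^ N) (h0 : m.reg 42 ≠ 0) :
    (findPivot.exec w m).reg 46 < N ∧ (m.reg 42).testBit ((findPivot.exec w m).reg 46) = true := by
  have key := iterate_inv (f := pivotStep.exec w) (a := m.setReg w 43 0) (N := N)
    (I := fun i m' => m'.reg 13 = 0 ∧ m'.reg 14 = 1 ∧ m'.reg 42 = m.reg 42 ∧ m'.reg 43 = i ∧
      ((∃ p < i, (m.reg 42).testBit p = true) →
        m'.reg 46 < i ∧ (m.reg 42).testBit (m'.reg 46) = true))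
    ⟨by simp [Mem.setReg, h13], by simp [Mem.setReg, h14], by simp [Mem.setReg],
      by simp [Mem.setReg], by simp⟩ (by
      rintro i hi b ⟨b13, b14, b42, b43, bq⟩
      obtain ⟨h1, h2⟩ := exec_pivotStep b13 b14 b43 (succ_lt_word hN hi)
        (by rw [b42]; exact lt_two_pow_of_le hN hv)
      refine ⟨?_, ?_, ?_, h2, ?_⟩
      · rw [exec_reg _ _ _ _ (by decide), b13]
      · rw [exec_reg _ _ _ _ (by decide), b14]
      · rw [exec_reg _ _ _ _ (by decide), b42]
      · rintro ⟨p, hp, hbit⟩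
        rw [h1, b42]
        split_ifs with hb
        · exact ⟨by omega, hb⟩
        · have hpi : p < i := by
            rcases Nat.lt_succ_iff_lt_or_eq.mp hp with h | h
            · exact h
            · rw [h] at hbit
              exact absurd hbit hb
          obtain ⟨h3, h4⟩ := bq ⟨p, hpi, hbit⟩
          exact ⟨by omega, h4⟩)
  have hx : findPivot.exec w m = (pivotStep.exec w)^[N] (m.setReg w 43 0) := by
    simp [findPivot, exec, Mem.setReg, h12]
  rw [hx]
  refine key.2.2.2.2 ?_
  obtain ⟨p, hp⟩ := Nat.exists_testBit_of_ne_zero h0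
  refine ⟨p, ?_, hp⟩
  by_contra hpN
  rw [Nat.testBit_lt_two_pow (lt_of_lt_of_le hv (Nat.pow_le_pow_right (by norm_num)
    (not_lt.mp hpN)))] at hp
  exact absurd hp (by decide)

theorem exec_updateStep {w i q : ℕ} {m : Mem} (h14 : m.reg 14 = 1) (h43 : m.reg 43 = i)
    (h46 : m.reg 46 = q) (hi : i + 1 < 2 ^ w) (hv : m.reg 42 < 2 ^ w) (hT : m.arr 10 i < 2 ^ w) :
    (updateStep.exec w m).arr 10 = Function.update (m.arr 10) i
      (m.arr 10 i ^^^ (if (m.arr 10 i).testBit q then m.reg 42 else 0)) ∧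
    (updateStep.exec w m).reg 43 = i + 1 := by
  have e1 : m.arr 10 i >>> q % 2 ^ w = m.arr 10 i >>> q :=
    Nat.mod_eq_of_lt (lt_of_le_of_lt (Nat.shiftRight_le _ _) hT)
  have e2 : 1 < 2 ^ w := by omega
  have e3 : (m.arr 10 i ^^^ m.reg 42) % 2 ^ w = m.arr 10 i ^^^ m.reg 42 :=
    Nat.mod_eq_of_lt (Nat.xor_lt_two_pow hT hv)
  by_cases h : (m.arr 10 i).testBit q <;>
      simp [updateStep, exec, Mem.setReg, Mem.setArr, WordOp.eval, h14, h43, h46, e1,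
        shiftRight_mod_two, h, Nat.mod_eq_of_lt e2, e3, Nat.mod_eq_of_lt hi, Nat.mod_eq_of_lt hT,
        Nat.mod_eq_of_lt hv]

theorem exec_update {w N q : ℕ} {m : Mem} (h12 : m.reg 12 = N) (h14 : m.reg 14 = 1) (hN : N ≤ w)
    (h46 : m.reg 46 = q) (hv : m.reg 42 < 2 ^ N) (hT : ∀ p, m.arr 10 p < 2 ^ N) (p : ℕ) :
    (update.exec w m).arr 10 p = if p < N then
      m.arr 10 p ^^^ (if (m.arr 10 p).testBit q then m.reg 42 else 0) else m.arr 10 p := by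
  have key := iterate_inv (f := updateStep.exec w) (a := m.setReg w 43 0) (N := N)
    (I := fun i m' => m'.reg 14 = 1 ∧ m'.reg 42 = m.reg 42 ∧ m'.reg 43 = i ∧ m'.reg 46 = q ∧
      ∀ p, m'.arr 10 p = if p < i then
        m.arr 10 p ^^^ (if (m.arr 10 p).testBit q then m.reg 42 else 0) else m.arr 10 p)
    ⟨by simp [Mem.setReg, h14], by simp [Mem.setReg], by simp [Mem.setReg],
      by simp [Mem.setReg, h46], by simp [Mem.setReg]⟩ (by
      rintro i hi b ⟨b14, b42, b43, b46, bT⟩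
      have hbi : b.arr 10 i = m.arr 10 i := by rw [bT i, if_neg (lt_irrefl i)]
      obtain ⟨h1, h2⟩ := exec_updateStep b14 b43 b46 (succ_lt_word hN hi)
        (by rw [b42]; exact lt_two_pow_of_le hN hv)
        (by rw [hbi]; exact lt_two_pow_of_le hN (hT i))
      refine ⟨?_, ?_, h2, ?_, ?_⟩
      · rw [exec_reg _ _ _ _ (by decide), b14]
      · rw [exec_reg _ _ _ _ (by decide), b42]
      · rw [exec_reg _ _ _ _ (by decide), b46]
      · intro p
        rw [h1, b42, hbi]
        by_cases hp : p = i
        · subst hp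
          rw [Function.update_self, if_pos (show p < p + 1 by omega)]
        · rw [Function.update_of_ne hp, bT p]
          by_cases hpi : p < i
          · rw [if_pos hpi, if_pos (show p < i + 1 by omega)]
          · rw [if_neg hpi, if_neg (show ¬ p < i + 1 by omega)])
  have hx : update.exec w m = (updateStep.exec w)^[N] (m.setReg w 43 0) := by
    simp [update, exec, Mem.setReg, h12]
  rw [hx]
  exact key.2.2.2.2 p

/-- Inserting a vector keeps the table reduced and intersects its orthogonal complement with that
of the vector. -/
theorem exec_insertVec {w N : ℕ} {m : Mem} (h12 : m.reg 12 = N) (h13 : m.reg 13 = 0)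
    (h14 : m.reg 14 = 1) (hN : N ≤ w) (hT : TableOK N (m.arr 10)) (hv : m.reg 42 < 2 ^ N) :
    TableOK N ((insertVec.exec w m).arr 10) ∧
    ∀ z, Orth N (tableOf ((insertVec.exec w m).arr 10)) z ↔
      Orth N (tableOf (m.arr 10)) z ∧ dot N (bits (m.reg 42)) z = 0 := by
  set m₁ := (reduce 10).exec w m with hm₁
  obtain ⟨hlt, hred⟩ := exec_reduce (A := 10) h12 h14 hN hT hv
  rw [← hm₁] at hlt hred
  have ha₁ : m₁.arr 10 = m.arr 10 := exec_arr _ _ _ _ (by decide)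
  have r12 : m₁.reg 12 = N := by rw [hm₁, exec_reg _ _ _ _ (by decide), h12]
  have r13 : m₁.reg 13 = 0 := by rw [hm₁, exec_reg _ _ _ _ (by decide), h13]
  have r14 : m₁.reg 14 = 1 := by rw [hm₁, exec_reg _ _ _ _ (by decide), h14]
  by_cases h0 : m₁.reg 42 = 0
  · have hx : insertVec.exec w m = skip.exec w m₁ := by
      simp [insertVec, exec, ← hm₁, h0]
    have ha : (insertVec.exec w m).arr 10 = m.arr 10 := by
      rw [hx, exec_arr _ _ _ _ (by decide), ha₁]
    rw [ha]
    refine ⟨hT, fun z => ⟨fun h => ⟨h, ?_⟩, fun h => h.1⟩⟩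
    rw [← dot_reduceBy (bits (m.reg 42)) z h, ← hred, h0, bits_zero, dot_zero_left]
  · have hx : insertVec.exec w m = (store 10 46 42).exec w (update.exec w (findPivot.exec w m₁)) := by
      simp [insertVec, exec, ← hm₁, h0]
    set m₂ := findPivot.exec w m₁ with hm₂
    obtain ⟨hq, hqb⟩ := exec_findPivot r12 r13 r14 hN hlt h0
    rw [← hm₂] at hq hqb
    set q := m₂.reg 46 with hqdef
    have s12 : m₂.reg 12 = N := by rw [hm₂, exec_reg _ _ _ _ (by decide), r12]
    have s14 : m₂.reg 14 = 1 := by rw [hm₂, exec_reg _ _ _ _ (by decide), r14]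
    have s42 : m₂.reg 42 = m₁.reg 42 := by rw [hm₂, exec_reg _ _ _ _ (by decide)]
    have ha₂ : m₂.arr 10 = m.arr 10 := by rw [hm₂, exec_arr _ _ _ _ (by decide), ha₁]
    set y := m₁.reg 42 with hy
    have hup := exec_update s12 s14 hN hqdef.symm (by rw [s42]; exact hlt)
      (by rw [ha₂]; exact hT.lt)
    set m₃ := update.exec w m₂ with hm₃
    have t46 : m₃.reg 46 = q := by rw [hm₃, exec_reg _ _ _ _ (by decide)]
    have t42 : m₃.reg 42 = y := by rw [hm₃, exec_reg _ _ _ _ (by decide), s42]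
    have hfin : (insertVec.exec w m).arr 10 = Function.update (m₃.arr 10) q y := by
      rw [hx]
      simp [exec, Mem.setArr, t46, t42, Nat.mod_eq_of_lt (lt_two_pow_of_le hN hlt)]
    have hpiv : ∀ p, tableOf (m.arr 10) p ≠ 0 → bits y p = 0 := by
      intro p hp
      rw [hred]
      by_cases hpN : p < N
      · exact reduceBy_apply_pivot hT.reduced _ hpN hp
      · exact absurd (by rw [tableOf, hT.zero p (by omega), bits_zero]) hp
    have hyq : bits y q = 1 := bits_apply_eq_one.mpr hqb
    have hTq : tableOf (m.arr 10) q = 0 := by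
      by_contra h
      rw [hpiv q h] at hyq
      exact zero_ne_one hyq
    have htab : tableOf ((insertVec.exec w m).arr 10) = insertAt (tableOf (m.arr 10)) (bits y) q := by
      funext p
      rw [hfin]
      by_cases hpq : p = q
      · rw [tableOf, hpq, Function.update_self, insertAt, if_pos rfl]
      · rw [tableOf, Function.update_of_ne hpq, insertAt, if_neg hpq, hup p, ha₂, s42]
        by_cases hpN : p < N
        · rw [if_pos hpN, bits_xor, bits_ite]
          rfl
        · rw [if_neg hpN]
          rw [tableOf, hT.zero p (by omega), bits_zero]
          simp
    refine ⟨⟨?_, ?_, ?_⟩, fun z => ?_⟩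
    · rw [htab]
      exact insertAt_isReduced hT.reduced hpiv hyq
    · intro p
      rw [hfin]
      by_cases hpq : p = q
      · rw [hpq, Function.update_self]
        exact hlt
      · rw [Function.update_of_ne hpq, hup p, ha₂, s42]
        split_ifs
        · exact Nat.xor_lt_two_pow (hT.lt p) hlt
        · simpa using hT.lt p
        · exact hT.lt p
    · intro p hp
      rw [hfin, Function.update_of_ne (by omega), hup p, if_neg (by omega), ha₂, hT.zero p hp]
    · rw [htab, orth_insertAt hq hTq]
      refine and_congr_right fun h => ?_
      rw [hred, dot_reduceBy _ _ h]

end Learn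
end

noncomputable section

/-! ## The samples -/

theorem encodeBits_lt {n : ℕ} (b : Fin n → ZMod 2) : encodeBits b < 2 ^ n := by
  induction n with
  | zero => simp [encodeBits]
  | succ n ih =>
    have h := ih fun i => b i.castSucc
    have hb : (b (Fin.last n)).val ≤ 1 := Nat.lt_succ_iff.mp (ZMod.val_lt _)
    have : encodeBits b = encodeBits (fun i => b i.castSucc) + (b (Fin.last n)).val * 2 ^ n := by
      simp [encodeBits, Fin.sum_univ_castSucc]
    rw [this, pow_succ]
    nlinarith [Nat.mul_le_mul_right (2 ^ n) hb]

theorem bits_encodeBits {n : ℕ} (b : Fin n → ZMod 2) (p : ℕ) :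
    bits (encodeBits b) p = if h : p < n then b ⟨p, h⟩ else 0 := by
  induction n generalizing p with
  | zero => simp [encodeBits, bits]
  | succ n ih =>
    have h := encodeBits_lt fun i => b i.castSucc
    have he : encodeBits b = 2 ^ n * (b (Fin.last n)).val + encodeBits (fun i => b i.castSucc) := by
      simp [encodeBits, Fin.sum_univ_castSucc]
      ring
    rw [he, bits, Nat.testBit_two_pow_mul_add _ h]
    by_cases hp : p < n
    · have := ih (fun i => b i.castSucc) p
      rw [dif_pos hp] at this
      rw [if_pos hp, dif_pos (by omega)]
      exact this
    · rw [if_neg hp]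
      by_cases hpn : p = n
      · subst hpn
        rw [dif_pos (by omega)]
        change _ = b (Fin.last p)
        rcases zmod2_cases (b (Fin.last p)) with h | h <;> rw [h] <;> simp [ZMod.val_one]
      · rw [dif_neg (by omega)]
        have hv : (b (Fin.last n)).val < 2 ^ 1 := ZMod.val_lt _
        rw [Nat.testBit_lt_two_pow (lt_of_lt_of_le hv (Nat.pow_le_pow_right (by norm_num) (by omega)))]
        simp

theorem bits_shiftLeft (v k p : ℕ) : bits (v <<< k) p = if k ≤ p then bits v (p - k) else 0 := by
  simp only [bits, Nat.testBit_shiftLeft]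
  by_cases h : k ≤ p <;> simp [h]

/-- The word that is made of a sampled Pauli string. -/
def sampleWord {n : ℕ} (P : Pauli n) : ℕ :=
  (encodeBits fun i => (P i).2) ^^^ (encodeBits fun i => (P i).1) <<< n

theorem bits_sampleWord {n : ℕ} (P : Pauli n) : bits (sampleWord P) = swapHalves n (ofPauli P) := by
  funext p
  rw [sampleWord, bits_xor, Pi.add_apply, bits_shiftLeft, bits_encodeBits, bits_encodeBits,
    swapHalves]
  by_cases h : p < n
  · rw [dif_pos h, if_neg (by omega), if_pos h, add_zero, ofPauli, dif_neg (by omega),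
      dif_pos (by omega)]
    simp
  · rw [dif_neg h, if_pos (by omega), if_neg h, zero_add]
    by_cases h' : p < 2 * n
    · rw [dif_pos (by omega), if_pos h', ofPauli, dif_pos (by omega)]
    · rw [dif_neg (by omega), if_neg h']

theorem sampleWord_lt {n : ℕ} (P : Pauli n) : sampleWord P < 2 ^ (2 * n) := by
  rw [← short_bits_iff, bits_sampleWord]
  exact short_swapHalves _ _

namespace PMF

open scoped ENNReal

theorem ensures_forall {α ι : Type*} {μ : PMF α} (s : Finset ι) {ε : ι → ℝ≥0∞}
    {Q : ι → α → Prop} (h : ∀ i ∈ s, μ.Ensures (ε i) (Q i)) :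
    μ.Ensures (∑ i ∈ s, ε i) fun a => ∀ i ∈ s, Q i a := by
  have hset : {a | ¬ ∀ i ∈ s, Q i a} = ⋃ i ∈ s, {a | ¬ Q i a} := by
    ext a
    simp
  rw [Ensures, hset]
  exact (MeasureTheory.measure_biUnion_finset_le s _).trans (Finset.sum_le_sum h)

end PMF

/-! ### Identification of the stabilizer group from the samples -/

namespace Learn

open Prog
open scoped ENNReal

/-- The memory after the sample `P`. -/
def afterSample {n : ℕ} (w : ℕ) (m : Mem) (P : Pauli n) : Mem :=
  insertVec.exec w (combine.exec w ((m.setReg w 40 (encodeBits fun i => (P i).1)).setReg w 41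
    (encodeBits fun i => (P i).2)))

theorem sem_sampleStep {n : ℕ} (w : ℕ) (ψ : PureState n) (m : Mem) :
    sampleStep.sem w ψ m = ψ.charDist.map (afterSample w m) := by
  have h : ∀ m, (combine ⨾ insertVec).sem w ψ m = PMF.pure ((combine ⨾ insertVec).exec w m) :=
    sem_of_isDet w ψ _ rfl
  have h2 : sampleStep.sem w ψ m =
      ((Prog.sample 40 41).sem w ψ m).bind fun m' => (combine ⨾ insertVec).sem w ψ m' := rfl
  rw [h2]
  simp only [h]
  rw [Prog.sem, PMF.bind_map]
  rfl

/-- The state of the memory between two samples. -/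
structure Sampled {n : ℕ} (t : ℕ) (ψ : PureState n) (m : Mem) : Prop where
  consts : Consts n t m
  table : TableOK (2 * n) (m.arr 10)
  orth : ∀ g ∈ ψ.stab, Orth (2 * n) (tableOf (m.arr 10)) (ofPauli g)

theorem afterSample_spec {n t w : ℕ} {m : Mem} (hw : 2 * n ≤ w) (hc : Consts n t m)
    (hT : TableOK (2 * n) (m.arr 10)) (P : Pauli n) :
    Consts n t (afterSample w m P) ∧ TableOK (2 * n) ((afterSample w m P).arr 10) ∧
    ∀ Q, Orth (2 * n) (tableOf ((afterSample w m P).arr 10)) (ofPauli Q) ↔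
      Orth (2 * n) (tableOf (m.arr 10)) (ofPauli Q) ∧ symp P Q = 0 := by
  set m₁ := combine.exec w ((m.setReg w 40 (encodeBits fun i => (P i).1)).setReg w 41
    (encodeBits fun i => (P i).2)) with hm₁
  have hx : (encodeBits fun i => (P i).1) < 2 ^ w := lt_two_pow_of_le (by omega) (encodeBits_lt _)
  have hz : (encodeBits fun i => (P i).2) < 2 ^ w := lt_two_pow_of_le (by omega) (encodeBits_lt _)
  have hs : (encodeBits fun i => (P i).1) <<< n < 2 ^ w := by
    refine lt_two_pow_of_le hw ?_
    rw [Nat.shiftLeft_eq, two_mul, pow_add]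
    exact Nat.mul_lt_mul_of_pos_right (encodeBits_lt _) (by positivity)
  have c1 : Consts n t m₁ := by
    refine Consts.exec ?_ w combine (by decide)
    refine hc.of_eq ?_
    simp [Mem.setReg]
  have r42 : m₁.reg 42 = sampleWord P := by
    simp [hm₁, combine, Prog.exec, Mem.setReg, WordOp.eval, hc.r10, Nat.mod_eq_of_lt hx,
      Nat.mod_eq_of_lt hz, Nat.mod_eq_of_lt hs]
    exact Nat.mod_eq_of_lt (lt_two_pow_of_le hw (sampleWord_lt P))
  have ha : m₁.arr = m.arr := by
    simp [hm₁, combine, Prog.exec, Mem.setReg]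
  have hins := exec_insertVec (w := w) c1.r12 c1.r13 c1.r14 hw (by rw [ha]; exact hT)
    (by rw [r42]; exact sampleWord_lt P)
  refine ⟨c1.exec w insertVec (by decide), hins.1, fun Q => ?_⟩
  refine (hins.2 _).trans ?_
  rw [ha, r42, bits_sampleWord, dot_swapHalves, toPauli_ofPauli, toPauli_ofPauli]

theorem sampleStep_support {n t w : ℕ} {ψ : PureState n} (hw : 2 * n ≤ w) {m : Mem}
    (h : Sampled t ψ m) : ∀ m' ∈ (sampleStep.sem w ψ m).support, Sampled t ψ m' := by
  intro m' hm'
  rw [sem_sampleStep, PMF.support_map] at hm'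
  obtain ⟨P, hP, rfl⟩ := hm'
  obtain ⟨h1, h2, h3⟩ := afterSample_spec hw h.consts h.table P
  exact ⟨h1, h2, fun g hg => (h3 g).mpr ⟨h.orth g hg,
    ψ.symp_eq_zero_of_mem hg (PureState.expect_ne_zero_of_mem_support hP)⟩⟩

open Classical in
/-- The potential that tells whether `Q` still commutes with all samples. -/
def orthPotential {n : ℕ} (Q : Pauli n) (m : Mem) : ℝ≥0∞ :=
  if Orth (2 * n) (tableOf (m.arr 10)) (ofPauli Q) then 1 else 0

/-- A string that is still orthogonal to the table remains so exactly if the next sample commutes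
with it; an excluded string never returns. So the indicator contracts in mean by the commutation
probability. -/
theorem sampleStep_mean_le {n t w : ℕ} {ψ : PureState n} (hψ : ψ.IsArithmetic t) (hw : 2 * n ≤ w)
    {Q : Pauli n} (hQ : Q ∉ ψ.stab) {m : Mem} (h : Sampled t ψ m) :
    (sampleStep.sem w ψ m).mean (orthPotential Q) ≤
      ENNReal.ofReal (1 - (2 : ℝ)⁻¹ ^ t / 4) * orthPotential Q m := by
  classical
  rw [sem_sampleStep, PMF.mean_map]
  by_cases h0 : Orth (2 * n) (tableOf (m.arr 10)) (ofPauli Q)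
  · have : (fun P => orthPotential Q (afterSample w m P)) =
        fun P => if symp P Q = 0 then 1 else 0 := by
      funext P
      rw [orthPotential]
      have := (afterSample_spec hw h.consts h.table P).2.2 Q
      by_cases hs : symp P Q = 0
      · rw [if_pos (this.mpr ⟨h0, hs⟩), if_pos hs]
      · rw [if_neg (fun h => hs (this.mp h).2), if_neg hs]
    rw [this, orthPotential, if_pos h0, mul_one]
    calc PMF.mean ψ.charDist (fun P => if symp P Q = 0 then 1 else 0)
        = ψ.charDist.toOuterMeasure {P | symp P Q = 0} := by
          rw [PMF.mean, PMF.toOuterMeasure_apply]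
          refine tsum_congr fun P => ?_
          by_cases hs : symp P Q = 0
          · rw [if_pos hs, mul_one, Set.indicator_of_mem (by exact hs)]
          · rw [if_neg hs, mul_zero, Set.indicator_of_notMem (by exact hs)]
      _ = ENNReal.ofReal ((1 + ψ.expect Q ^ 2) / 2) := ψ.toOuterMeasure_charDist_commuting Q
      _ ≤ _ := ENNReal.ofReal_le_ofReal (hψ.expect_sq_le hQ)
  · have : (fun P : Pauli n => orthPotential Q (afterSample w m P)) = fun _ => 0 := by
      funext P
      rw [orthPotential, if_neg fun h' => h0 (((afterSample_spec hw h.consts h.table P).2.2 Q).mp h').1]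
    rw [this]
    simp [PMF.mean]

/-- The exponent `16·2^t·n` times the rate `2^{-t}/4` is `4n`, and `4e^{-4} ≤ 1/2` pays for the
union over `4^n` strings. -/
theorem sampling_bound (n t : ℕ) :
    (4 : ℝ) ^ n * (1 - (2 : ℝ)⁻¹ ^ t / 4) ^ (16 * (2 ^ t * n)) ≤ (2 : ℝ)⁻¹ ^ n := by
  have hx1 : (2 : ℝ)⁻¹ ^ t ≤ 1 := pow_le_one₀ (by norm_num) (by norm_num)
  have h1 : (1 - (2 : ℝ)⁻¹ ^ t / 4) ^ (16 * (2 ^ t * n)) ≤ Real.exp (-4) ^ n := by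
    calc (1 - (2 : ℝ)⁻¹ ^ t / 4) ^ (16 * (2 ^ t * n))
        ≤ Real.exp (-((2 : ℝ)⁻¹ ^ t / 4)) ^ (16 * (2 ^ t * n)) :=
          pow_le_pow_left₀ (by linarith) (Real.one_sub_le_exp_neg _) _
      _ = Real.exp (-4) ^ n := by
          rw [← Real.exp_nat_mul, ← Real.exp_nat_mul]
          congr 1
          push_cast
          have : (2 : ℝ) ^ t * (2 : ℝ)⁻¹ ^ t = 1 := by rw [← mul_pow]; norm_num
          linear_combination (-4 * n : ℝ) * this
  have h2 : 4 * Real.exp (-4) ≤ (2 : ℝ)⁻¹ := by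
    have h3 : (2 : ℝ) ≤ Real.exp 1 := by
      have := Real.add_one_le_exp (1 : ℝ)
      linarith
    have h4 : (16 : ℝ) ≤ Real.exp 4 := by
      have : Real.exp 4 = Real.exp 1 ^ 4 := by rw [← Real.exp_nat_mul]; norm_num
      rw [this]
      calc (16 : ℝ) = 2 ^ 4 := by norm_num
        _ ≤ _ := by gcongr
    rw [Real.exp_neg]
    have h5 : (Real.exp 4)⁻¹ ≤ 16⁻¹ := inv_anti₀ (by norm_num) h4
    linarith
  calc (4 : ℝ) ^ n * (1 - (2 : ℝ)⁻¹ ^ t / 4) ^ (16 * (2 ^ t * n))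
      ≤ 4 ^ n * Real.exp (-4) ^ n := by gcongr
    _ = (4 * Real.exp (-4)) ^ n := (mul_pow _ _ _).symm
    _ ≤ _ := by gcongr

/-- Except with probability `2^{-n}`, the samples determine the stabilizer group. -/
theorem sampling_ensures {n t w : ℕ} {ψ : PureState n} (hψ : ψ.IsArithmetic t) (hw : 2 * n ≤ w)
    {m : Mem} (h : Sampled t ψ m) :
    (sampling.sem w ψ m).Ensures (ENNReal.ofReal ((2 : ℝ)⁻¹ ^ n))
      fun m' => Consts n t m' ∧ TableOK (2 * n) (m'.arr 10) ∧ IsStabTable ψ (tableOf (m'.arr 10)) := by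
  classical
  have hsem : sampling.sem w ψ m = PMF.iter (sampleStep.sem w ψ) (16 * (2 ^ t * n)) m := by
    rw [sampling, Prog.sem, h.consts.r15]
  rw [hsem]
  have hsupp : ∀ m' ∈ (PMF.iter (sampleStep.sem w ψ) (16 * (2 ^ t * n)) m).support, Sampled t ψ m' :=
    PMF.iter_support (I := fun _ => Sampled t ψ) h fun _ _ b hb => sampleStep_support hw hb
  have hx1 : (2 : ℝ)⁻¹ ^ t ≤ 1 := pow_le_one₀ (by norm_num) (by norm_num)
  -- That stabilizers stay orthogonal to the table is certain, by `hsupp`. Only the exclusion of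
  -- every other string can fail, and this is the union bound.
  have hfor := PMF.ensures_forall (μ := PMF.iter (sampleStep.sem w ψ) (16 * (2 ^ t * n)) m)
    (Finset.univ.filter fun Q : Pauli n => Q ∉ ψ.stab)
    (ε := fun _ => ENNReal.ofReal (1 - (2 : ℝ)⁻¹ ^ t / 4) ^ (16 * (2 ^ t * n)))
    (Q := fun Q m' => ¬ Orth (2 * n) (tableOf (m'.arr 10)) (ofPauli Q)) (by
      intro Q hQ
      have hQ' : Q ∉ ψ.stab := (Finset.mem_filter.mp hQ).2
      refine PMF.ensures_of_mean (Φ := orthPotential Q) ?_ ?_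
      · refine (PMF.iter_mean_le (I := fun _ => Sampled t ψ) h
          (fun _ _ b hb => sampleStep_support hw hb)
          fun _ _ b hb => sampleStep_mean_le hψ hw hQ' hb).trans ?_
        calc _ ≤ ENNReal.ofReal (1 - (2 : ℝ)⁻¹ ^ t / 4) ^ (16 * (2 ^ t * n)) * 1 := by
              gcongr
              rw [orthPotential]
              split_ifs <;> simp
          _ = _ := mul_one _
      · intro m' _ hm'
        rw [orthPotential, if_pos (not_not.mp hm')])
  refine hfor.mono ?_ ?_
  · rw [Finset.sum_const, nsmul_eq_mul, ← ENNReal.ofReal_pow (by linarith)]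
    have hcard : ((Finset.univ.filter fun Q : Pauli n => Q ∉ ψ.stab).card : ℝ≥0∞) ≤
        ENNReal.ofReal ((4 : ℝ) ^ n) := by
      have h1 : (Finset.univ.filter fun Q : Pauli n => Q ∉ ψ.stab).card ≤ 4 ^ n := by
        refine (Finset.card_filter_le _ _).trans (le_of_eq ?_)
        simp
      calc ((Finset.univ.filter fun Q : Pauli n => Q ∉ ψ.stab).card : ℝ≥0∞) ≤ ((4 ^ n : ℕ) : ℝ≥0∞) := by
            exact_mod_cast h1
        _ = ENNReal.ofReal ((4 ^ n : ℕ) : ℝ) := (ENNReal.ofReal_natCast _).symm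
        _ = _ := by push_cast; rfl
    calc _ ≤ ENNReal.ofReal ((4 : ℝ) ^ n) *
          ENNReal.ofReal ((1 - (2 : ℝ)⁻¹ ^ t / 4) ^ (16 * (2 ^ t * n))) := by gcongr
      _ = ENNReal.ofReal ((4 : ℝ) ^ n * (1 - (2 : ℝ)⁻¹ ^ t / 4) ^ (16 * (2 ^ t * n))) :=
          (ENNReal.ofReal_mul (by positivity)).symm
      _ ≤ _ := ENNReal.ofReal_le_ofReal (sampling_bound n t)
  · intro m' hm' hor
    have hS := hsupp m' hm'
    refine ⟨hS.consts, hS.table, hS.table.reduced, fun p => short_bits_iff.mpr (hS.table.lt p),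
      fun Q => ⟨fun hQ => ?_, fun hQ => hS.orth Q hQ⟩⟩
    by_contra hQ'
    exact hor Q (Finset.mem_filter.mpr ⟨Finset.mem_univ _, hQ'⟩) hQ

end Learn
end

noncomputable section

/-! ## The generators of the stabilizer group -/

theorem dualTable_eq {N : ℕ} {T : ℕ → Vec} {f : ℕ} (hf : f < N) (h : T f = 0) :
    dualTable N T f = unitVec f + ∑ p ∈ Finset.range N, T p f • unitVec p := if_pos ⟨hf, h⟩

theorem tableOf_eq_zero_iff {T : ℕ → ℕ} {p : ℕ} : tableOf T p = 0 ↔ T p = 0 := bits_eq_zero_iff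

theorem one_shiftLeft_lt {i N : ℕ} (h : i < N) : 1 <<< i < 2 ^ N := by
  rw [Nat.one_shiftLeft]
  exact Nat.pow_lt_pow_right (by norm_num) h

/-- For a stabilizer the wrong outcome has probability zero, so one shot determines the phase
without error. -/
theorem PureState.eq_expect_of_mem_support_shotDist {n : ℕ} {ψ : PureState n} {g : Pauli n}
    (hg : g ∈ ψ.stab) {b : Bool} (hb : b ∈ (ψ.shotDist g).support) :
    ψ.expect g = if b then -1 else 1 := by
  rw [PMF.mem_support_iff] at hb
  have h1 : ENNReal.ofReal ((1 + (if b then (-1 : ℝ) else 1) * ψ.expect g) / 2) ≠ 0 := hb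
  rw [ne_eq, ENNReal.ofReal_eq_zero, not_le] at h1
  rcases ψ.mem_stab_iff.mp hg with h | h <;> cases b <;> simp_all

namespace Learn

open Prog

theorem exec_dualStep {w i f : ℕ} {m : Mem} (h14 : m.reg 14 = 1) (h43 : m.reg 43 = i)
    (h47 : m.reg 47 = f) (hi : i + 1 < 2 ^ w) (hi' : 1 <<< i < 2 ^ w) (hv : m.reg 42 < 2 ^ w)
    (hT : m.arr 10 i < 2 ^ w) :
    (dualStep.exec w m).reg 42 =
      m.reg 42 ^^^ (if (m.arr 10 i).testBit f then 1 <<< i else 0) ∧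
    (dualStep.exec w m).reg 43 = i + 1 := by
  have e1 : m.arr 10 i >>> f % 2 ^ w = m.arr 10 i >>> f :=
    Nat.mod_eq_of_lt (lt_of_le_of_lt (Nat.shiftRight_le _ _) hT)
  have e2 : 1 < 2 ^ w := by omega
  have e3 : (m.reg 42 ^^^ 1 <<< i) % 2 ^ w = m.reg 42 ^^^ 1 <<< i :=
    Nat.mod_eq_of_lt (Nat.xor_lt_two_pow hv hi')
  by_cases h : (m.arr 10 i).testBit f <;>
    simp [dualStep, exec, Mem.setReg, WordOp.eval, h14, h43, h47, e1, shiftRight_mod_two, h,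
      Nat.mod_eq_of_lt e2, e3, Nat.mod_eq_of_lt hi, Nat.mod_eq_of_lt hT, Nat.mod_eq_of_lt hv,
      Nat.mod_eq_of_lt hi']

theorem exec_dualVec {w N f : ℕ} {m : Mem} (h12 : m.reg 12 = N) (h14 : m.reg 14 = 1)
    (h47 : m.reg 47 = f) (hN : N ≤ w) (hf : f < N) (hT : TableOK N (m.arr 10))
    (h0 : m.arr 10 f = 0) :
    (dualVec.exec w m).reg 42 < 2 ^ N ∧
    bits ((dualVec.exec w m).reg 42) = dualTable N (tableOf (m.arr 10)) f := by
  have hsf := one_shiftLeft_lt hf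
  have key := iterate_inv (f := dualStep.exec w) (a := (m.setReg w 42 (1 <<< f)).setReg w 43 0) (N := N)
    (I := fun i m' => m'.reg 14 = 1 ∧ m'.arr = m.arr ∧ m'.reg 43 = i ∧ m'.reg 47 = f ∧
      m'.reg 42 < 2 ^ N ∧
      bits (m'.reg 42) = unitVec f + ∑ p ∈ Finset.range i, tableOf (m.arr 10) p f • unitVec p)
    ⟨by simp [Mem.setReg, h14], rfl, by simp [Mem.setReg], by simp [Mem.setReg, h47],
      by simpa [Mem.setReg, Nat.mod_eq_of_lt (lt_two_pow_of_le hN hsf)] using hsf,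
      by simp [Mem.setReg, Nat.mod_eq_of_lt (lt_two_pow_of_le hN hsf), bits_one_shiftLeft]⟩ (by
      rintro i hi b ⟨b14, barr, b43, b47, blt, bv⟩
      have hTi : b.arr 10 i < 2 ^ N := by rw [barr]; exact hT.lt i
      have hsi := one_shiftLeft_lt hi
      obtain ⟨h1, h2⟩ := exec_dualStep b14 b43 b47 (succ_lt_word hN hi)
        (lt_two_pow_of_le hN hsi) (lt_two_pow_of_le hN blt) (lt_two_pow_of_le hN hTi)
      refine ⟨?_, ?_, h2, ?_, ?_, ?_⟩
      · rw [exec_reg _ _ _ _ (by decide), b14]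
      · rw [← barr]
        funext B
        rw [exec_arr _ _ _ _ (by simp [dualStep, warrs])]
      · rw [exec_reg _ _ _ _ (by decide), b47]
      · rw [h1]
        split_ifs
        · exact Nat.xor_lt_two_pow blt hsi
        · simpa using blt
      · rw [h1, bits_xor, bits_ite, Finset.sum_range_succ, ← add_assoc, ← bv, bits_one_shiftLeft,
          barr]
        rfl)
  have hx : dualVec.exec w m = (dualStep.exec w)^[N] ((m.setReg w 42 (1 <<< f)).setReg w 43 0) := by
    simp [dualVec, exec, Mem.setReg, h12, h14, h47, WordOp.eval]
  rw [hx]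
  refine ⟨key.2.2.2.2.1, ?_⟩
  rw [key.2.2.2.2.2, dualTable_eq hf (tableOf_eq_zero_iff.mpr h0)]

/-- The number of free entries below `f`. -/
def freeCount (T : ℕ → ℕ) (f : ℕ) : ℕ := Nat.count (fun p => T p = 0) f

theorem freeCount_succ (T : ℕ → ℕ) (f : ℕ) :
    freeCount T (f + 1) = freeCount T f + if T f = 0 then 1 else 0 := by
  rw [freeCount, Nat.count_succ]
  rfl

theorem freeCount_le (T : ℕ → ℕ) (f : ℕ) : freeCount T f ≤ f := Nat.count_le _

theorem freeCount_lt {T : ℕ → ℕ} {p f : ℕ} (hp : T p = 0) (h : p < f) :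
    freeCount T p < freeCount T f := Nat.count_strict_mono hp h

/-- The state of the memory while the generators are computed, after the first `f` entries. -/
structure Generated {n : ℕ} (t : ℕ) (ψ : PureState n) (T : ℕ → ℕ) (f : ℕ) (m : Mem) : Prop where
  consts : Consts n t m
  arr10 : m.arr 10 = T
  r47 : m.reg 47 = f
  r0 : m.reg 0 = freeCount T f
  arr11 : ∀ p, bits (m.arr 11 p) = if p < f then dualTable (2 * n) (tableOf T) p else 0
  gens : ∀ p < f, T p = 0 →
    decodePauli n (m.arr 0 (freeCount T p)) (m.arr 1 (freeCount T p)) =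
      toPauli n (dualTable (2 * n) (tableOf T) p) ∧
    ψ.expect (toPauli n (dualTable (2 * n) (tableOf T) p)) =
      if m.arr 2 (freeCount T p) = 0 then 1 else -1

theorem exec_generator {w n t f : ℕ} {m : Mem} (hc : Consts n t m) (hw : 2 * n ≤ w)
    (h47 : m.reg 47 = f) (hf : f < 2 * n) (hT : TableOK (2 * n) (m.arr 10)) (h0 : m.arr 10 f = 0) :
    ∃ u < 2 ^ (2 * n), bits u = dualTable (2 * n) (tableOf (m.arr 10)) f ∧
      (generator.exec w m).reg 42 = u ∧ (generator.exec w m).reg 48 = u >>> n ∧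
      (generator.exec w m).arr 11 = Function.update (m.arr 11) f u ∧
      (generator.exec w m).arr 0 = Function.update (m.arr 0) (m.reg 0) u ∧
      (generator.exec w m).arr 1 = Function.update (m.arr 1) (m.reg 0) (u >>> n) := by
  obtain ⟨h1, h2⟩ := exec_dualVec hc.r12 hc.r14 h47 hw hf hT h0
  set m₁ := dualVec.exec w m with hm₁
  have ha : m₁.arr = m.arr := by
    funext B
    exact exec_arr _ _ _ _ (by simp [dualVec, dualStep, warrs])
  have r0 : m₁.reg 0 = m.reg 0 := exec_reg _ _ _ _ (by decide)
  have r10 : m₁.reg 10 = n := by rw [hm₁, exec_reg _ _ _ _ (by decide), hc.r10]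
  have r47 : m₁.reg 47 = f := by rw [hm₁, exec_reg _ _ _ _ (by decide), h47]
  have e1 := Nat.mod_eq_of_lt (lt_two_pow_of_le hw h1)
  have e2 : m₁.reg 42 >>> n % 2 ^ w = m₁.reg 42 >>> n :=
    Nat.mod_eq_of_lt (lt_of_le_of_lt (Nat.shiftRight_le _ _) (lt_two_pow_of_le hw h1))
  refine ⟨m₁.reg 42, h1, h2, ?_, ?_, ?_, ?_, ?_⟩ <;>
    simp [generator, exec, ← hm₁, Mem.setReg, Mem.setArr, WordOp.eval, r0, r10, r47, e1, e2, ha]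

theorem generatorStep_support {n t w : ℕ} {ψ : PureState n} {T : ℕ → ℕ} (hw : 2 * n ≤ w)
    (hT : TableOK (2 * n) T) (hst : IsStabTable ψ (tableOf T)) {f : ℕ} (hf : f < 2 * n) {m : Mem}
    (h : Generated t ψ T f m) :
    ∀ m' ∈ (generatorStep.sem w ψ m).support, Generated t ψ T (f + 1) m' := by
  intro m' hm'
  have hc' : Consts n t m' := h.consts.sem hm' (by decide)
  have hTf : T f < 2 ^ w := lt_two_pow_of_le hw (hT.lt f)
  have hf1 : f + 1 < 2 ^ w := succ_lt_word hw hf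
  have e1 : 1 < 2 ^ w := by omega
  set m₁ := m.setReg w 45 (T f) with hm₁
  have c1 : Consts n t m₁ := h.consts.of_eq (by simp [hm₁, Mem.setReg])
  have r45 : m₁.reg 45 = T f := by simp [hm₁, Mem.setReg, Nat.mod_eq_of_lt hTf]
  have r47 : m₁.reg 47 = f := by simp [hm₁, Mem.setReg, h.r47]
  have r0 : m₁.reg 0 = freeCount T f := by simp [hm₁, Mem.setReg, h.r0]
  have ha₁ : m₁.arr = m.arr := rfl
  have hsem : generatorStep.sem w ψ m =
      ((Prog.ite 45 skip (generator ⨾ .measure 49 42 48 ⨾ recordPhase)).sem w ψ m₁).bind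
        ((Prog.op .add 47 47 14).sem w ψ) := by
    simp only [generatorStep, Prog.sem, PMF.pure_bind, h.arr10, h.r47, hm₁]
  rw [hsem, PMF.mem_support_bind_iff] at hm'
  obtain ⟨m₂, h2, h3⟩ := hm'
  simp only [Prog.sem, PMF.mem_support_pure_iff, WordOp.eval] at h3
  have harr : m'.arr = m₂.arr := by rw [h3]; rfl
  have hr0 : m'.reg 0 = m₂.reg 0 := by rw [h3]; simp [Mem.setReg]
  have s47 : m₂.reg 47 = f := by rw [(sem_frame _ _ _ _ _ h2).1 47 (by decide), r47]
  have s14 : m₂.reg 14 = 1 := by rw [(sem_frame _ _ _ _ _ h2).1 14 (by decide), c1.r14]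
  have s10 : m₂.arr 10 = T := by
    rw [(sem_frame _ _ _ _ _ h2).2 10 (by decide), ha₁, h.arr10]
  have hr47 : m'.reg 47 = f + 1 := by
    rw [h3]; simp [Mem.setReg, s47, s14, Nat.mod_eq_of_lt hf1]
  by_cases h0 : T f = 0
  · rw [Prog.sem, if_neg (by rw [r45]; simpa using h0)] at h2
    simp only [Prog.sem] at h2
    rw [sem_of_isDet w ψ generator rfl, PMF.pure_bind, PMF.mem_support_bind_iff] at h2
    obtain ⟨m₃, h4, h5⟩ := h2
    rw [sem_of_isDet w ψ recordPhase rfl, PMF.mem_support_pure_iff] at h5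
    rw [PMF.support_map] at h4
    obtain ⟨b, hb, rfl⟩ := h4
    obtain ⟨u, hu, hubits, g42, g48, g11, g0, g1⟩ := exec_generator c1 hw r47 hf
      (by rw [ha₁, h.arr10]; exact hT) (by rw [ha₁, h.arr10]; exact h0)
    set m₄ := generator.exec w m₁ with hm₄
    rw [ha₁, h.arr10] at hubits
    have hdec : decodePauli n u (u >>> n) = toPauli n (dualTable (2 * n) (tableOf T) f) := by
      rw [decodePauli_eq, hubits]
    rw [g42, g48, hdec] at hb
    have hexp := PureState.eq_expect_of_mem_support_shotDist (hst.toPauli_dual_mem f) hb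
    have q0 : m₄.reg 0 = freeCount T f := by rw [hm₄, exec_reg _ _ _ _ (by decide), r0]
    have q14 : m₄.reg 14 = 1 := by rw [hm₄, exec_reg _ _ _ _ (by decide), c1.r14]
    have q2 : m₄.arr 2 = m.arr 2 := by rw [hm₄, exec_arr _ _ _ _ (by decide), ha₁]
    have hcnt : freeCount T f + 1 < 2 ^ w := lt_of_le_of_lt (by have := freeCount_le T f; omega) hf1
    have a2 : m'.arr 2 = Function.update (m.arr 2) (freeCount T f) (if b then 1 else 0) := by
      rw [harr, h5]
      cases b <;> simp [recordPhase, exec, Mem.setReg, Mem.setArr, q0, q2, Nat.mod_eq_of_lt e1]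
    have a0 : m'.arr 0 = Function.update (m.arr 0) (freeCount T f) u := by
      rw [harr, h5]
      simp [recordPhase, exec, Mem.setReg, Mem.setArr, g0, r0, ha₁]
    have a1 : m'.arr 1 = Function.update (m.arr 1) (freeCount T f) (u >>> n) := by
      rw [harr, h5]
      simp [recordPhase, exec, Mem.setReg, Mem.setArr, g1, r0, ha₁]
    have a11 : m'.arr 11 = Function.update (m.arr 11) f u := by
      rw [harr, h5]
      simp [recordPhase, exec, Mem.setReg, Mem.setArr, g11, ha₁]
    have b0 : m'.reg 0 = freeCount T (f + 1) := by
      rw [hr0, h5, freeCount_succ, if_pos h0]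
      simp [recordPhase, exec, Mem.setReg, Mem.setArr, WordOp.eval, q0, q14,
        Nat.mod_eq_of_lt hcnt]
    refine ⟨hc', by rw [harr, s10], hr47, b0, fun p => ?_, fun p hp hp0 => ?_⟩
    · rw [a11]
      by_cases hpf : p = f
      · rw [hpf, Function.update_self, if_pos (by omega), hubits]
      · rw [Function.update_of_ne hpf, h.arr11 p]
        by_cases hpf' : p < f
        · rw [if_pos hpf', if_pos (by omega)]
        · rw [if_neg hpf', if_neg (by omega)]
    · by_cases hpf : p = f
      · rw [a0, a1, a2, hpf, Function.update_self, Function.update_self, Function.update_self]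
        refine ⟨hdec, ?_⟩
        rw [hexp]
        cases b <;> simp
      · have hne : freeCount T p ≠ freeCount T f := (freeCount_lt hp0 (by omega)).ne
        rw [a0, a1, a2, Function.update_of_ne hne, Function.update_of_ne hne,
          Function.update_of_ne hne]
        exact h.gens p (by omega) hp0
  · rw [Prog.sem, if_pos (by rw [r45]; exact h0), skip] at h2
    simp only [Prog.sem, PMF.mem_support_pure_iff] at h2
    have harr2 : m'.arr = m.arr := by rw [harr, h2]; rfl
    refine ⟨hc', by rw [harr, s10], hr47, ?_, fun p => ?_, fun p hp hp0 => ?_⟩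
    · rw [hr0, h2, freeCount_succ, if_neg h0]
      simp [Mem.setReg, r0]
    · rw [harr2, h.arr11 p]
      by_cases hpf : p = f
      -- Cells of array `11` at pivots of `T` are never written; their initial value `0` is the
      -- right one.
      · have hd : dualTable (2 * n) (tableOf T) f = 0 := by
          by_contra h'
          exact h0 (tableOf_eq_zero_iff.mp (dualTable_ne_zero_iff.mp h').2)
        rw [hpf, if_neg (lt_irrefl f), if_pos (by omega), hd]
      · by_cases hpf' : p < f
        · rw [if_pos hpf', if_pos (by omega)]
        · rw [if_neg hpf', if_neg (by omega)]
    · rw [harr2]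
      have : p ≠ f := by
        rintro rfl
        exact h0 hp0
      exact h.gens p (by omega) hp0

theorem generators_support {n t w : ℕ} {ψ : PureState n} {m : Mem} (hw : 2 * n ≤ w)
    (hc : Consts n t m) (hT : TableOK (2 * n) (m.arr 10)) (hst : IsStabTable ψ (tableOf (m.arr 10)))
    (h0 : m.reg 0 = 0) (h11 : m.arr 11 = fun _ => 0) :
    ∀ m' ∈ (generators.sem w ψ m).support, Generated t ψ (m.arr 10) (2 * n) m' := by
  have hsem : generators.sem w ψ m =
      PMF.iter (generatorStep.sem w ψ) (2 * n) (m.setReg w 47 0) := by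
    simp only [generators, Prog.sem, PMF.pure_bind]
    simp [Mem.setReg, hc.r12]
  rw [hsem]
  refine PMF.iter_support (I := fun f => Generated t ψ (m.arr 10) f) ?_
    fun f hf b hb => generatorStep_support hw hT hst hf hb
  refine ⟨hc.of_eq (by simp [Mem.setReg]), rfl, by simp [Mem.setReg], ?_, fun p => ?_,
    fun p hp => absurd hp (by omega)⟩
  · simp [Mem.setReg, h0, freeCount]
  · simp [Mem.setReg, h11, bits_zero]

end Learn
end

noncomputable section

/-! ## The list of the coset representatives -/

namespace IsStabTable

variable {n : ℕ} {ψ : PureState n} {T : ℕ → Vec}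

theorem short_cosetVec (p : ℕ) : Short (2 * n) (cosetVec n T p) :=
  short_reduceBy short_dualTable (short_swapHalves n _)

theorem cosetVec_vanish (p : ℕ) {f : ℕ} (hf : f < 2 * n) (h : T f = 0) : cosetVec n T p f = 0 :=
  reduceBy_apply_pivot dualTable_isReduced _ hf (dualTable_ne_zero_iff.mpr ⟨hf, h⟩)

theorem cosetVec_commute (h : IsStabTable ψ T) {p : ℕ} (hp : p < 2 * n) {g : Pauli n}
    (hg : g ∈ ψ.stab) : symp (toPauli n (cosetVec n T p)) g = 0 := by
  rw [cosetVec, reduceBy, toPauli_add, symp_add_left, symp_stab (h.sum_dual_mem _) hg, add_zero]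
  conv_lhs => rw [← toPauli_ofPauli g]
  rw [← dot_swapHalves, swapHalves_swapHalves (h.short p)]
  exact (h.orth_iff g).mpr hg p hp

/-- A combination of the first `p` coset vectors. -/
def combo (n : ℕ) (T : ℕ → Vec) (p : ℕ) (c : ℕ → ZMod 2) : Vec :=
  ∑ q ∈ Finset.range p, c q • cosetVec n T q

theorem combo_succ (p : ℕ) (c : ℕ → ZMod 2) :
    combo n T (p + 1) c = combo n T p c + c p • cosetVec n T p := Finset.sum_range_succ _ _

theorem combo_add (p : ℕ) (c c' : ℕ → ZMod 2) :
    combo n T p c + combo n T p c' = combo n T p (c + c') := by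
  simp only [combo, Pi.add_apply, add_smul, Finset.sum_add_distrib]

theorem combo_update (p : ℕ) (c : ℕ → ZMod 2) (x : ZMod 2) :
    combo n T p (Function.update c p x) = combo n T p c :=
  Finset.sum_congr rfl fun q hq => by
    rw [Function.update_of_ne (Finset.mem_range.mp hq).ne]

theorem short_combo (p : ℕ) (c : ℕ → ZMod 2) : Short (2 * n) (combo n T p c) :=
  short_sum _ _ fun q _ => short_smul _ (short_cosetVec q)

theorem combo_vanish (p : ℕ) (c : ℕ → ZMod 2) {f : ℕ} (hf : f < 2 * n) (h : T f = 0) :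
    combo n T p c f = 0 := by
  rw [combo, Finset.sum_apply]
  exact Finset.sum_eq_zero fun q _ => by rw [Pi.smul_apply, cosetVec_vanish q hf h, smul_zero]

theorem combo_commute (h : IsStabTable ψ T) {p : ℕ} (hp : p ≤ 2 * n) (c : ℕ → ZMod 2) {g : Pauli n}
    (hg : g ∈ ψ.stab) : symp (toPauli n (combo n T p c)) g = 0 := by
  induction p with
  | zero =>
    have : toPauli n (combo n T 0 c) = 0 := rfl
    rw [this]
    have := symp_add_left (0 : Pauli n) 0 g
    simpa using this
  | succ p ih =>
    rw [combo_succ, toPauli_add, symp_add_left, ih (by omega), zero_add]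
    rcases zmod2_cases (c p) with h0 | h0
    · rw [h0, zero_smul]
      have := symp_add_left (0 : Pauli n) 0 g
      simpa [toPauli_zero] using this
    · rw [h0, one_smul]
      exact h.cosetVec_commute (by omega) hg

end IsStabTable

open IsStabTable

/-- The list `L` of length `len` holds the combinations of the first `p` coset vectors. -/
structure CosetList (n t : ℕ) (T : ℕ → Vec) (p len : ℕ) (L : ℕ → ℕ) : Prop where
  pos : 0 < len
  le : len ≤ 4 ^ t
  zero : ∀ j, len ≤ j → L j = 0
  inj : ∀ i < len, ∀ j < len, L i = L j → i = j
  exists_combo : ∀ j < len, ∃ c, bits (L j) = combo n T p c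
  span : ∀ c, ∃ j < len, bits (L j) = combo n T p c

namespace CosetList

variable {n t : ℕ} {ψ : PureState n} {T : ℕ → Vec} {p len : ℕ} {L : ℕ → ℕ}

theorem lt (h : CosetList n t T p len L) (j : ℕ) : L j < 2 ^ (2 * n) := by
  by_cases hj : j < len
  · obtain ⟨c, hc⟩ := h.exists_combo j hj
    rw [← short_bits_iff, hc]
    exact short_combo p c
  · rw [h.zero j (by omega)]
    positivity

theorem init : CosetList n t T 0 1 fun _ => 0 where
  pos := one_pos
  le := Nat.one_le_pow _ _ (by norm_num)
  zero := fun _ _ => rfl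
  inj := fun i hi j hj _ => by omega
  exists_combo := fun _ _ => ⟨0, bits_zero⟩
  span := fun _ => ⟨0, one_pos, bits_zero⟩

/-- The coset vector is in the list already. -/
theorem step_of_mem (h : CosetList n t T p len L) {v : ℕ} (hv : bits v = cosetVec n T p)
    (hmem : ∃ j < 4 ^ t, L j = v) : CosetList n t T (p + 1) len L := by
  obtain ⟨c₀, hc₀⟩ : ∃ c₀, cosetVec n T p = combo n T p c₀ := by
    obtain ⟨j, -, hj⟩ := hmem
    by_cases hjl : j < len
    · obtain ⟨c, hc⟩ := h.exists_combo j hjl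
      exact ⟨c, by rw [← hv, ← hj, hc]⟩
    -- The scan covers all `4^t` cells, so the match may be an unused one. Those hold zero, which is
    -- the empty combination.
    · refine ⟨0, ?_⟩
      rw [← hv, ← hj, h.zero j (by omega), bits_zero]
      simp [combo]
  refine ⟨h.pos, h.le, h.zero, h.inj, fun j hj => ?_, fun c => ?_⟩
  · obtain ⟨c, hc⟩ := h.exists_combo j hj
    refine ⟨Function.update c p 0, ?_⟩
    rw [combo_succ, combo_update, Function.update_self, zero_smul, add_zero, hc]
  · rcases zmod2_cases (c p) with h0 | h0
    · rw [combo_succ, h0, zero_smul, add_zero]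
      exact h.span c
    · rw [combo_succ, h0, one_smul, hc₀, combo_add]
      exact h.span _

/-- The list with all sums of its entries and `v` appended. -/
def doubled (len v : ℕ) (L : ℕ → ℕ) : ℕ → ℕ := fun j =>
  if j < len then L j else if j < 2 * len then L (j - len) ^^^ v else 0

/-- The coset vector is new. -/
theorem step_of_notMem (h : CosetList n t T p len L) (hst : IsStabTable ψ T)
    (ht : ψ.IsArithmetic t) (hp : p < 2 * n) {v : ℕ} (hv : bits v = cosetVec n T p)
    (hmem : ¬ ∃ j < 4 ^ t, L j = v) : CosetList n t T (p + 1) (2 * len) (doubled len v L) := by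
  classical
  have hnot : ∀ c, bits v ≠ combo n T p c := by
    intro c hc
    obtain ⟨j, hj, hj'⟩ := h.span c
    exact hmem ⟨j, hj.trans_le h.le, bits_injective (hj'.trans hc.symm)⟩
  have hcombo : ∀ j < 2 * len, ∃ c, bits (doubled len v L j) = combo n T (p + 1) c := by
    intro j hj
    by_cases hjl : j < len
    · obtain ⟨c, hc⟩ := h.exists_combo j hjl
      refine ⟨Function.update c p 0, ?_⟩
      rw [combo_succ, combo_update, Function.update_self, zero_smul, add_zero, doubled, if_pos hjl,
        hc]
    · obtain ⟨c, hc⟩ := h.exists_combo (j - len) (by omega)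
      refine ⟨Function.update c p 1, ?_⟩
      rw [combo_succ, combo_update, Function.update_self, one_smul, doubled, if_neg hjl, if_pos hj,
        bits_xor, hc, hv]
  have hcross : ∀ i < len, ∀ j < len, L i ≠ L j ^^^ v := by
    intro i hi j hj heq
    obtain ⟨c, hc⟩ := h.exists_combo i hi
    obtain ⟨c', hc'⟩ := h.exists_combo j hj
    apply hnot (c + c')
    rw [← combo_add, ← hc, ← hc', heq, bits_xor, add_comm (bits (L j)), add_assoc, vec_add_self,
      add_zero]
  have hinj : ∀ i < 2 * len, ∀ j < 2 * len, doubled len v L i = doubled len v L j → i = j := by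
    intro i hi j hj heq
    simp only [doubled, if_pos hi, if_pos hj] at heq
    split_ifs at heq with h1 h2 h2
    · exact h.inj i h1 j h2 heq
    · exact absurd heq (hcross i h1 _ (by omega))
    · exact absurd heq.symm (hcross j h2 _ (by omega))
    · have := h.inj (i - len) (by omega) (j - len) (by omega) (Nat.xor_left_injective (x := v) heq)
      omega
  -- The entries of the doubled list are distinct, reduced and commute with the stabilizer group, so
  -- `card_le` bounds their number: the capacity is never exceeded.
  have hcard : 2 * len ≤ 4 ^ t := by
    have h1 := hst.card_le ht ((Finset.range (2 * len)).image fun j => bits (doubled len v L j))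
      (by
        intro y hy
        obtain ⟨j, hj, rfl⟩ := Finset.mem_image.mp hy
        obtain ⟨c, hc⟩ := hcombo j (Finset.mem_range.mp hj)
        rw [hc]
        exact short_combo _ _)
      (by
        intro y hy f hf h0
        obtain ⟨j, hj, rfl⟩ := Finset.mem_image.mp hy
        obtain ⟨c, hc⟩ := hcombo j (Finset.mem_range.mp hj)
        rw [hc]
        exact combo_vanish _ _ hf h0)
      (by
        intro y hy g hg
        obtain ⟨j, hj, rfl⟩ := Finset.mem_image.mp hy
        obtain ⟨c, hc⟩ := hcombo j (Finset.mem_range.mp hj)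
        rw [hc]
        exact hst.combo_commute hp c hg)
    rwa [Finset.card_image_of_injOn, Finset.card_range] at h1
    intro i hi j hj heq
    exact hinj i (by simpa using hi) j (by simpa using hj) (bits_injective heq)
  have := h.pos
  refine ⟨by omega, hcard, fun j hj => ?_, hinj, hcombo, fun c => ?_⟩
  · rw [doubled, if_neg (by omega), if_neg (by omega)]
  · obtain ⟨j, hj, hc⟩ := h.span c
    rcases zmod2_cases (c p) with h0 | h0
    · exact ⟨j, by omega, by rw [doubled, if_pos hj, combo_succ, h0, zero_smul, add_zero, hc]⟩
    · refine ⟨len + j, by omega, ?_⟩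
      rw [doubled, if_neg (by omega), if_pos (by omega), combo_succ, h0, one_smul, bits_xor,
        Nat.add_sub_cancel_left, hc, hv]

end CosetList

theorem bits_swapWord {n v : ℕ} (hv : v < 2 ^ (2 * n)) :
    bits ((v <<< n ^^^ v >>> n) &&& (2 ^ (2 * n) - 1)) = swapHalves n (bits v) := by
  funext p
  simp only [bits, swapHalves, Nat.testBit_and, Nat.testBit_xor, Nat.testBit_shiftLeft,
    Nat.testBit_shiftRight, Nat.testBit_two_pow_sub_one]
  by_cases h1 : p < n
  · have h2 : ¬ n ≤ p := by omega
    have h3 : p < 2 * n := by omega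
    simp [h1, h2, h3, add_comm]
  · have h2 : n ≤ p := by omega
    by_cases h3 : p < 2 * n
    · have h4 : v.testBit (n + p) = false :=
        Nat.testBit_lt_two_pow (lt_of_lt_of_le hv (Nat.pow_le_pow_right (by norm_num) (by omega)))
      simp [h1, h2, h3, h4]
    · simp [h1, h3]

namespace Learn

open Prog

/-- The word needs room for `3n` bits because the left shift is masked only afterwards. -/
theorem exec_loadRow {w n t p : ℕ} {m : Mem} (hc : Consts n t m) (hw : 3 * n ≤ w)
    (h47 : m.reg 47 = p) (hT : m.arr 10 p < 2 ^ (2 * n)) :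
    (loadRow.exec w m).reg 42 < 2 ^ (2 * n) ∧
    bits ((loadRow.exec w m).reg 42) = swapHalves n (bits (m.arr 10 p)) := by
  have b1 : m.arr 10 p < 2 ^ w := lt_two_pow_of_le (by omega) hT
  have b2 : m.arr 10 p >>> n < 2 ^ w := lt_of_le_of_lt (Nat.shiftRight_le _ _) b1
  have b3 : m.arr 10 p <<< n < 2 ^ w := by
    rw [Nat.shiftLeft_eq]
    calc m.arr 10 p * 2 ^ n < 2 ^ (2 * n) * 2 ^ n := by gcongr
      _ = 2 ^ (3 * n) := by rw [← pow_add]; congr 1; omega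
      _ ≤ 2 ^ w := Nat.pow_le_pow_right (by norm_num) hw
  have b4 := Nat.xor_lt_two_pow b3 b2
  have b5 : (m.arr 10 p <<< n ^^^ m.arr 10 p >>> n) &&& (2 ^ (2 * n) - 1) < 2 ^ w :=
    lt_of_le_of_lt Nat.and_le_left b4
  have hx : (loadRow.exec w m).reg 42 =
      (m.arr 10 p <<< n ^^^ m.arr 10 p >>> n) &&& (2 ^ (2 * n) - 1) := by
    simp only [loadRow, exec, Mem.setReg, WordOp.eval]
    simp [h47, hc.r10, hc.r21, Nat.mod_eq_of_lt b1, Nat.mod_eq_of_lt b2, Nat.mod_eq_of_lt b3,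
      Nat.mod_eq_of_lt b4, -Nat.and_two_pow_sub_one_eq_mod, Nat.mod_eq_of_lt b5]
  have hb := bits_swapWord hT
  rw [hx]
  refine ⟨?_, hb⟩
  rw [← short_bits_iff, hb]
  exact short_swapHalves n _

theorem exec_scanStep {w i : ℕ} {m : Mem} (h14 : m.reg 14 = 1) (h43 : m.reg 43 = i)
    (hi : i + 1 < 2 ^ w) (hv : m.arr 12 i < 2 ^ w) (h51 : m.reg 51 ≤ 1) :
    (scanStep.exec w m).reg 51 = (if m.arr 12 i = m.reg 42 then 1 else m.reg 51) ∧
    (scanStep.exec w m).reg 43 = i + 1 := by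
  have e1 : 1 < 2 ^ w := by omega
  constructor
  · have h51' : m.reg 51 = 0 ∨ m.reg 51 = 1 := by omega
    have hx : (scanStep.exec w m).reg 51 =
        (m.reg 51 ||| if m.arr 12 i = m.reg 42 then 1 else 0) % 2 ^ w := by
      simp only [scanStep, exec, Mem.setReg, WordOp.eval]
      by_cases h : m.arr 12 i = m.reg 42 <;> simp [h43, Nat.mod_eq_of_lt hv, h]
      rw [← h, Nat.mod_eq_of_lt hv]
      simp [Nat.mod_eq_of_lt e1]
    rw [hx]
    by_cases h : m.arr 12 i = m.reg 42 <;> rcases h51' with h5 | h5 <;>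
      simp [h5, h, Nat.mod_eq_of_lt e1]
  · simp [scanStep, exec, Mem.setReg, WordOp.eval, h14, h43, Nat.mod_eq_of_lt hi]

theorem exec_scan {w t : ℕ} {m : Mem} (h14 : m.reg 14 = 1) (h16 : m.reg 16 = 4 ^ t)
    (hw : 2 * 4 ^ t < 2 ^ w) (hL : ∀ j, m.arr 12 j < 2 ^ w) :
    (scan.exec w m).reg 51 ≠ 0 ↔ ∃ j < 4 ^ t, m.arr 12 j = m.reg 42 := by
  have key := iterate_inv (f := scanStep.exec w) (a := (m.setReg w 51 0).setReg w 43 0) (N := 4 ^ t)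
    (I := fun i m' => m'.reg 14 = 1 ∧ m'.reg 42 = m.reg 42 ∧ m'.arr 12 = m.arr 12 ∧ m'.reg 43 = i ∧
      m'.reg 51 ≤ 1 ∧ (m'.reg 51 ≠ 0 ↔ ∃ j < i, m.arr 12 j = m.reg 42))
    ⟨by simp [Mem.setReg, h14], by simp [Mem.setReg], rfl, by simp [Mem.setReg],
      by simp [Mem.setReg], by simp [Mem.setReg]⟩ (by
      rintro i hi b ⟨b14, b42, b12, b43, ble, biff⟩
      obtain ⟨h1, h2⟩ := exec_scanStep (w := w) b14 b43 (by omega) (by rw [b12]; exact hL i) ble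
      refine ⟨?_, ?_, ?_, h2, ?_, ?_⟩
      · rw [exec_reg _ _ _ _ (by decide), b14]
      · rw [exec_reg _ _ _ _ (by decide), b42]
      · rw [exec_arr _ _ _ _ (by decide), b12]
      · rw [h1]
        split_ifs <;> omega
      · rw [h1, b12, b42]
        by_cases h : m.arr 12 i = m.reg 42
        · rw [if_pos h]
          exact ⟨fun _ => ⟨i, by omega, h⟩, fun _ => one_ne_zero⟩
        · rw [if_neg h, biff]
          constructor
          · rintro ⟨j, hj, hj'⟩
            exact ⟨j, by omega, hj'⟩
          · rintro ⟨j, hj, hj'⟩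
            refine ⟨j, ?_, hj'⟩
            rcases Nat.lt_succ_iff_lt_or_eq.mp hj with h' | h'
            · exact h'
            · rw [h'] at hj'
              exact absurd hj' h)
  have hx : scan.exec w m = (scanStep.exec w)^[4 ^ t] ((m.setReg w 51 0).setReg w 43 0) := by
    simp [scan, exec, Mem.setReg, h16]
  rw [hx]
  exact key.2.2.2.2.2

theorem exec_doubleStep {w i len : ℕ} {m : Mem} (h14 : m.reg 14 = 1) (h43 : m.reg 43 = i)
    (h50 : m.reg 50 = len) (hi : i + 1 < 2 ^ w) (hil : i + len < 2 ^ w) (hL : m.arr 12 i < 2 ^ w)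
    (hv : m.reg 42 < 2 ^ w) :
    (doubleStep.exec w m).arr 12 = (if i < len then
      Function.update (m.arr 12) (i + len) (m.arr 12 i ^^^ m.reg 42) else m.arr 12) ∧
    (doubleStep.exec w m).reg 43 = i + 1 := by
  have e1 : 1 < 2 ^ w := by omega
  have e2 := Nat.xor_lt_two_pow hL hv
  by_cases h : i < len <;>
    simp [doubleStep, skip, exec, Mem.setReg, Mem.setArr, WordOp.eval, h14, h43, h50, h,
      Nat.mod_eq_of_lt e1, Nat.mod_eq_of_lt e2, Nat.mod_eq_of_lt hi, Nat.mod_eq_of_lt hil,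
      Nat.mod_eq_of_lt hL]

theorem exec_double {w t len : ℕ} {m : Mem} (h14 : m.reg 14 = 1) (h16 : m.reg 16 = 4 ^ t)
    (h50 : m.reg 50 = len) (hw : 2 * 4 ^ t < 2 ^ w) (hL : ∀ j, m.arr 12 j < 2 ^ w)
    (hv : m.reg 42 < 2 ^ w) (hle : len ≤ 4 ^ t) (hz : ∀ j, len ≤ j → m.arr 12 j = 0) :
    (double.exec w m).arr 12 = CosetList.doubled len (m.reg 42) (m.arr 12) ∧
    (double.exec w m).reg 50 = 2 * len := by
  -- Writes go to positions from `len` on, while only positions below `len` are read for copying; no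
  -- sum is built from an already modified entry.
  have key := iterate_inv (f := doubleStep.exec w) (a := m.setReg w 43 0) (N := 4 ^ t)
    (I := fun i m' => m'.reg 14 = 1 ∧ m'.reg 42 = m.reg 42 ∧ m'.reg 43 = i ∧ m'.reg 50 = len ∧
      ∀ j, m'.arr 12 j = if len ≤ j ∧ j < 2 * len ∧ j < len + i then
        m.arr 12 (j - len) ^^^ m.reg 42 else m.arr 12 j)
    ⟨by simp [Mem.setReg, h14], by simp [Mem.setReg], by simp [Mem.setReg],
      by simp [Mem.setReg, h50], fun j => by rw [if_neg (by omega)]; rfl⟩ (by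
      rintro i hi b ⟨b14, b42, b43, b50, bL⟩
      have hbL : b.arr 12 i < 2 ^ w := by
        rw [bL i]
        split_ifs
        · exact Nat.xor_lt_two_pow (hL _) hv
        · exact hL i
      obtain ⟨h1, h2⟩ := exec_doubleStep b14 b43 b50 (by omega) (by omega) hbL
        (by rw [b42]; exact hv)
      refine ⟨?_, ?_, h2, ?_, fun j => ?_⟩
      · rw [exec_reg _ _ _ _ (by decide), b14]
      · rw [exec_reg _ _ _ _ (by decide), b42]
      · rw [exec_reg _ _ _ _ (by decide), b50]
      · rw [h1, b42]
        by_cases hil : i < len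
        · rw [if_pos hil]
          by_cases hj : j = i + len
          · rw [hj, Function.update_self, if_pos (by omega), bL i, if_neg (by omega),
              Nat.add_sub_cancel]
          · rw [Function.update_of_ne hj, bL j]
            congr 1
            apply propext
            omega
        · rw [if_neg hil, bL j]
          congr 1
          apply propext
          omega)
  set m₁ := (doubleStep.exec w)^[4 ^ t] (m.setReg w 43 0) with hm₁
  have hx : double.exec w m = (Prog.op .add 50 50 50).exec w m₁ := by
    simp [double, exec, Mem.setReg, h16, hm₁]
  obtain ⟨-, -, -, k50, kL⟩ := key
  rw [hx]
  constructor
  · funext j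
    have : ((Prog.op .add 50 50 50).exec w m₁).arr 12 j = m₁.arr 12 j := rfl
    rw [this, kL j, CosetList.doubled]
    by_cases h1 : j < len
    · rw [if_pos h1, if_neg (by omega)]
    · rw [if_neg h1]
      by_cases h2 : j < 2 * len
      · rw [if_pos h2, if_pos (by omega)]
      · rw [if_neg h2, if_neg (by omega), hz j (by omega)]
  · have e : len + len < 2 ^ w := by omega
    simp [exec, Mem.setReg, WordOp.eval, k50, Nat.mod_eq_of_lt e]
    omega

/-- The state of the memory while the coset representatives are listed. -/
structure Listed (n t : ℕ) (T U : ℕ → ℕ) (p : ℕ) (m : Mem) : Prop where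
  consts : Consts n t m
  arr10 : m.arr 10 = T
  arr11 : m.arr 11 = U
  r47 : m.reg 47 = p
  list : CosetList n t (tableOf T) p (m.reg 50) (m.arr 12)

theorem exec_cosetStep {n t w : ℕ} {ψ : PureState n} {T U : ℕ → ℕ} (hw : 3 * n ≤ w)
    (hwt : 2 * 4 ^ t < 2 ^ w) (ht : ψ.IsArithmetic t) (hT : TableOK (2 * n) T)
    (hst : IsStabTable ψ (tableOf T)) (hU : TableOK (2 * n) U)
    (hUd : tableOf U = dualTable (2 * n) (tableOf T)) {p : ℕ} (hp : p < 2 * n) {m : Mem}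
    (h : Listed n t T U p m) : Listed n t T U (p + 1) (cosetStep.exec w m) := by
  obtain ⟨a1, a2⟩ := exec_loadRow h.consts hw h.r47 (by rw [h.arr10]; exact hT.lt p)
  set m₁ := loadRow.exec w m with hm₁
  have c1 : Consts n t m₁ := h.consts.exec w _ (by decide)
  have q11 : m₁.arr 11 = U := by rw [hm₁, exec_arr _ _ _ _ (by decide), h.arr11]
  obtain ⟨b1, b2⟩ := exec_reduce (A := 11) c1.r12 c1.r14 (show 2 * n ≤ w by omega)
    (by rw [q11]; exact hU) a1
  rw [q11, hUd, a2, h.arr10] at b2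
  set m₂ := (reduce 11).exec w m₁ with hm₂
  have c2 : Consts n t m₂ := c1.exec w _ (by decide)
  have q12 : m₂.arr 12 = m.arr 12 := by
    rw [hm₂, exec_arr _ _ _ _ (by decide), hm₁, exec_arr _ _ _ _ (by decide)]
  have hvb : bits (m₂.reg 42) = cosetVec n (tableOf T) p := b2
  have hLw : ∀ j, m₂.arr 12 j < 2 ^ w := fun j => by
    rw [q12]
    exact lt_two_pow_of_le (by omega) (h.list.lt j)
  have hsc := exec_scan c2.r14 c2.r16 hwt hLw
  set m₃ := scan.exec w m₂ with hm₃
  have c3 : Consts n t m₃ := c2.exec w _ (by decide)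
  have s12 : m₃.arr 12 = m.arr 12 := by rw [hm₃, exec_arr _ _ _ _ (by decide), q12]
  have s42 : m₃.reg 42 = m₂.reg 42 := by rw [hm₃, exec_reg _ _ _ _ (by decide)]
  have s50 : m₃.reg 50 = m.reg 50 := by
    rw [hm₃, exec_reg _ _ _ _ (by decide), hm₂, exec_reg _ _ _ _ (by decide), hm₁,
      exec_reg _ _ _ _ (by decide)]
  rw [q12] at hsc
  set m₄ := (Prog.ite 51 skip (.op .lt 52 50 16 ⨾ .ite 52 double skip)).exec w m₃ with hm₄
  have hx : cosetStep.exec w m = (Prog.op .add 47 47 14).exec w m₄ := rfl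
  have u47 : m₄.reg 47 = p := by
    rw [hm₄, exec_reg _ _ _ _ (by decide), hm₃, exec_reg _ _ _ _ (by decide), hm₂,
      exec_reg _ _ _ _ (by decide), hm₁, exec_reg _ _ _ _ (by decide), h.r47]
  have c4 : Consts n t m₄ := c3.exec w _ (by decide)
  have hlist : CosetList n t (tableOf T) (p + 1) (m₄.reg 50) (m₄.arr 12) := by
    by_cases hmem : ∃ j < 4 ^ t, m.arr 12 j = m₂.reg 42
    · have e50 : m₄.reg 50 = m.reg 50 := by
        rw [hm₄, exec, if_pos (hsc.mpr hmem), exec_reg _ _ _ _ (by decide), s50]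
      have e12 : m₄.arr 12 = m.arr 12 := by
        rw [hm₄, exec, if_pos (hsc.mpr hmem), exec_arr _ _ _ _ (by decide), s12]
      rw [e50, e12]
      exact h.list.step_of_mem hvb hmem
    · have hnew := h.list.step_of_notMem hst ht hp hvb hmem
      -- The guard of the program is always passed here, since the doubled length is at most `4^t`
      -- and the length is positive.
      have hlt : m.reg 50 < 4 ^ t := by
        have h1 := hnew.le
        have h2 := h.list.pos
        omega
      set m₅ := (Prog.op .lt 52 50 16).exec w m₃ with hm₅
      have e52 : m₅.reg 52 = 1 := by
        have e1 : 1 < 2 ^ w := by omega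
        simp [hm₅, exec, Mem.setReg, WordOp.eval, s50, c3.r16, hlt, Nat.mod_eq_of_lt e1]
      have hd : m₄ = double.exec w m₅ := by
        rw [hm₄, exec, if_neg (fun hne => hmem (hsc.mp hne)), exec, ← hm₅, exec,
          if_pos (by rw [e52]; exact one_ne_zero)]
      have c5 : Consts n t m₅ := c3.exec w _ (by decide)
      have v12 : m₅.arr 12 = m.arr 12 := s12
      have v42 : m₅.reg 42 = m₂.reg 42 := by
        rw [hm₅, exec_reg _ _ _ _ (by decide), s42]
      obtain ⟨d1, d2⟩ := exec_double c5.r14 c5.r16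
        (show m₅.reg 50 = m.reg 50 by rw [hm₅, exec_reg _ _ _ _ (by decide), s50]) hwt
        (by rw [v12, ← q12]; exact hLw) (by rw [v42]; exact lt_two_pow_of_le (by omega) b1)
        h.list.le (by rw [v12]; exact h.list.zero)
      rw [hd, d1, d2, v12, v42]
      exact hnew
  have hp1 : p + 1 < 2 ^ w := succ_lt_word (show 2 * n ≤ w by omega) hp
  have g10 : m₄.arr 10 = T := by
    rw [hm₄, exec_arr _ _ _ _ (by decide), hm₃, exec_arr _ _ _ _ (by decide), hm₂,
      exec_arr _ _ _ _ (by decide), hm₁, exec_arr _ _ _ _ (by decide), h.arr10]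
  have g11 : m₄.arr 11 = U := by
    rw [hm₄, exec_arr _ _ _ _ (by decide), hm₃, exec_arr _ _ _ _ (by decide), hm₂,
      exec_arr _ _ _ _ (by decide), q11]
  rw [hx]
  refine ⟨c4.exec w _ (by decide), g10, g11, ?_, ?_⟩
  · simp [exec, Mem.setReg, WordOp.eval, u47, c4.r14, Nat.mod_eq_of_lt hp1]
  · rw [exec_reg _ _ _ _ (by decide)]
    exact hlist

theorem exec_cosets {n t w : ℕ} {ψ : PureState n} {m : Mem} (hw : 3 * n ≤ w)
    (hwt : 2 * 4 ^ t < 2 ^ w) (ht : ψ.IsArithmetic t) (hc : Consts n t m)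
    (hT : TableOK (2 * n) (m.arr 10)) (hst : IsStabTable ψ (tableOf (m.arr 10)))
    (hUd : tableOf (m.arr 11) = dualTable (2 * n) (tableOf (m.arr 10)))
    (h12 : m.arr 12 = fun _ => 0) :
    ∃ len, CosetList n t (tableOf (m.arr 10)) (2 * n) len ((cosets.exec w m).arr 12) := by
  have hU : TableOK (2 * n) (m.arr 11) := by
    refine ⟨by rw [hUd]; exact dualTable_isReduced, fun p => ?_, fun p hp => ?_⟩
    · rw [← short_bits_iff]
      change Short _ (tableOf _ p)
      rw [hUd]
      exact short_dualTable p
    · rw [← tableOf_eq_zero_iff, hUd]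
      by_contra h0
      exact absurd (dualTable_ne_zero_iff.mp h0).1 (by omega)
  have e1 : 1 < 2 ^ w := by
    have := Nat.one_le_pow t 4 (by norm_num)
    omega
  set m₁ := (m.setReg w 47 0).setReg w 50 1 with hm₁
  have key := iterate_inv (f := cosetStep.exec w) (a := m₁) (N := 2 * n)
    (I := fun p => Listed n t (m.arr 10) (m.arr 11) p)
    ⟨hc.of_eq (by simp [hm₁, Mem.setReg]), rfl, rfl, by simp [hm₁, Mem.setReg], by
      have h50 : m₁.reg 50 = 1 := by simp [hm₁, Mem.setReg, Nat.mod_eq_of_lt e1]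
      have h12' : m₁.arr 12 = fun _ => 0 := h12
      rw [h50, h12']
      exact CosetList.init⟩
    (fun p hp b hb => exec_cosetStep hw hwt ht hT hst hU hUd hp hb)
  have hx : cosets.exec w m = (cosetStep.exec w)^[2 * n] m₁ := by
    simp [cosets, exec, Mem.setReg, hc.r12, hm₁]
  rw [hx]
  exact ⟨_, key.list⟩

end Learn
end

noncomputable section

/-! ## Rational approximations of the powers of `√2` -/

/-- `u / q` and `v / q` approximate `√2 ^ t` and `√2 ^ (t + 1)`. -/
structure Approximates (t q u v : ℕ) : Prop where
  le_q : 2 ^ (t + 5) ≤ q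
  q_le : q ≤ 4 ^ (t + 5)
  u_le : u ≤ 2 ^ t * 4 ^ (t + 5)
  v_le : v ≤ 2 ^ t * 4 ^ (t + 5)
  u_near : |(u : ℝ) - √2 ^ t * q| ≤ √2 ^ t / q
  v_near : |(v : ℝ) - √2 ^ (t + 1) * q| ≤ √2 ^ (t + 1) / q

/-- `|p - √2q|(p + √2q) = |p² - 2q²| = 1`, and the second factor is at least `q`. -/
theorem abs_sub_sqrt_two_mul_le {p q : ℕ} (hq : 0 < q)
    (h : (p : ℤ) ^ 2 - 2 * (q : ℤ) ^ 2 = 1 ∨ (p : ℤ) ^ 2 - 2 * (q : ℤ) ^ 2 = -1) :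
    |(p : ℝ) - √2 * q| ≤ 1 / q := by
  have hq' : (0 : ℝ) < q := by exact_mod_cast hq
  have h2 : √2 * √2 = 2 := Real.mul_self_sqrt (by norm_num)
  have h1 : (1 : ℝ) ≤ √2 := by
    rw [Real.one_le_sqrt]
    norm_num
  have hs : (q : ℝ) ≤ p + √2 * q := by nlinarith [Nat.cast_nonneg (α := ℝ) p]
  have hprod : |(p : ℝ) - √2 * q| * (p + √2 * q) = 1 := by
    rw [← abs_of_pos (show (0 : ℝ) < p + √2 * q by linarith), ← abs_mul]
    have e : ((p : ℝ) - √2 * q) * (p + √2 * q) = ((p : ℝ) ^ 2 - 2 * (q : ℝ) ^ 2) := by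
      linear_combination (-(q : ℝ) ^ 2) * h2
    rw [e]
    rcases h with h | h
    · rw [show (p : ℝ) ^ 2 - 2 * (q : ℝ) ^ 2 = 1 by exact_mod_cast h, abs_one]
    · rw [show (p : ℝ) ^ 2 - 2 * (q : ℝ) ^ 2 = -1 by exact_mod_cast h, abs_neg, abs_one]
  rw [le_div_iff₀ hq']
  calc |(p : ℝ) - √2 * q| * q ≤ |(p : ℝ) - √2 * q| * (p + √2 * q) := by gcongr
    _ = 1 := hprod

/-- Bounds for the constants, for the absence of overflows. -/
theorem Approximates.bounds {t q u v : ℕ} (h : Approximates t q u v) :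
    q ≤ 2 ^ (2 * t + 10) ∧ u + v ≤ 2 ^ (3 * t + 11) := by
  have hpow : 4 ^ (t + 5) = 2 ^ (2 * t + 10) := by
    rw [show (4 : ℕ) = 2 ^ 2 from rfl, ← pow_mul]; congr 1
  have h2 : 2 ^ t * 2 ^ (2 * t + 10) + 2 ^ t * 2 ^ (2 * t + 10) = 2 ^ (3 * t + 11) := by
    rw [← two_mul, ← pow_add, ← pow_succ']; congr 1; omega
  have h3 := h.u_le
  have h4 := h.v_le
  have h5 := h.q_le
  rw [hpow] at h3 h4 h5
  exact ⟨h5, by omega⟩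

/-! ### Computing the approximations and thresholds without overflow -/

namespace Learn

open Prog

theorem exec_pellStep {w : ℕ} {m : Mem} (h13 : m.reg 13 = 0)
    (h : m.reg 22 + m.reg 22 + m.reg 25 < 2 ^ w) :
    (pellStep.exec w m).reg 22 = m.reg 22 + m.reg 25 ∧
    (pellStep.exec w m).reg 25 = m.reg 22 + m.reg 22 + m.reg 25 := by
  have e1 : m.reg 22 + m.reg 22 < 2 ^ w := by omega
  have e2 : m.reg 22 + m.reg 25 < 2 ^ w := by omega
  simp [pellStep, exec, Mem.setReg, WordOp.eval, h13, Nat.mod_eq_of_lt h, Nat.mod_eq_of_lt e1,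
    Nat.mod_eq_of_lt e2]

theorem exec_scaleStep {w : ℕ} {m : Mem} (h13 : m.reg 13 = 0) (h1 : m.reg 24 < 2 ^ w)
    (h2 : m.reg 23 + m.reg 23 < 2 ^ w) :
    (scaleStep.exec w m).reg 23 = m.reg 24 ∧
    (scaleStep.exec w m).reg 24 = m.reg 23 + m.reg 23 := by
  simp [scaleStep, exec, Mem.setReg, WordOp.eval, h13, Nat.mod_eq_of_lt h1, Nat.mod_eq_of_lt h2]

theorem exec_approx {n t : ℕ} {m : Mem} (hn : 1 ≤ n) (hc : Consts n t m) :
    Approximates t ((approx.exec (64 * (n + t)) m).reg 22) ((approx.exec (64 * (n + t)) m).reg 23)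
      ((approx.exec (64 * (n + t)) m).reg 24) := by
  set w := 64 * (n + t) with hw
  have e1 : 1 < 2 ^ w := pow_lt_word 1 (a := 0) (by norm_num) (by omega)
  have hpow : 4 ^ (t + 5) = 2 ^ (2 * t + 10) := by
    rw [show (4 : ℕ) = 2 ^ 2 from rfl, ← pow_mul]; congr 1
  have e4 : 4 * 4 ^ (t + 5) < 2 ^ w := pow_lt_word _ (a := 2 * t + 12) (by
    rw [hpow, show 4 = 2 ^ 2 from rfl, ← pow_add]
    exact Nat.pow_le_pow_right (by norm_num) (by omega)) (by omega)
  have e5 : 2 * (2 ^ t * 4 ^ (t + 5)) < 2 ^ w := pow_lt_word _ (a := 3 * t + 11) (by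
    rw [hpow, ← pow_add, ← pow_succ']
    exact Nat.pow_le_pow_right (by norm_num) (by omega)) (by omega)
  set m₀ := (m.setReg w 22 1).setReg w 25 1 with hm₀
  have z13 : m₀.reg 13 = 0 := by simp [hm₀, Mem.setReg, hc.r13]
  -- After `t + 5` steps `q ≥ 32·2^t`, which makes the error of an approximated candidate at most
  -- `q/128`; the upper bound `4^(t+5)` controls the word length.
  have key := iterate_inv (f := pellStep.exec w) (a := m₀) (N := t + 5)
    (I := fun i m' => m'.reg 13 = 0 ∧ 2 ^ i ≤ m'.reg 22 ∧ m'.reg 22 ≤ m'.reg 25 ∧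
      m'.reg 25 ≤ 4 ^ i ∧
      (((m'.reg 25 : ℕ) : ℤ) ^ 2 - 2 * ((m'.reg 22 : ℕ) : ℤ) ^ 2 = 1 ∨
        ((m'.reg 25 : ℕ) : ℤ) ^ 2 - 2 * ((m'.reg 22 : ℕ) : ℤ) ^ 2 = -1))
    ⟨z13, by simp [hm₀, Mem.setReg, Nat.mod_eq_of_lt e1], by simp [hm₀, Mem.setReg],
      by simp [hm₀, Mem.setReg, Nat.mod_eq_of_lt e1],
      by simp [hm₀, Mem.setReg, Nat.mod_eq_of_lt e1]⟩ (by
      rintro i hi b ⟨b13, b1, b2, b3, b4⟩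
      have h4 : 4 ^ i ≤ 4 ^ (t + 5) := Nat.pow_le_pow_right (by norm_num) hi.le
      obtain ⟨s1, s2⟩ := exec_pellStep (w := w) b13 (by omega)
      rw [s1, s2, pow_succ, pow_succ]
      refine ⟨by rw [exec_reg _ _ _ _ (by decide), b13], by omega, by omega, by omega, ?_⟩
      push_cast
      rcases b4 with b4 | b4
      · right; linear_combination -b4
      · left; linear_combination -b4)
  set m₁ := (pellStep.exec w)^[t + 5] m₀ with hm₁
  obtain ⟨k13, k1, k2, k3, k4⟩ := key
  set q := m₁.reg 22 with hq
  set p := m₁.reg 25 with hp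
  have hqpos : 0 < q := lt_of_lt_of_le (by positivity) k1
  have hnear := abs_sub_sqrt_two_mul_le hqpos k4
  have k11 : m₁.reg 11 = t := by
    have h0 : m₁ = (Prog.const 22 1 ⨾ .const 25 1 ⨾ .loop 20 pellStep).exec w m := by
      simp [exec, hm₁, hm₀, Mem.setReg, hc.r20]
    rw [h0, exec_reg _ _ _ _ (by decide), hc.r11]
  set m₂ := (m₁.setReg w 23 q).setReg w 24 p with hm₂
  have hs : (0 : ℝ) < √2 := by positivity
  have h2 : √2 * √2 = 2 := Real.mul_self_sqrt (by norm_num)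
  have hs1 : (1 : ℝ) ≤ √2 := by
    rw [Real.one_le_sqrt]
    norm_num
  have hqr : (0 : ℝ) < q := by exact_mod_cast hqpos
  have key2 := iterate_inv (f := scaleStep.exec w) (a := m₂) (N := t)
    (I := fun i m' => m'.reg 13 = 0 ∧ m'.reg 22 = q ∧ m'.reg 23 ≤ 2 ^ i * 4 ^ (t + 5) ∧
      m'.reg 24 ≤ 2 ^ i * 4 ^ (t + 5) ∧
      |((m'.reg 23 : ℕ) : ℝ) - √2 ^ i * q| ≤ √2 ^ i / q ∧
      |((m'.reg 24 : ℕ) : ℝ) - √2 ^ (i + 1) * q| ≤ √2 ^ (i + 1) / q)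
    (by
      have f1 : m₂.reg 23 = q := by
        simp [hm₂, Mem.setReg, Nat.mod_eq_of_lt (show q < 2 ^ w by omega)]
      have f2 : m₂.reg 24 = p := by
        simp [hm₂, Mem.setReg, Nat.mod_eq_of_lt (show p < 2 ^ w by omega)]
      rw [f1, f2]
      refine ⟨by simp [hm₂, Mem.setReg, k13], by simp [hm₂, Mem.setReg, hq], by omega, by omega,
        ?_, ?_⟩
      · simp
      · rw [zero_add, pow_one]
        refine hnear.trans ?_
        gcongr) (by
      rintro i hi b ⟨b13, b22, b1, b2, b3, b4⟩
      have h4 : 2 ^ i * 4 ^ (t + 5) ≤ 2 ^ t * 4 ^ (t + 5) := by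
        gcongr
        norm_num
      obtain ⟨s1, s2⟩ := exec_scaleStep (w := w) b13 (by omega) (by omega)
      rw [s1, s2]
      refine ⟨by rw [exec_reg _ _ _ _ (by decide), b13],
        by rw [exec_reg _ _ _ _ (by decide), b22], ?_, ?_, b4, ?_⟩
      · rw [pow_succ, mul_right_comm]; omega
      · rw [pow_succ, mul_right_comm]; omega
      · push_cast
        have e : √2 ^ (i + 1 + 1) = 2 * √2 ^ i := by
          rw [pow_succ, pow_succ, mul_assoc, h2]; ring
        rw [e, show (b.reg 23 : ℝ) + b.reg 23 - 2 * √2 ^ i * q =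
          2 * ((b.reg 23 : ℝ) - √2 ^ i * q) by ring, abs_mul, abs_two, mul_div_assoc]
        gcongr)
  have hx : approx.exec w m = (scaleStep.exec w)^[t] m₂ := by
    have h0 : approx.exec w m = (Prog.op .add 23 22 13 ⨾ .op .add 24 25 13 ⨾
        .loop 11 scaleStep).exec w m₁ := by
      simp [approx, exec, hm₁, hm₀, Mem.setReg, hc.r20]
    rw [h0]
    have h1 : m₂.reg 11 = t := by simp [hm₂, Mem.setReg, k11]
    have h3 : (Prog.op .add 24 25 13).exec w ((Prog.op .add 23 22 13).exec w m₁) = m₂ := by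
      simp [exec, WordOp.eval, hm₂, Mem.setReg, k13, hq, hp]
    simp only [exec] at h3 ⊢
    rw [h3, h1]
  rw [hx]
  obtain ⟨-, l22, l1, l2, l3, l4⟩ := key2
  rw [l22]
  exact ⟨k1, k2.trans k3, l1, l2, l3, l4⟩

/-- The constants for the comparison of estimates and candidates. -/
structure Calibrated (n t : ℕ) (m : Mem) : Prop where
  approx : Approximates t (m.reg 22) (m.reg 23) (m.reg 24)
  r26 : m.reg 26 = 16 * (16384 * (4 ^ t * n) *
    (2 ^ ((t + 1) / 2) * (m.reg 23 + m.reg 24) + 2 ^ t * m.reg 22))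
  r27 : m.reg 27 = 16384 * (4 ^ t * n) * m.reg 22
  r28 : m.reg 28 = 2 * (2 ^ t * m.reg 22)

theorem Calibrated.of_eq {n t : ℕ} {m m' : Mem} (h : Calibrated n t m)
    (heq : ∀ r ∈ [22, 23, 24, 26, 27, 28], m'.reg r = m.reg r) : Calibrated n t m' := by
  simp only [List.forall_mem_cons, List.not_mem_nil, false_imp_iff, implies_true, and_true] at heq
  obtain ⟨a, b, c, d, e, f⟩ := heq
  refine ⟨?_, ?_, ?_, ?_⟩ <;> simp only [a, b, c, d, e, f]
  exacts [h.approx, h.r26, h.r27, h.r28]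

theorem Calibrated.sem {n t : ℕ} {m m' : Mem} (h : Calibrated n t m) {w : ℕ} {ψ : PureState n}
    {p : Prog} (hm : m' ∈ (p.sem w ψ m).support)
    (hp : ∀ r ∈ [22, 23, 24, 26, 27, 28], r ∉ p.wregs) : Calibrated n t m' :=
  h.of_eq fun r hr => (sem_frame w ψ p m m' hm).1 r (hp r hr)

theorem mul_lt_word {n t a b x y : ℕ} (hx : x ≤ 2 ^ a) (hy : y ≤ 2 ^ b)
    (h : a + b < 64 * (n + t)) : x * y < 2 ^ (64 * (n + t)) :=
  pow_lt_word _ (a := a + b) (by rw [pow_add]; gcongr) h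

theorem shots_le (n t : ℕ) : 16384 * (4 ^ t * n) ≤ 2 ^ (2 * t + n + 14) := by
  have hn : n ≤ 2 ^ n := Nat.lt_two_pow_self.le
  calc 16384 * (4 ^ t * n) ≤ 2 ^ 14 * (2 ^ (2 * t) * 2 ^ n) := by
        rw [pow_mul]
        gcongr <;> norm_num
    _ = 2 ^ (2 * t + n + 14) := by rw [← pow_add, ← pow_add]; congr 1; omega

theorem exec_thresholds {n t : ℕ} {m : Mem} (hn : 1 ≤ n) (hc : Consts n t m)
    (h : Approximates t (m.reg 22) (m.reg 23) (m.reg 24)) :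
    Calibrated n t (thresholds.exec (64 * (n + t)) m) := by
  set w := 64 * (n + t) with hw
  obtain ⟨hq, huv⟩ := h.bounds
  have hN := shots_le n t
  generalize hq' : m.reg 22 = q at *
  generalize hu' : m.reg 23 = u at *
  generalize hv' : m.reg 24 = v at *
  have r17 := hc.r17
  have r19 := hc.r19
  have hRle : 2 ^ ((t + 1) / 2) ≤ 2 ^ (t + 1) := Nat.pow_le_pow_right (by norm_num) (by omega)
  generalize hNe : 16384 * (4 ^ t * n) = N at *
  generalize hRe : 2 ^ ((t + 1) / 2) = R at *
  have b1 : u + v < 2 ^ w := pow_lt_word _ huv (by omega)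
  have b2 : (u + v) * R < 2 ^ w := mul_lt_word huv hRle (by omega)
  have b3 : 2 ^ t * q < 2 ^ w := mul_lt_word le_rfl hq (by omega)
  have b4' : (u + v) * R + 2 ^ t * q ≤ 2 ^ (4 * t + 13) := by
    calc (u + v) * R + 2 ^ t * q ≤ 2 ^ (3 * t + 11) * 2 ^ (t + 1) + 2 ^ t * 2 ^ (2 * t + 10) := by
          gcongr
      _ = 2 ^ (4 * t + 12) + 2 ^ (3 * t + 10) := by
          rw [← pow_add, ← pow_add]; congr 2 <;> omega
      _ ≤ 2 ^ (4 * t + 12) + 2 ^ (4 * t + 12) := by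
          gcongr <;> omega
      _ = 2 ^ (4 * t + 13) := by rw [← two_mul, ← pow_succ']
  have b4 : (u + v) * R + 2 ^ t * q < 2 ^ w := pow_lt_word _ b4' (by omega)
  have b5 : ((u + v) * R + 2 ^ t * q) * N < 2 ^ w := mul_lt_word b4' hN (by omega)
  have b6 : ((u + v) * R + 2 ^ t * q) * N * 16 < 2 ^ w := by
    rw [mul_assoc]
    refine mul_lt_word b4' (b := 2 * t + n + 14 + 4) ?_ (by omega)
    rw [pow_add]
    gcongr
    norm_num
  have b7 : N * q < 2 ^ w := mul_lt_word hN hq (by omega)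
  have b8 : 2 ^ t * q + 2 ^ t * q < 2 ^ w := by
    rw [← two_mul, ← mul_assoc, ← pow_succ']
    exact mul_lt_word le_rfl hq (by omega)
  have s22 : (thresholds.exec w m).reg 22 = q := by rw [exec_reg _ _ _ _ (by decide), hq']
  have s23 : (thresholds.exec w m).reg 23 = u := by rw [exec_reg _ _ _ _ (by decide), hu']
  have s24 : (thresholds.exec w m).reg 24 = v := by rw [exec_reg _ _ _ _ (by decide), hv']
  refine ⟨by rw [s22, s23, s24]; exact h, ?_, ?_, ?_⟩
  all_goals
    simp only [s22, s23, s24, hNe, hRe]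
    simp [thresholds, exec, Mem.setReg, WordOp.eval, hq', hu', hv', r17, r19, hc.r29, hc.r38,
      Nat.mod_eq_of_lt b1, Nat.mod_eq_of_lt b2, Nat.mod_eq_of_lt b3, Nat.mod_eq_of_lt b4,
      Nat.mod_eq_of_lt b5, Nat.mod_eq_of_lt b6, Nat.mod_eq_of_lt b7, Nat.mod_eq_of_lt b8]
    try ring

end Learn
end

noncomputable section

open scoped ENNReal

/-! ## Estimating an expectation value -/

theorem PureState.mean_shotDist {n : ℕ} (ψ : PureState n) (P : Pauli n) (F : Bool → ℝ)
    (hF : ∀ b, 0 ≤ F b) :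
    ((ψ.shotDist P).mean fun b => ENNReal.ofReal (F b)) =
      ENNReal.ofReal ((1 + ψ.expect P) / 2 * F false + (1 - ψ.expect P) / 2 * F true) := by
  have h := abs_le.mp (ψ.abs_expect_le P)
  have h1 : 0 ≤ (1 + ψ.expect P) / 2 := by linarith
  have h2 : 0 ≤ (1 - ψ.expect P) / 2 := by linarith
  rw [PMF.mean, tsum_fintype, Fintype.sum_bool, add_comm,
    ENNReal.ofReal_add (mul_nonneg h1 (hF _)) (mul_nonneg h2 (hF _)), ENNReal.ofReal_mul h1,
    ENNReal.ofReal_mul h2]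
  simp only [PureState.shotDist, PMF.ofFintype_apply, if_true, Bool.false_eq_true, if_false]
  rw [one_mul, neg_one_mul, ← sub_eq_add_neg]

/-- A crude Hoeffding bound: `e^{±c} ≤ 1 ± c + c²` makes the left side at most `1 + cx + c²`. -/
theorem moment_le {x c : ℝ} (hx : |x| ≤ 1) (hc : |c| ≤ 1) :
    (1 + x) / 2 * Real.exp c + (1 - x) / 2 * Real.exp (-c) ≤ Real.exp (c * x + c ^ 2) := by
  have h := abs_le.mp hx
  have h1 := (abs_le.mp (Real.abs_exp_sub_one_sub_id_le hc)).2
  have h2 := (abs_le.mp (Real.abs_exp_sub_one_sub_id_le (x := -c) (by rwa [abs_neg]))).2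
  have h3 := Real.add_one_le_exp (c * x + c ^ 2)
  nlinarith [mul_le_mul_of_nonneg_left h1 (show 0 ≤ (1 + x) / 2 by linarith),
    mul_le_mul_of_nonneg_left h2 (show 0 ≤ (1 - x) / 2 by linarith)]

namespace Learn

open Prog

/-- The state of the memory while the shots are counted. -/
structure Counting (n t v i : ℕ) (m : Mem) : Prop where
  consts : Consts n t m
  r42 : m.reg 42 = v
  r48 : m.reg 48 = v >>> n
  r53 : m.reg 53 ≤ i

theorem shotStep_sem {n t v i w : ℕ} (ψ : PureState n) {m : Mem} (h : Counting n t v i m)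
    (hi : i + 1 < 2 ^ w) :
    ∃ f : Bool → Mem, shotStep.sem w ψ m = (ψ.shotDist (toPauli n (bits v))).map f ∧
      ∀ b, (f b).reg 53 = m.reg 53 + if b then 1 else 0 := by
  refine ⟨fun b => (m.setReg w 49 (if b then 1 else 0)).setReg w 53
    (m.reg 53 + if b then 1 else 0), ?_, fun b => ?_⟩
  · simp only [shotStep, Prog.sem, h.r42, h.r48, decodePauli_eq, PMF.bind_map]
    rw [PMF.map]
    congr 1
    funext b
    have e1 : 1 < 2 ^ w := by omega
    cases b <;> simp [Mem.setReg, WordOp.eval, Nat.mod_eq_of_lt e1]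
  · have := h.r53
    have e : m.reg 53 + (if b then 1 else 0) < 2 ^ w := by split_ifs <;> omega
    simp [Mem.setReg, Nat.mod_eq_of_lt e]

theorem shotStep_support {n t v i w : ℕ} {ψ : PureState n} {m : Mem} (h : Counting n t v i m)
    (hi : i + 1 < 2 ^ w) : ∀ m' ∈ (shotStep.sem w ψ m).support, Counting n t v (i + 1) m' := by
  intro m' hm'
  refine ⟨h.consts.sem hm' (by decide), ?_, ?_, ?_⟩
  · rw [(sem_frame _ _ _ _ _ hm').1 42 (by decide), h.r42]
  · rw [(sem_frame _ _ _ _ _ hm').1 48 (by decide), h.r48]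
  · obtain ⟨f, hf, hf'⟩ := shotStep_sem ψ h hi
    rw [hf, PMF.support_map] at hm'
    obtain ⟨b, -, rfl⟩ := hm'
    rw [hf' b]
    have := h.r53
    split_ifs <;> omega

/-- Register `53` counts the outcomes `-1`, so each shot `±1` equals `1` minus twice its increment.
The summand `-c` in the factor compensates for that `1`. -/
theorem shotStep_mean_le {n t v i w : ℕ} {ψ : PureState n} {m : Mem} (h : Counting n t v i m)
    (hi : i + 1 < 2 ^ w) {c : ℝ} (hc : |c| ≤ 1) (d : ℝ) :
    ((shotStep.sem w ψ m).mean fun m' => ENNReal.ofReal (Real.exp (d - 2 * c * m'.reg 53))) ≤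
      ENNReal.ofReal (Real.exp (c * ψ.expect (toPauli n (bits v)) + c ^ 2 - c)) *
        ENNReal.ofReal (Real.exp (d - 2 * c * m.reg 53)) := by
  obtain ⟨f, hf, hf'⟩ := shotStep_sem ψ h hi
  rw [hf, PMF.mean_map]
  simp only [hf']
  rw [ψ.mean_shotDist _ (fun b => Real.exp (d - 2 * c * ((m.reg 53 + if b then 1 else 0 : ℕ) : ℝ)))
    (fun _ => (Real.exp_pos _).le), ← ENNReal.ofReal_mul (Real.exp_pos _).le]
  apply ENNReal.ofReal_le_ofReal
  set x := ψ.expect (toPauli n (bits v))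
  set K : ℝ := (m.reg 53 : ℝ) with hK
  have hm := moment_le (ψ.abs_expect_le (toPauli n (bits v))) hc
  have e1 : Real.exp (d - 2 * c * ((m.reg 53 + if false = true then 1 else 0 : ℕ) : ℝ)) =
      Real.exp (d - 2 * c * K - c) * Real.exp c := by
    rw [← Real.exp_add]
    congr 1
    simp [hK]
  have e2 : Real.exp (d - 2 * c * ((m.reg 53 + if true = true then 1 else 0 : ℕ) : ℝ)) =
      Real.exp (d - 2 * c * K - c) * Real.exp (-c) := by
    rw [← Real.exp_add]
    congr 1
    simp [hK]
    ring
  have e3 : Real.exp (c * x + c ^ 2 - c) * Real.exp (d - 2 * c * K) =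
      Real.exp (d - 2 * c * K - c) * Real.exp (c * x + c ^ 2) := by
    rw [← Real.exp_add, ← Real.exp_add]
    congr 1
    ring
  rw [e1, e2, e3]
  calc _ = Real.exp (d - 2 * c * K - c) *
        ((1 + x) / 2 * Real.exp c + (1 - x) / 2 * Real.exp (-c)) := by ring
    _ ≤ _ := by gcongr

/-- The deviation of the estimate in one direction. -/
theorem shots_ensures {n t v w N : ℕ} {ψ : PureState n} {m : Mem} (h : Counting n t v 0 m)
    (hN : N < 2 ^ w) {s δ : ℝ} (hs : |s| = 1) (hδ : 0 ≤ δ) (hδ' : δ ≤ 1) :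
    (PMF.iter (shotStep.sem w ψ) N m).Ensures (ENNReal.ofReal (Real.exp (-(N * δ ^ 2 / 4))))
      fun m' => s * (N - 2 * m'.reg 53 - N * ψ.expect (toPauli n (bits v))) ≤ N * δ := by
  set x := ψ.expect (toPauli n (bits v)) with hx
  -- This choice balances `Nc²` from the moment bound against the deviation: the exponent becomes
  -- `Nδ²/4 - Nδ²/2`. The constant `d` normalizes the potential to be at least `1` when the
  -- deviation exceeds `Nδ`.
  set c := s * δ / 2 with hc
  have hs2 : s ^ 2 = 1 := by rw [← sq_abs, hs, one_pow]
  have hc1 : |c| ≤ 1 := by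
    rw [hc, abs_div, abs_mul, hs, one_mul, abs_of_nonneg hδ, abs_two]
    linarith
  set d := c * N - c * N * x - N * δ ^ 2 / 2 with hd
  refine PMF.ensures_of_mean (Φ := fun m' => ENNReal.ofReal (Real.exp (d - 2 * c * m'.reg 53))) ?_ ?_
  · refine (PMF.iter_mean_le (I := fun i => Counting n t v i) h
      (fun i hi b hb => shotStep_support hb (by omega))
      fun i hi b hb => shotStep_mean_le hb (by omega) hc1 d).trans (le_of_eq ?_)
    have h0 : m.reg 53 = 0 := by have := h.r53; omega
    rw [← ENNReal.ofReal_pow (Real.exp_pos _).le, ← ENNReal.ofReal_mul (by positivity),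
      ← Real.exp_nat_mul, ← Real.exp_add, h0, ← hx]
    congr 2
    rw [hd, hc]
    push_cast
    linear_combination ((N : ℝ) * δ ^ 2 / 4) * hs2
  · intro m' _ hm'
    rw [not_le] at hm'
    rw [ENNReal.one_le_ofReal, Real.one_le_exp_iff, hd, hc]
    nlinarith

/-- The estimate is accurate except with small probability. -/
theorem estimate_ensures {n t w : ℕ} {ψ : PureState n} {m : Mem} (hc : Consts n t m)
    (hv : m.reg 42 < 2 ^ w) (hN : 16384 * (4 ^ t * n) < 2 ^ w) :
    (estimate.sem w ψ m).Ensures (ENNReal.ofReal (2 * Real.exp (-(4 * n)))) fun m' =>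
      m'.reg 48 = m.reg 42 >>> n ∧ m'.reg 53 ≤ 16384 * (4 ^ t * n) ∧
      |(16384 * (4 ^ t * n) : ℝ) - 2 * m'.reg 53 -
        (16384 * (4 ^ t * n)) * ψ.expect (toPauli n (bits (m.reg 42)))| ≤
        (16384 * (4 ^ t * n)) * ((2 : ℝ)⁻¹ ^ t / 32) := by
  set m₁ := (m.setReg w 48 (m.reg 42 >>> n)).setReg w 53 0 with hm₁
  have hsh : m.reg 42 >>> n < 2 ^ w := lt_of_le_of_lt (Nat.shiftRight_le _ _) hv
  have c1 : Counting n t (m.reg 42) 0 m₁ :=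
    ⟨hc.of_eq (by simp [hm₁, Mem.setReg]), by simp [hm₁, Mem.setReg],
      by simp [hm₁, Mem.setReg, Nat.mod_eq_of_lt hsh], by simp [hm₁, Mem.setReg]⟩
  have hsem : estimate.sem w ψ m = PMF.iter (shotStep.sem w ψ) (16384 * (4 ^ t * n)) m₁ := by
    have h17 : m₁.reg 17 = 16384 * (4 ^ t * n) := c1.consts.r17
    simp only [estimate, Prog.sem, PMF.pure_bind, WordOp.eval, hc.r10, ← hm₁, h17]
  rw [hsem]
  set N := 16384 * (4 ^ t * n) with hNdef
  have hNr : (16384 * (4 ^ t * n) : ℝ) = (N : ℝ) := by rw [hNdef]; push_cast; ring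
  rw [hNr]
  set δ : ℝ := (2 : ℝ)⁻¹ ^ t / 32 with hδ
  have hp : (2 : ℝ)⁻¹ ^ t ≤ 1 := pow_le_one₀ (by norm_num) (by norm_num)
  have hp0 : (0 : ℝ) < (2 : ℝ)⁻¹ ^ t := by positivity
  -- The number `16384 = 16·1024` of shots per `4^t·n` is chosen for this: `δ² = 4^{-t}/1024`.
  have hexp : (N : ℝ) * δ ^ 2 / 4 = 4 * n := by
    have h4 : (4 : ℝ) ^ t * ((2 : ℝ)⁻¹ ^ t) ^ 2 = 1 := by
      rw [← pow_mul, mul_comm t 2, pow_mul, ← mul_pow]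
      norm_num
    rw [← hNr, hδ]
    linear_combination (4 * (n : ℝ)) * h4
  have hboth := PMF.ensures_forall (μ := PMF.iter (shotStep.sem w ψ) N m₁) (Finset.univ : Finset Bool)
    (ε := fun _ => ENNReal.ofReal (Real.exp (-(4 * n))))
    (Q := fun b m' => (if b then (-1 : ℝ) else 1) *
      (N - 2 * m'.reg 53 - N * ψ.expect (toPauli n (bits (m.reg 42)))) ≤ N * δ) (by
      intro b _
      rw [← hexp]
      exact shots_ensures c1 hN (by cases b <;> simp) (by positivity) (by rw [hδ]; linarith))
  refine hboth.mono ?_ ?_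
  · rw [Finset.sum_const, Finset.card_univ, Fintype.card_bool, two_nsmul,
      ← ENNReal.ofReal_add (Real.exp_pos _).le (Real.exp_pos _).le, two_mul]
  · intro m' hm' hQ
    have hk := PMF.iter_support (I := fun i => Counting n t (m.reg 42) i) c1
      (fun i hi b hb => shotStep_support (ψ := ψ) hb (by omega)) m' hm'
    refine ⟨hk.r48, hk.r53, abs_le.mpr ⟨?_, ?_⟩⟩
    · have := hQ true (Finset.mem_univ _)
      rw [if_pos rfl] at this
      linarith
    · have := hQ false (Finset.mem_univ _)
      rw [if_neg (by simp), one_mul] at this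
      exact this

end Learn
end

noncomputable section

open scoped ENNReal

/-! ## Recognizing an expectation value -/

theorem add_mul_sqrt_two_inj {a b c d : ℤ} (h : (a : ℝ) + b * √2 = c + d * √2) : a = c ∧ b = d := by
  have hbd : b = d := by
    by_contra hne
    apply irrational_sqrt_two
    refine ⟨((c - a : ℤ) : ℚ) / ((b - d : ℤ) : ℚ), ?_⟩
    have : ((b : ℝ) - d) ≠ 0 := by
      rw [sub_ne_zero]
      exact_mod_cast hne
    push_cast
    rw [div_eq_iff this]
    linarith
  subst hbd
  exact ⟨by exact_mod_cast add_right_cancel h, rfl⟩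

theorem sqrt_two_pow_mul_self (t : ℕ) : √2 ^ t * √2 ^ t = 2 ^ t := by
  rw [← mul_pow, Real.mul_self_sqrt (by norm_num)]

theorem sqrt_two_pow_le (t : ℕ) : √2 ^ t ≤ 2 ^ ((t + 1) / 2) := by
  have h1 : (1 : ℝ) ≤ √2 := by
    rw [Real.one_le_sqrt]
    norm_num
  calc √2 ^ t ≤ √2 ^ (2 * ((t + 1) / 2)) := pow_le_pow_right₀ h1 (by omega)
    _ = 2 ^ ((t + 1) / 2) := by rw [pow_mul, Real.sq_sqrt (by norm_num)]

theorem two_pow_half_le (t : ℕ) : (2 : ℝ) ^ ((t + 1) / 2) ≤ √2 * √2 ^ t := by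
  have h1 : (1 : ℝ) ≤ √2 := by
    rw [Real.one_le_sqrt]
    norm_num
  calc (2 : ℝ) ^ ((t + 1) / 2) = √2 ^ (2 * ((t + 1) / 2)) := by
        rw [pow_mul, Real.sq_sqrt (by norm_num)]
    _ ≤ √2 ^ (t + 1) := pow_le_pow_right₀ h1 (by omega)
    _ = √2 * √2 ^ t := by rw [pow_succ']

/-- The error of the rational approximation of `a + b √2`. -/
theorem Approximates.abs_le {t q u v : ℕ} (h : Approximates t q u v) {a b : ℤ}
    (ha : |(a : ℝ)| ≤ 2 ^ ((t + 1) / 2)) (hb : |(b : ℝ)| ≤ 2 ^ ((t + 1) / 2)) :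
    |(a * u + b * v : ℝ) - √2 ^ t * (a + b * √2) * q| ≤ q / 128 := by
  have hq : (2 : ℝ) ^ (t + 5) ≤ q := by exact_mod_cast h.le_q
  have hq0 : (0 : ℝ) < q := lt_of_lt_of_le (by positivity) hq
  have hs0 : (0 : ℝ) < √2 ^ t := by positivity
  have h2 : √2 * √2 = 2 := Real.mul_self_sqrt (by norm_num)
  have h2' : √2 ≤ 3 / 2 := by
    rw [Real.sqrt_le_left (by norm_num)]
    norm_num
  have hR := two_pow_half_le t
  set s := √2 ^ t with hs
  have hss : s * s = 2 ^ t := sqrt_two_pow_mul_self t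
  have hv := h.v_near
  rw [pow_succ, ← hs] at hv
  have hu := h.u_near
  rw [← hs] at hu
  have hsplit : (a * u + b * v : ℝ) - s * (a + b * √2) * q =
      a * (u - s * q) + b * (v - s * √2 * q) := by ring
  rw [hsplit]
  have h1 : |(a : ℝ) * (u - s * q)| ≤ √2 * s * (s / q) := by
    rw [abs_mul]
    exact mul_le_mul (ha.trans hR) hu (abs_nonneg _) (by positivity)
  have h3 : |(b : ℝ) * (v - s * √2 * q)| ≤ √2 * s * (s * √2 / q) := by
    rw [abs_mul]
    exact mul_le_mul (hb.trans hR) hv (abs_nonneg _) (by positivity)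
  -- This is at most `q/128`, because `q² ≥ 1024·4^t` and `128(√2 + 2) ≤ 448`.
  have h4 : √2 * s * (s / q) + √2 * s * (s * √2 / q) = (√2 + 2) * 2 ^ t / q := by
    rw [← hss]
    field_simp
    linear_combination h2
  refine (abs_add_le _ _).trans ((add_le_add h1 h3).trans ?_)
  rw [h4, div_le_div_iff₀ hq0 (by norm_num)]
  have ht : (1 : ℝ) ≤ 2 ^ t := one_le_pow₀ (by norm_num)
  have hq2 : (32 * 2 ^ t) * (32 * 2 ^ t) ≤ (q : ℝ) * q := by
    have : (32 * 2 ^ t : ℝ) ≤ q := by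
      rw [pow_add] at hq
      linarith
    exact mul_self_le_mul_self (by positivity) this
  nlinarith

/-- The comparison with an accurate estimate recognizes the expectation value. -/
theorem Approximates.near_iff {t q u v : ℕ} (h : Approximates t q u v) {N K x : ℝ} (hN : 0 < N)
    (hK : |N - 2 * K - N * x| ≤ N * ((2 : ℝ)⁻¹ ^ t / 32)) {a₀ b₀ : ℤ}
    (hx : x = (a₀ + b₀ * √2) / √2 ^ t) (hx' : |(a₀ - b₀ * √2) / √2 ^ t| ≤ 1) {a b : ℤ}
    (ha : |(a : ℝ)| ≤ 2 ^ ((t + 1) / 2)) (hb : |(b : ℝ)| ≤ 2 ^ ((t + 1) / 2)) :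
    16 * |N * (a * u + b * v) - 2 ^ t * q * (N - 2 * K)| < N * q ↔ a = a₀ ∧ b = b₀ := by
  have happ := h.abs_le ha hb
  have hq : (2 : ℝ) ^ (t + 5) ≤ q := by exact_mod_cast h.le_q
  have hq0 : (0 : ℝ) < q := lt_of_lt_of_le (by positivity) hq
  have h2 : √2 * √2 = 2 := Real.mul_self_sqrt (by norm_num)
  have h2' : √2 ≤ 3 / 2 := by
    rw [Real.sqrt_le_left (by norm_num)]
    norm_num
  have hR := two_pow_half_le t
  have hs0 : (0 : ℝ) < √2 ^ t := by positivity
  have hss : √2 ^ t * √2 ^ t = 2 ^ t := sqrt_two_pow_mul_self t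
  set s := √2 ^ t with hs
  set y : ℝ := (a + b * √2) / s with hy
  have hsy : s * (a + b * √2) = 2 ^ t * y := by
    rw [hy, ← hss]
    field_simp
  rw [hsy] at happ
  have hpp : (2 : ℝ) ^ t * (2 : ℝ)⁻¹ ^ t = 1 := by
    rw [← mul_pow]
    norm_num
  have hNq : 0 < N * q := by positivity
  set X := N * (a * u + b * v) - 2 ^ t * q * (N - 2 * K) with hX
  -- After scaling by `2^t·N·q`, the tested integer `X` is the distance between candidate and true
  -- value, up to `1/128` from the rational approximation and `1/32` from the shots. The true
  -- candidate passes, as `5/128 < 1/16`.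
  have hXy : |X - N * q * (2 ^ t * (y - x))| ≤ N * q * (5 / 128) := by
    have e : X - N * q * (2 ^ t * (y - x)) = N * ((a * u + b * v) - 2 ^ t * y * q) -
        2 ^ t * q * (N - 2 * K - N * x) := by
      rw [hX]; ring
    rw [e]
    refine (abs_sub _ _).trans ?_
    rw [abs_mul, abs_mul, abs_of_pos hN, abs_of_pos (show (0 : ℝ) < 2 ^ t * q by positivity)]
    calc N * |(a * u + b * v) - 2 ^ t * y * q| + 2 ^ t * q * |N - 2 * K - N * x|
        ≤ N * (q / 128) + 2 ^ t * q * (N * ((2 : ℝ)⁻¹ ^ t / 32)) := by gcongr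
      _ = N * (q / 128) + q * N / 32 * (2 ^ t * (2 : ℝ)⁻¹ ^ t) := by ring
      _ = N * q * (5 / 128) := by rw [hpp]; ring
  constructor
  · intro hlt
    by_contra hne
    have hyx : y - x ≠ 0 := by
      intro h0
      apply hne
      rw [sub_eq_zero, hy, hx, div_left_inj' hs0.ne'] at h0
      exact add_mul_sqrt_two_inj h0
    -- A candidate in the grid need not be an expectation value of any state, so its conjugate is
    -- only bounded by `√2 + 2 ≤ 4`. With the bound `1` for `x` the gap is `2^{-t}/5`, and `1/5 -
    -- 5/128 > 1/16`.
    have hyq : IsQuad t (4 : ℝ) y := by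
      refine ⟨a, b, hy, ?_⟩
      rw [abs_div, abs_of_pos hs0, div_le_iff₀ hs0]
      refine (abs_sub _ _).trans ?_
      rw [abs_mul, abs_of_pos (show (0 : ℝ) < √2 by positivity)]
      have h1 := ha.trans hR
      have h3 : |(b : ℝ)| * √2 ≤ √2 * s * √2 := by
        gcongr
        exact hb.trans hR
      nlinarith
    have hgap := (hyq.sub ⟨a₀, b₀, hx, hx'⟩).gap hyx
    have h5 : 1 ≤ 5 * |2 ^ t * (y - x)| := by
      rw [abs_mul, abs_of_pos (show (0 : ℝ) < 2 ^ t by positivity)]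
      have := mul_le_mul_of_nonneg_left hgap (show (0 : ℝ) ≤ 2 ^ t by positivity)
      rw [hpp] at this
      linarith
    have h6 : N * q * |2 ^ t * (y - x)| ≤ |X| + N * q * (5 / 128) := by
      rw [← abs_of_pos hNq, ← abs_mul, abs_of_pos hNq]
      have := abs_sub_abs_le_abs_sub (N * q * (2 ^ t * (y - x))) X
      rw [abs_sub_comm _ X] at this
      linarith
    nlinarith
  · rintro ⟨rfl, rfl⟩
    have h0 : y - x = 0 := by rw [hx, hy, sub_self]
    rw [h0, mul_zero, mul_zero, sub_zero] at hXy
    linarith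

namespace Learn

open Prog

/-- The test for the candidate `i`, `j`. -/
def Passes (n t q u v K i j : ℕ) : Prop :=
  16 * |(16384 * (4 ^ t * n) : ℝ) * ((i - 2 ^ ((t + 1) / 2)) * u + (j - 2 ^ ((t + 1) / 2)) * v) -
    2 ^ t * q * (16384 * (4 ^ t * n) - 2 * K)| < 16384 * (4 ^ t * n) * q

theorem abs_natSub_lt_iff (x y z : ℕ) : x - y + (y - x) < z ↔ |(x : ℝ) - y| < z := by
  rcases le_total x y with h | h
  · rw [abs_of_nonpos (by rw [sub_nonpos]; exact_mod_cast h), neg_sub, ← Nat.cast_sub h, Nat.cast_lt]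
    omega
  · rw [abs_of_nonneg (by rw [sub_nonneg]; exact_mod_cast h), ← Nat.cast_sub h, Nat.cast_lt]
    omega

/-- All negative terms of the real inequality, those from the offset of `i`, `j` and from `2^t·q·N`,
are collected in register `26`. The comparison then involves natural numbers only, and the bulk of
the proof excludes overflow. -/
theorem exec_testCandidate {n t K i j : ℕ} {m : Mem} (hn : 1 ≤ n) (hc : Consts n t m)
    (hcal : Calibrated n t m) (h54 : m.reg 54 = K * (2 * (2 ^ t * m.reg 22)))
    (hK : K ≤ 16384 * (4 ^ t * n)) (h60 : m.reg 60 = i) (h61 : m.reg 61 = j)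
    (hi : i ≤ 2 * 2 ^ ((t + 1) / 2)) (hj : j ≤ 2 * 2 ^ ((t + 1) / 2)) :
    ((testCandidate.exec (64 * (n + t)) m).reg 62 ≠ 0 ↔
      Passes n t (m.reg 22) (m.reg 23) (m.reg 24) K i j) := by
  set w := 64 * (n + t) with hw
  obtain ⟨hq, huv⟩ := hcal.approx.bounds
  have hN := shots_le n t
  have r26 := hcal.r26
  have r27 := hcal.r27
  rw [Passes]
  have hNr : (16384 * (4 ^ t * n) : ℝ) = ((16384 * (4 ^ t * n) : ℕ) : ℝ) := by push_cast; ring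
  have hRr : (2 : ℝ) ^ ((t + 1) / 2) = ((2 ^ ((t + 1) / 2) : ℕ) : ℝ) := by push_cast; ring
  rw [hNr, hRr]
  generalize hq' : m.reg 22 = q at *
  generalize hu' : m.reg 23 = u at *
  generalize hv' : m.reg 24 = v at *
  have r17 := hc.r17
  have hRle : 2 * 2 ^ ((t + 1) / 2) ≤ 2 ^ (t + 1) := by
    rw [← pow_succ']
    exact Nat.pow_le_pow_right (by norm_num) (by omega)
  generalize 16384 * (4 ^ t * n) = N at *
  generalize 2 ^ ((t + 1) / 2) = R at *
  have hi' := hi.trans hRle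
  have hj' := hj.trans hRle
  have b1 : i * u < 2 ^ w := mul_lt_word hi' ((Nat.le_add_right u v).trans huv) (by omega)
  have b2 : j * v < 2 ^ w := mul_lt_word hj' ((Nat.le_add_left v u).trans huv) (by omega)
  have c3 : i * u + j * v ≤ 2 ^ (4 * t + 12) := by
    calc i * u + j * v ≤ 2 ^ (t + 1) * u + 2 ^ (t + 1) * v := by gcongr
      _ = 2 ^ (t + 1) * (u + v) := by ring
      _ ≤ 2 ^ (t + 1) * 2 ^ (3 * t + 11) := by gcongr
      _ = 2 ^ (4 * t + 12) := by rw [← pow_add]; congr 1; omega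
  have b3 : i * u + j * v < 2 ^ w := pow_lt_word _ c3 (by omega)
  have b4 : (i * u + j * v) * N < 2 ^ w := mul_lt_word c3 hN (by omega)
  have c5 : (i * u + j * v) * N + K * (2 * (2 ^ t * q)) ≤ 2 ^ (6 * t + n + 27) := by
    calc (i * u + j * v) * N + K * (2 * (2 ^ t * q))
        ≤ 2 ^ (4 * t + 12) * 2 ^ (2 * t + n + 14) +
          2 ^ (2 * t + n + 14) * (2 * (2 ^ t * 2 ^ (2 * t + 10))) := by
          gcongr
          exact hK.trans hN
      _ = 2 ^ (6 * t + n + 26) + 2 ^ (5 * t + n + 25) := by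
          rw [← pow_add, ← pow_add, ← pow_succ', ← pow_add]
          congr 2 <;> omega
      _ ≤ 2 ^ (6 * t + n + 26) + 2 ^ (6 * t + n + 26) := by
          gcongr <;> omega
      _ = 2 ^ (6 * t + n + 27) := by rw [← two_mul, ← pow_succ']
  have b5 : (i * u + j * v) * N + K * (2 * (2 ^ t * q)) < 2 ^ w := pow_lt_word _ c5 (by omega)
  have b6 : ((i * u + j * v) * N + K * (2 * (2 ^ t * q))) * 16 < 2 ^ w :=
    mul_lt_word c5 (show 16 ≤ 2 ^ 4 by norm_num) (by omega)
  have b26 : m.reg 26 < 2 ^ w := by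
    have c6 : R * (u + v) + 2 ^ t * q ≤ 2 ^ (4 * t + 13) := by
      calc R * (u + v) + 2 ^ t * q ≤ 2 ^ (t + 1) * 2 ^ (3 * t + 11) + 2 ^ t * 2 ^ (2 * t + 10) := by
            gcongr
            omega
        _ = 2 ^ (4 * t + 12) + 2 ^ (3 * t + 10) := by
            rw [← pow_add, ← pow_add]; congr 2 <;> omega
        _ ≤ 2 ^ (4 * t + 12) + 2 ^ (4 * t + 12) := by
            gcongr <;> omega
        _ = 2 ^ (4 * t + 13) := by rw [← two_mul, ← pow_succ']
    rw [r26, ← mul_assoc]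
    refine mul_lt_word (a := 4 + (2 * t + n + 14)) ?_ c6 (by omega)
    rw [pow_add]
    gcongr
    norm_num
  set X := ((i * u + j * v) * N + K * (2 * (2 ^ t * q))) * 16 with hXdef
  have b7 : X - m.reg 26 < 2 ^ w := by omega
  have b8 : m.reg 26 - X < 2 ^ w := by omega
  have b9 : X - m.reg 26 + (m.reg 26 - X) < 2 ^ w := by omega
  have e1 : 1 < 2 ^ w := pow_lt_word 1 (a := 0) (by norm_num) (by omega)
  have hx : (testCandidate.exec w m).reg 62 =
      if X - m.reg 26 + (m.reg 26 - X) < N * q then 1 else 0 := by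
    simp only [testCandidate, exec, Mem.setReg, WordOp.eval]
    simp only [Function.update_self, Function.update_of_ne, ne_eq, Nat.reduceEqDiff, not_false_eq_true,
      h60, h61, hu', hv', r17, h54, hc.r38, Nat.mod_eq_of_lt b1, Nat.mod_eq_of_lt b2,
      Nat.mod_eq_of_lt b3, Nat.mod_eq_of_lt b4, Nat.mod_eq_of_lt b5, ← hXdef, Nat.mod_eq_of_lt b6,
      Nat.mod_eq_of_lt b7, Nat.mod_eq_of_lt b8, Nat.mod_eq_of_lt b9, r27]
    split_ifs
    · exact Nat.mod_eq_of_lt e1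
    · exact Nat.zero_mod _
  rw [hx]
  have hiff : (X - m.reg 26 + (m.reg 26 - X) < N * q) ↔
      16 * |(N : ℝ) * ((i - R) * u + (j - R) * v) - 2 ^ t * q * (N - 2 * K)| < N * q := by
    rw [abs_natSub_lt_iff, r26, hXdef]
    push_cast
    have e : (((i : ℝ) * u + j * v) * N + K * (2 * (2 ^ t * q))) * 16 -
        16 * (N * (R * (u + v) + 2 ^ t * q)) =
        16 * ((N : ℝ) * ((i - R) * u + (j - R) * v) - 2 ^ t * q * (N - 2 * K)) := by ring
    rw [e, abs_mul, abs_of_pos (show (0 : ℝ) < 16 by norm_num)]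
  rw [← hiff]
  split_ifs with h <;> simp [h]

end Learn
end

noncomputable section

open scoped ENNReal

/-! ## The bad generators and their expectation values -/

namespace Learn

open Prog

/-- The state of the memory during the search, in row `i`. -/
structure Searching (n t q u v K i : ℕ) (m : Mem) : Prop where
  consts : Consts n t m
  calibrated : Calibrated n t m
  r22 : m.reg 22 = q
  r23 : m.reg 23 = u
  r24 : m.reg 24 = v
  r54 : m.reg 54 = K * (2 * (2 ^ t * q))
  r60 : m.reg 60 = i

/-- If `c` holds, then the candidate `i₀`, `j₀` has been found. -/
structure Found (t i₀ j₀ : ℕ) (c : Prop) [Decidable c] (m : Mem) : Prop where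
  r55 : m.reg 55 = if c then i₀ else 2 ^ ((t + 1) / 2)
  r56 : m.reg 56 = if c then j₀ else 2 ^ ((t + 1) / 2)

section

variable {n t q u v K i₀ j₀ : ℕ}

theorem range_lt_word (hn : 1 ≤ n) : 2 * 2 ^ ((t + 1) / 2) + 1 < 2 ^ (64 * (n + t)) :=
  pow_lt_word _ (a := t + 2) (by
    have h1 : 2 ^ ((t + 1) / 2) ≤ 2 ^ t := Nat.pow_le_pow_right (by norm_num) (by omega)
    have h2 : 1 ≤ 2 ^ t := Nat.one_le_two_pow
    rw [pow_add]
    omega) (by omega)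

/-- Just one grid point passes, so registers `55`, `56` keep their default until the lexicographic
search reaches it and are not overwritten later. -/
theorem exec_candidateStep (hn : 1 ≤ n) (hK : K ≤ 16384 * (4 ^ t * n))
    (hpass : ∀ i ≤ 2 * 2 ^ ((t + 1) / 2), ∀ j ≤ 2 * 2 ^ ((t + 1) / 2),
      (Passes n t q u v K i j ↔ i = i₀ ∧ j = j₀)) {i j : ℕ} (hi : i ≤ 2 * 2 ^ ((t + 1) / 2))
    (hj : j ≤ 2 * 2 ^ ((t + 1) / 2)) {m : Mem} (h : Searching n t q u v K i m)
    (h61 : m.reg 61 = j) (hf : Found t i₀ j₀ (i₀ < i ∨ i₀ = i ∧ j₀ < j) m) :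
    Searching n t q u v K i (candidateStep.exec (64 * (n + t)) m) ∧
    (candidateStep.exec (64 * (n + t)) m).reg 61 = j + 1 ∧
    Found t i₀ j₀ (i₀ < i ∨ i₀ = i ∧ j₀ < j + 1) (candidateStep.exec (64 * (n + t)) m) := by
  have hr := range_lt_word (t := t) hn
  have htest := exec_testCandidate hn h.consts h.calibrated (by rw [h.r54, h.r22]) hK h.r60 h61
    hi hj
  rw [h.r22, h.r23, h.r24, hpass i hi j hj] at htest
  set w := 64 * (n + t) with hw
  set m₁ := testCandidate.exec w m with hm₁
  have s13 : m₁.reg 13 = 0 := by rw [hm₁, exec_reg _ _ _ _ (by decide), h.consts.r13]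
  have s14 : m₁.reg 14 = 1 := by rw [hm₁, exec_reg _ _ _ _ (by decide), h.consts.r14]
  have s60 : m₁.reg 60 = i := by rw [hm₁, exec_reg _ _ _ _ (by decide), h.r60]
  have s61 : m₁.reg 61 = j := by rw [hm₁, exec_reg _ _ _ _ (by decide), h61]
  have s55 : m₁.reg 55 = m.reg 55 := by rw [hm₁, exec_reg _ _ _ _ (by decide)]
  have s56 : m₁.reg 56 = m.reg 56 := by rw [hm₁, exec_reg _ _ _ _ (by decide)]
  have e1 : j + 1 < 2 ^ w := by omega
  have e2 : i < 2 ^ w := by omega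
  have e3 : j < 2 ^ w := by omega
  have hx : candidateStep.exec w m = (Prog.op .add 61 61 14).exec w
      ((Prog.ite 62 (.op .add 55 60 13 ⨾ .op .add 56 61 13) skip).exec w m₁) := rfl
  have hres : (candidateStep.exec w m).reg 61 = j + 1 ∧
      (candidateStep.exec w m).reg 55 = (if i = i₀ ∧ j = j₀ then i else m.reg 55) ∧
      (candidateStep.exec w m).reg 56 = (if i = i₀ ∧ j = j₀ then j else m.reg 56) := by
    rw [hx]
    by_cases hb : i = i₀ ∧ j = j₀
    · have h62 := htest.mpr hb
      simp only [if_pos hb]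
      simp [exec, h62, Mem.setReg, WordOp.eval, s13, s14, s60, s61, Nat.mod_eq_of_lt e1,
        Nat.mod_eq_of_lt e2, Nat.mod_eq_of_lt e3]
    · have h62 : m₁.reg 62 = 0 := by
        by_contra h'
        exact hb (htest.mp h')
      simp only [if_neg hb]
      simp [exec, skip, h62, Mem.setReg, WordOp.eval, s14, s55, s56, s61, Nat.mod_eq_of_lt e1]
  obtain ⟨f61, f55, f56⟩ := hres
  have hcal : Calibrated n t (candidateStep.exec w m) :=
    h.calibrated.of_eq fun r hr => exec_reg _ _ _ _ (by revert r; decide)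
  refine ⟨⟨h.consts.exec w _ (by decide), hcal, ?_, ?_, ?_, ?_, ?_⟩, f61, ?_, ?_⟩
  · rw [exec_reg _ _ _ _ (by decide), h.r22]
  · rw [exec_reg _ _ _ _ (by decide), h.r23]
  · rw [exec_reg _ _ _ _ (by decide), h.r24]
  · rw [exec_reg _ _ _ _ (by decide), h.r54]
  · rw [exec_reg _ _ _ _ (by decide), h.r60]
  · rw [f55, hf.r55]
    split_ifs <;> omega
  · rw [f56, hf.r56]
    split_ifs <;> omega

theorem exec_candidateRow (hn : 1 ≤ n) (hK : K ≤ 16384 * (4 ^ t * n))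
    (hj₀ : j₀ ≤ 2 * 2 ^ ((t + 1) / 2))
    (hpass : ∀ i ≤ 2 * 2 ^ ((t + 1) / 2), ∀ j ≤ 2 * 2 ^ ((t + 1) / 2),
      (Passes n t q u v K i j ↔ i = i₀ ∧ j = j₀)) {i : ℕ} (hi : i ≤ 2 * 2 ^ ((t + 1) / 2))
    {m : Mem} (h : Searching n t q u v K i m) (hf : Found t i₀ j₀ (i₀ < i) m) :
    Searching n t q u v K (i + 1) (candidateRow.exec (64 * (n + t)) m) ∧
    Found t i₀ j₀ (i₀ < i + 1) (candidateRow.exec (64 * (n + t)) m) := by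
  have hr := range_lt_word (t := t) hn
  set w := 64 * (n + t) with hw
  set m₁ := m.setReg w 61 0 with hm₁
  have c1 : Consts n t m₁ := h.consts.of_eq (by simp [hm₁, Mem.setReg])
  have key := iterate_inv (f := candidateStep.exec w) (a := m₁) (N := 2 * 2 ^ ((t + 1) / 2) + 1)
    (I := fun j m' => Searching n t q u v K i m' ∧ m'.reg 61 = j ∧
      Found t i₀ j₀ (i₀ < i ∨ i₀ = i ∧ j₀ < j) m')
    ⟨⟨c1, h.calibrated.of_eq (by simp [hm₁, Mem.setReg]), by simp [hm₁, Mem.setReg, h.r22],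
      by simp [hm₁, Mem.setReg, h.r23], by simp [hm₁, Mem.setReg, h.r24],
      by simp [hm₁, Mem.setReg, h.r54], by simp [hm₁, Mem.setReg, h.r60]⟩,
      by simp [hm₁, Mem.setReg], by simp [hm₁, Mem.setReg, hf.r55],
      by simp [hm₁, Mem.setReg, hf.r56]⟩
    (fun j hj b hb => exec_candidateStep hn hK hpass hi (by omega) hb.1 hb.2.1 hb.2.2)
  set m₂ := (candidateStep.exec w)^[2 * 2 ^ ((t + 1) / 2) + 1] m₁ with hm₂
  have hx : candidateRow.exec w m = (Prog.op .add 60 60 14).exec w m₂ := by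
    have h18 : m₁.reg 18 = 2 * 2 ^ ((t + 1) / 2) + 1 := c1.r18
    simp only [candidateRow, exec, ← hm₁, h18, hm₂]
  obtain ⟨ks, -, kf⟩ := key
  have e1 : i + 1 < 2 ^ w := by omega
  rw [hx]
  refine ⟨⟨ks.consts.exec w _ (by decide), ?_, ?_, ?_, ?_, ?_, ?_⟩, ?_, ?_⟩
  · exact ks.calibrated.of_eq fun r hr => exec_reg _ _ _ _ (by revert r; decide)
  · rw [exec_reg _ _ _ _ (by decide), ks.r22]
  · rw [exec_reg _ _ _ _ (by decide), ks.r23]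
  · rw [exec_reg _ _ _ _ (by decide), ks.r24]
  · rw [exec_reg _ _ _ _ (by decide), ks.r54]
  · simp [exec, Mem.setReg, WordOp.eval, ks.r60, ks.consts.r14, Nat.mod_eq_of_lt e1]
  · rw [exec_reg _ _ _ _ (by decide), kf.r55]
    congr 1
    apply propext
    omega
  · rw [exec_reg _ _ _ _ (by decide), kf.r56]
    congr 1
    apply propext
    omega

theorem exec_search (hn : 1 ≤ n) (hi₀ : i₀ ≤ 2 * 2 ^ ((t + 1) / 2))
    (hj₀ : j₀ ≤ 2 * 2 ^ ((t + 1) / 2)) {m : Mem} (hc : Consts n t m) (hcal : Calibrated n t m)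
    (hK : m.reg 53 ≤ 16384 * (4 ^ t * n))
    (hpass : ∀ i ≤ 2 * 2 ^ ((t + 1) / 2), ∀ j ≤ 2 * 2 ^ ((t + 1) / 2),
      (Passes n t (m.reg 22) (m.reg 23) (m.reg 24) (m.reg 53) i j ↔ i = i₀ ∧ j = j₀)) :
    (search.exec (64 * (n + t)) m).reg 55 = i₀ ∧ (search.exec (64 * (n + t)) m).reg 56 = j₀ := by
  have hr := range_lt_word (t := t) hn
  obtain ⟨hq, -⟩ := hcal.approx.bounds
  have hN := shots_le n t
  have b54 : m.reg 53 * (2 * (2 ^ t * m.reg 22)) < 2 ^ (64 * (n + t)) := by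
    refine mul_lt_word (a := 2 * t + n + 14) (b := 3 * t + 11) (hK.trans hN) ?_ (by omega)
    calc 2 * (2 ^ t * m.reg 22) ≤ 2 * (2 ^ t * 2 ^ (2 * t + 10)) := by gcongr
      _ = 2 ^ (3 * t + 11) := by rw [← pow_add, ← pow_succ']; congr 1; omega
  set w := 64 * (n + t) with hw
  have eR : 2 ^ ((t + 1) / 2) < 2 ^ w := by omega
  set m₁ := (Prog.op .mul 54 53 28 ⨾ .op .add 55 19 13 ⨾ .op .add 56 19 13 ⨾ .const 60 0).exec w m
    with hm₁
  have c1 : Consts n t m₁ := hc.exec w _ (by decide)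
  have hcal1 : Calibrated n t m₁ := hcal.of_eq fun r hr => exec_reg _ _ _ _ (by revert r; decide)
  have s55 : m₁.reg 55 = 2 ^ ((t + 1) / 2) := by
    simp [hm₁, exec, Mem.setReg, WordOp.eval, hc.r19, hc.r13, Nat.mod_eq_of_lt eR]
  have s56 : m₁.reg 56 = 2 ^ ((t + 1) / 2) := by
    simp [hm₁, exec, Mem.setReg, WordOp.eval, hc.r19, hc.r13, Nat.mod_eq_of_lt eR]
  have s54 : m₁.reg 54 = m.reg 53 * (2 * (2 ^ t * m.reg 22)) := by
    simp [hm₁, exec, Mem.setReg, WordOp.eval, hcal.r28, Nat.mod_eq_of_lt b54]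
  have s60 : m₁.reg 60 = 0 := by
    simp [hm₁, exec, Mem.setReg, WordOp.eval]
  have key := iterate_inv (f := candidateRow.exec w) (a := m₁) (N := 2 * 2 ^ ((t + 1) / 2) + 1)
    (I := fun i m' => Searching n t (m.reg 22) (m.reg 23) (m.reg 24) (m.reg 53) i m' ∧
      Found t i₀ j₀ (i₀ < i) m')
    ⟨⟨c1, hcal1, exec_reg _ _ _ _ (by decide), exec_reg _ _ _ _ (by decide),
      exec_reg _ _ _ _ (by decide), s54, s60⟩, by simp [s55], by simp [s56]⟩
    (fun i hi b hb => exec_candidateRow hn hK hj₀ hpass (by omega) hb.1 hb.2)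
  have hx : search.exec w m = (candidateRow.exec w)^[2 * 2 ^ ((t + 1) / 2) + 1] m₁ := by
    have h0 : search.exec w m = (Prog.loop 18 candidateRow).exec w m₁ := rfl
    rw [h0, exec, c1.r18]
  rw [hx]
  obtain ⟨-, kf⟩ := key
  exact ⟨by rw [kf.r55, if_pos (by omega)], by rw [kf.r56, if_pos (by omega)]⟩

end

/-- Recording a value: nothing happens for the value zero. -/
theorem exec_record {n t w k v i j : ℕ} {m : Mem} (hc : Consts n t m)
    (h1 : m.reg 1 = k) (h42 : m.reg 42 = v) (h48 : m.reg 48 = v >>> n) (h55 : m.reg 55 = i)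
    (h56 : m.reg 56 = j) (hv : v < 2 ^ w) (hi : i < 2 ^ w) (hj : j < 2 ^ w) (hk : k + 1 < 2 ^ w)
    (hR : 2 ^ ((t + 1) / 2) < 2 ^ w) :
    (i = 2 ^ ((t + 1) / 2) ∧ j = 2 ^ ((t + 1) / 2) →
      (record.exec w m).reg 1 = k ∧ (record.exec w m).arr = m.arr) ∧
    (¬ (i = 2 ^ ((t + 1) / 2) ∧ j = 2 ^ ((t + 1) / 2)) →
      (record.exec w m).reg 1 = k + 1 ∧
      (record.exec w m).arr 3 = Function.update (m.arr 3) k v ∧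
      (record.exec w m).arr 4 = Function.update (m.arr 4) k (v >>> n) ∧
      (record.exec w m).arr 5 = Function.update (m.arr 5) k i ∧
      (record.exec w m).arr 6 = Function.update (m.arr 6) k (2 ^ ((t + 1) / 2)) ∧
      (record.exec w m).arr 7 = Function.update (m.arr 7) k j ∧
      (record.exec w m).arr 8 = Function.update (m.arr 8) k (2 ^ ((t + 1) / 2))) := by
  have r19 := hc.r19
  generalize 2 ^ ((t + 1) / 2) = R at *
  have e1 : 1 < 2 ^ w := by omega
  have e2 : v >>> n < 2 ^ w := lt_of_le_of_lt (Nat.shiftRight_le _ _) hv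
  set m₁ := (Prog.op .eq 57 55 19 ⨾ .op .eq 58 56 19 ⨾ .op .and 57 57 58).exec w m with hm₁
  have s57 : m₁.reg 57 = if i = R ∧ j = R then 1 else 0 := by
    by_cases ha : i = R <;> by_cases hb : j = R <;>
      simp [hm₁, exec, Mem.setReg, WordOp.eval, h55, h56, r19, ha, hb, Nat.mod_eq_of_lt e1]
  have fr : ∀ r, r ≠ 57 → r ≠ 58 → m₁.reg r = m.reg r := fun r ha hb =>
    exec_reg _ _ _ _ (by simp [wregs, ha, hb])
  have fa : m₁.arr = m.arr := rfl
  have s1 : m₁.reg 1 = k := by rw [fr 1 (by decide) (by decide), h1]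
  have s14 : m₁.reg 14 = 1 := by rw [fr 14 (by decide) (by decide), hc.r14]
  have s19 : m₁.reg 19 = R := by rw [fr 19 (by decide) (by decide), r19]
  have s42 : m₁.reg 42 = v := by rw [fr 42 (by decide) (by decide), h42]
  have s48 : m₁.reg 48 = v >>> n := by rw [fr 48 (by decide) (by decide), h48]
  have s55 : m₁.reg 55 = i := by rw [fr 55 (by decide) (by decide), h55]
  have s56 : m₁.reg 56 = j := by rw [fr 56 (by decide) (by decide), h56]
  constructor
  · intro hb
    have hx : record.exec w m = skip.exec w m₁ := by
      have h0 : record.exec w m = (Prog.ite 57 skip _).exec w m₁ := rfl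
      rw [h0, exec, if_pos (by rw [s57, if_pos hb]; exact one_ne_zero)]
    rw [hx]
    exact ⟨by rw [exec_reg _ _ _ _ (by decide), s1], rfl⟩
  · intro hb
    have hx : record.exec w m = (Prog.store 3 1 42 ⨾ .store 4 1 48 ⨾ .store 5 1 55 ⨾ .store 6 1 19 ⨾
        .store 7 1 56 ⨾ .store 8 1 19 ⨾ .op .add 1 1 14).exec w m₁ := by
      have h0 : record.exec w m = (Prog.ite 57 skip (.store 3 1 42 ⨾ .store 4 1 48 ⨾
        .store 5 1 55 ⨾ .store 6 1 19 ⨾ .store 7 1 56 ⨾ .store 8 1 19 ⨾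
        .op .add 1 1 14)).exec w m₁ := rfl
      exact h0.trans (if_neg (by rw [s57, if_neg hb]; simp))
    rw [hx]
    refine ⟨?_, ?_, ?_, ?_, ?_, ?_, ?_⟩ <;>
      simp [exec, Mem.setReg, Mem.setArr, WordOp.eval, s1, s14, s19, s42, s48, s55, s56, fa,
        Nat.mod_eq_of_lt hk, Nat.mod_eq_of_lt hv, Nat.mod_eq_of_lt e2, Nat.mod_eq_of_lt hi,
        Nat.mod_eq_of_lt hj, Nat.mod_eq_of_lt hR]

end Learn
end

/-! ### Evaluation of the whole list of representatives -/

noncomputable section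

open scoped ENNReal

namespace Learn

open Prog

theorem passes_iff {n t q u v K : ℕ} {x : ℝ} (hn : 1 ≤ n) (h : Approximates t q u v)
    (hK : |(16384 * (4 ^ t * n) : ℝ) - 2 * K - (16384 * (4 ^ t * n)) * x| ≤
      (16384 * (4 ^ t * n)) * ((2 : ℝ)⁻¹ ^ t / 32)) {a₀ b₀ : ℤ}
    (hx : x = (a₀ + b₀ * √2) / √2 ^ t) (hx' : |(a₀ - b₀ * √2) / √2 ^ t| ≤ 1) {i j : ℕ}
    (hi : i ≤ 2 * 2 ^ ((t + 1) / 2)) (hj : j ≤ 2 * 2 ^ ((t + 1) / 2)) :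
    Passes n t q u v K i j ↔
      (i : ℤ) - 2 ^ ((t + 1) / 2) = a₀ ∧ (j : ℤ) - 2 ^ ((t + 1) / 2) = b₀ := by
  have hn' : (0 : ℝ) < n := by exact_mod_cast hn
  have habs : ∀ i : ℕ, i ≤ 2 * 2 ^ ((t + 1) / 2) →
      |(((i : ℤ) - 2 ^ ((t + 1) / 2) : ℤ) : ℝ)| ≤ 2 ^ ((t + 1) / 2) := by
    intro i hi
    have : (i : ℝ) ≤ 2 * 2 ^ ((t + 1) / 2) := by exact_mod_cast hi
    have h0 : (0 : ℝ) ≤ i := Nat.cast_nonneg i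
    push_cast
    rw [abs_le]
    constructor <;> linarith
  rw [← h.near_iff (by positivity) hK hx hx' (habs i hi) (habs j hj), Passes]
  push_cast
  rfl

/-- The entry of the list is a bad generator. -/
def IsBad {n : ℕ} (ψ : PureState n) (L : ℕ → ℕ) (j : ℕ) : Prop :=
  L j ≠ 0 ∧ ψ.expect (toPauli n (bits (L j))) ≠ 0

open Classical in
/-- The number of bad generators among the first `i` entries. -/
def badCount {n : ℕ} (ψ : PureState n) (L : ℕ → ℕ) (i : ℕ) : ℕ := Nat.count (IsBad ψ L) i

section

variable {n : ℕ} {ψ : PureState n} {L : ℕ → ℕ}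

theorem badCount_succ_of_bad {i : ℕ} (h : IsBad ψ L i) : badCount ψ L (i + 1) = badCount ψ L i + 1 := by
  rw [badCount, Nat.count_succ, if_pos h]
  rfl

theorem badCount_succ_of_not_bad {i : ℕ} (h : ¬ IsBad ψ L i) :
    badCount ψ L (i + 1) = badCount ψ L i := by
  rw [badCount, Nat.count_succ, if_neg h]
  rfl

open Classical in
theorem badCount_le (i : ℕ) : badCount ψ L i ≤ i := Nat.count_le _

open Classical in
theorem badCount_lt {p i : ℕ} (hp : IsBad ψ L p) (h : p < i) : badCount ψ L p < badCount ψ L i :=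
  Nat.count_strict_mono hp h

end

/-- The state of the memory after the first `i` entries of the list have been examined. -/
structure Valued {n : ℕ} (t : ℕ) (ψ : PureState n) (L : ℕ → ℕ) (i : ℕ) (m : Mem) : Prop where
  consts : Consts n t m
  calibrated : Calibrated n t m
  arr12 : m.arr 12 = L
  r47 : m.reg 47 = i
  r1 : m.reg 1 = badCount ψ L i
  vals : ∀ p < i, IsBad ψ L p →
    m.arr 3 (badCount ψ L p) = L p ∧ m.arr 4 (badCount ψ L p) = L p >>> n ∧
    (((m.arr 5 (badCount ψ L p) : ℝ) - m.arr 6 (badCount ψ L p)) +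
      ((m.arr 7 (badCount ψ L p) : ℝ) - m.arr 8 (badCount ψ L p)) * √2) / √2 ^ t =
      ψ.expect (toPauli n (bits (L p)))

/-- The deterministic half of a value step: once the estimate is accurate, the search has a forced
result. -/
theorem exec_search_record {n t : ℕ} {ψ : PureState n} {L : ℕ → ℕ} (hn : 1 ≤ n)
    (ht : ψ.IsArithmetic t) (hL : ∀ j, L j < 2 ^ (2 * n)) {i : ℕ} (hi : i < 4 ^ t) (h0 : L i ≠ 0)
    {m : Mem} (h : Valued t ψ L i m) (h42 : m.reg 42 = L i) (h48 : m.reg 48 = L i >>> n)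
    (hK : m.reg 53 ≤ 16384 * (4 ^ t * n))
    (hest : |(16384 * (4 ^ t * n) : ℝ) - 2 * m.reg 53 -
        (16384 * (4 ^ t * n)) * ψ.expect (toPauli n (bits (L i)))| ≤
        (16384 * (4 ^ t * n)) * ((2 : ℝ)⁻¹ ^ t / 32)) :
    Valued t ψ L (i + 1)
      ((search ⨾ record ⨾ Prog.op .add 47 47 14).exec (64 * (n + t)) m) := by
  obtain ⟨a₀, b₀, hx, hx', ha, hb⟩ := ht.exists_form (toPauli n (bits (L i)))
  have hR := sqrt_two_pow_le t
  have hrange := range_lt_word (n := n) (t := t) hn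
  have hlift : ∀ a : ℤ, |(a : ℝ)| ≤ √2 ^ t → ∃ k : ℕ, k ≤ 2 * 2 ^ ((t + 1) / 2) ∧
      (k : ℤ) - 2 ^ ((t + 1) / 2) = a := by
    intro a ha
    have h1 : |a| ≤ 2 ^ ((t + 1) / 2) := by
      have := ha.trans hR
      exact_mod_cast this
    rw [abs_le] at h1
    refine ⟨(a + 2 ^ ((t + 1) / 2)).toNat, ?_, ?_⟩
    · zify
      rw [Int.toNat_of_nonneg (by linarith)]
      linarith
    · rw [Int.toNat_of_nonneg (by linarith)]
      ring
  obtain ⟨i₀, hi₀, ei⟩ := hlift a₀ ha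
  obtain ⟨j₀, hj₀, ej⟩ := hlift b₀ hb
  have hs := exec_search hn hi₀ hj₀ h.consts h.calibrated hK (fun i hi j hj => by
    rw [passes_iff hn h.calibrated.approx hest hx hx' hi hj, ← ei, ← ej]
    constructor
    · rintro ⟨h1, h2⟩
      exact ⟨by omega, by omega⟩
    · rintro ⟨rfl, rfl⟩
      exact ⟨rfl, rfl⟩)
  set w := 64 * (n + t) with hw
  set m₁ := search.exec w m with hm₁
  obtain ⟨s55, s56⟩ := hs
  have c1 : Consts n t m₁ := h.consts.exec w _ (by decide)
  have hfa : m₁.arr = m.arr := by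
    funext A
    exact exec_arr _ _ _ _ (by
      simp [search, candidateRow, candidateStep, testCandidate, skip, warrs])
  have hi1 : i + 1 < 2 ^ w := by
    refine lt_of_le_of_lt hi ?_
    rw [show (4 : ℕ) = 2 ^ 2 from rfl, ← pow_mul]
    exact Nat.pow_lt_pow_right (by norm_num) (by omega)
  have hLw : L i < 2 ^ w := lt_two_pow_of_le (by omega) (hL i)
  have hcnt := badCount_le (ψ := ψ) (L := L) i
  obtain ⟨hz, hnz⟩ := exec_record (w := w) (k := badCount ψ L i) (v := L i) c1
    (by rw [hm₁, exec_reg _ _ _ _ (by decide), h.r1])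
    (by rw [hm₁, exec_reg _ _ _ _ (by decide), h42])
    (by rw [hm₁, exec_reg _ _ _ _ (by decide), h48]) s55 s56 hLw (by omega) (by omega) (by omega)
    (by omega)
  set m₂ := record.exec w m₁ with hm₂
  have hx3 : (search ⨾ record ⨾ Prog.op .add 47 47 14).exec w m =
      (Prog.op .add 47 47 14).exec w m₂ := rfl
  have c2 : Consts n t m₂ := c1.exec w _ (by decide)
  have f12 : m₂.arr 12 = L := by
    rw [hm₂, exec_arr _ _ _ _ (by decide), hfa, h.arr12]
  have f47 : m₂.reg 47 = i := by
    rw [hm₂, exec_reg _ _ _ _ (by decide), hm₁, exec_reg _ _ _ _ (by decide), h.r47]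
  have hcal : Calibrated n t ((search ⨾ record ⨾ Prog.op .add 47 47 14).exec w m) :=
    h.calibrated.of_eq fun r hr => exec_reg _ _ _ _ (by revert r; decide)
  -- By irrationality of `√2` the value vanishes only for `a = b = 0`, that is, when both shifted
  -- coefficients equal the offset. So `record` skips exactly the strings outside the support.
  have hzero : (i₀ = 2 ^ ((t + 1) / 2) ∧ j₀ = 2 ^ ((t + 1) / 2)) ↔ ¬ IsBad ψ L i := by
    have hiff : ψ.expect (toPauli n (bits (L i))) = 0 ↔ a₀ = 0 ∧ b₀ = 0 := by
      rw [hx, div_eq_zero_iff, or_iff_left (by positivity)]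
      constructor
      · intro h0
        refine add_mul_sqrt_two_inj ?_
        simpa using h0
      · rintro ⟨rfl, rfl⟩
        simp
    rw [IsBad, not_and, not_not, hiff, ← ei, ← ej, sub_eq_zero, sub_eq_zero]
    constructor
    · rintro ⟨h1, h2⟩ -
      exact ⟨by exact_mod_cast h1, by exact_mod_cast h2⟩
    · intro h'
      obtain ⟨h1, h2⟩ := h' h0
      exact ⟨by exact_mod_cast h1, by exact_mod_cast h2⟩
  rw [hx3] at hcal ⊢
  refine ⟨c2.exec w _ (by decide), hcal, f12, ?_, ?_, ?_⟩
  · simp [exec, Mem.setReg, WordOp.eval, f47, c2.r14, Nat.mod_eq_of_lt hi1]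
  · rw [exec_reg _ _ _ _ (by decide)]
    by_cases hbad : IsBad ψ L i
    · rw [(hnz (fun h' => hzero.mp h' hbad)).1, badCount_succ_of_bad hbad]
    · rw [(hz (hzero.mpr hbad)).1, badCount_succ_of_not_bad hbad]
  · intro p hp hpbad
    have harr : ((Prog.op .add 47 47 14).exec w m₂).arr = m₂.arr := rfl
    rw [harr]
    by_cases hbad : IsBad ψ L i
    · obtain ⟨-, a3, a4, a5, a6, a7, a8⟩ := hnz (fun h' => hzero.mp h' hbad)
      rw [a3, a4, a5, a6, a7, a8, hfa]
      by_cases hpi : p = i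
      · subst hpi
        simp only [Function.update_self, true_and]
        rw [hx, ← ei, ← ej]
        push_cast
        rfl
      · have hne : badCount ψ L p ≠ badCount ψ L i := (badCount_lt hpbad (by omega)).ne
        simp only [Function.update_of_ne hne]
        exact h.vals p (by omega) hpbad
    · rw [(hz (hzero.mpr hbad)).2, hfa]
      refine h.vals p ?_ hpbad
      rcases Nat.lt_succ_iff_lt_or_eq.mp hp with h' | h'
      · exact h'
      · rw [h'] at hpbad
        exact absurd hpbad hbad

/-- The zero vector represents the stabilizer group itself and is not measured, hence costs no
failure probability. This matters when `4^t` exceeds `4^n`: the unused cells are then free. -/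
theorem valueStep_ensures {n t : ℕ} {ψ : PureState n} {L : ℕ → ℕ} (hn : 1 ≤ n)
    (ht : ψ.IsArithmetic t) (hL : ∀ j, L j < 2 ^ (2 * n)) {i : ℕ} (hi : i < 4 ^ t)
    {m : Mem} (h : Valued t ψ L i m) :
    (valueStep.sem (64 * (n + t)) ψ m).Ensures
      (if L i ≠ 0 then ENNReal.ofReal (2 * Real.exp (-(4 * n))) else 0) (Valued t ψ L (i + 1)) := by
  set w := 64 * (n + t) with hw
  have hLw : L i < 2 ^ w := lt_two_pow_of_le (by omega) (hL i)
  have hN : 16384 * (4 ^ t * n) < 2 ^ w := pow_lt_word _ (shots_le n t) (by omega)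
  have hi1 : i + 1 < 2 ^ w := by
    refine lt_of_le_of_lt hi ?_
    rw [show (4 : ℕ) = 2 ^ 2 from rfl, ← pow_mul]
    exact Nat.pow_lt_pow_right (by norm_num) (by omega)
  set m₁ := m.setReg w 42 (L i) with hm₁
  have r42 : m₁.reg 42 = L i := by simp [hm₁, Mem.setReg, Nat.mod_eq_of_lt hLw]
  have h1 : Valued t ψ L i m₁ :=
    ⟨h.consts.of_eq (by simp [hm₁, Mem.setReg]), h.calibrated.of_eq (by simp [hm₁, Mem.setReg]),
      h.arr12, by simp [hm₁, Mem.setReg, h.r47], by simp [hm₁, Mem.setReg, h.r1], h.vals⟩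
  have hsem : valueStep.sem w ψ m =
      ((Prog.ite 42 (estimate ⨾ search ⨾ record) skip).sem w ψ m₁).bind
        ((Prog.op .add 47 47 14).sem w ψ) := by
    simp only [valueStep, Prog.sem, PMF.pure_bind, h.arr12, h.r47, hm₁]
  rw [hsem]
  by_cases h0 : L i = 0
  · rw [if_neg (not_not.mpr h0), Prog.sem, if_neg (by rw [r42]; simpa using h0),
      sem_of_isDet w ψ skip rfl, PMF.pure_bind, sem_of_isDet w ψ _ rfl]
    refine PMF.ensures_pure ?_
    have hx : (Prog.op .add 47 47 14).exec w (skip.exec w m₁) =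
        (skip ⨾ Prog.op .add 47 47 14).exec w m₁ := rfl
    rw [hx]
    have hbad : ¬ IsBad ψ L i := fun hb => hb.1 h0
    refine ⟨h1.consts.exec w _ (by decide),
      h1.calibrated.of_eq fun r hr => exec_reg _ _ _ _ (by revert r; decide), h1.arr12, ?_, ?_, ?_⟩
    · simp [exec, skip, Mem.setReg, WordOp.eval, h1.r47, h1.consts.r14, Nat.mod_eq_of_lt hi1]
    · rw [exec_reg _ _ _ _ (by decide), h1.r1, badCount_succ_of_not_bad hbad]
    · intro p hp hpbad
      refine h1.vals p ?_ hpbad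
      rcases Nat.lt_succ_iff_lt_or_eq.mp hp with h' | h'
      · exact h'
      · rw [h'] at hpbad
        exact absurd hpbad hbad
  · rw [if_pos h0, Prog.sem, if_pos (by rw [r42]; exact h0), Prog.sem, PMF.bind_bind]
    have hest := estimate_ensures (ψ := ψ) h1.consts (by rw [r42]; exact hLw) hN
    rw [r42] at hest
    rw [← add_zero (ENNReal.ofReal _)]
    refine hest.bind fun m₂ hm₂ hR => ?_
    rw [sem_of_isDet w ψ (search ⨾ record) rfl, PMF.pure_bind, sem_of_isDet w ψ _ rfl]
    refine PMF.ensures_pure ?_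
    have hfr := (sem_frame _ _ _ _ _ hm₂).1
    have hfa : m₂.arr = m₁.arr := funext fun A =>
      (sem_frame _ _ _ _ _ hm₂).2 A (by simp [estimate, shotStep, warrs])
    have h2 : Valued t ψ L i m₂ := by
      refine ⟨h1.consts.sem hm₂ (by decide), h1.calibrated.sem hm₂ (by decide), ?_, ?_, ?_, ?_⟩
      · rw [hfa, h1.arr12]
      · rw [hfr 47 (by decide), h1.r47]
      · rw [hfr 1 (by decide), h1.r1]
      · rw [hfa]
        exact h1.vals
    exact exec_search_record hn ht hL hi h0 h2 (by rw [hfr 42 (by decide), r42]) hR.1 hR.2.1 hR.2.2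

theorem values_ensures {n t len : ℕ} {ψ : PureState n} {T : ℕ → Vec} {m : Mem} (hn : 1 ≤ n)
    (ht : ψ.IsArithmetic t) (hc : Consts n t m) (hcal : Calibrated n t m)
    (hL : CosetList n t T (2 * n) len (m.arr 12)) (h1 : m.reg 1 = 0) :
    (values.sem (64 * (n + t)) ψ m).Ensures (ENNReal.ofReal (2 * (2 : ℝ)⁻¹ ^ n))
      (Valued t ψ (m.arr 12) (4 ^ t)) := by
  classical
  set w := 64 * (n + t) with hw
  set m₁ := m.setReg w 47 0 with hm₁
  have c1 : Consts n t m₁ := hc.of_eq (by simp [hm₁, Mem.setReg])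
  have hsem : values.sem w ψ m = PMF.iter (valueStep.sem w ψ) (4 ^ t) m₁ := by
    have h16 : m₁.reg 16 = 4 ^ t := c1.r16
    simp only [values, Prog.sem, PMF.pure_bind, ← hm₁, h16]
  rw [hsem]
  have key := PMF.iter_ensures (f := valueStep.sem w ψ) (a := m₁) (N := 4 ^ t)
    (I := fun i => Valued t ψ (m.arr 12) i)
    (ε := fun i => if m.arr 12 i ≠ 0 then ENNReal.ofReal (2 * Real.exp (-(4 * n))) else 0)
    ⟨c1, hcal.of_eq (by simp [hm₁, Mem.setReg]), rfl, by simp [hm₁, Mem.setReg],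
      by simp [hm₁, Mem.setReg, h1, badCount], fun p hp => absurd hp (by omega)⟩
    (fun i hi b hb => valueStep_ensures hn ht hL.lt hi hb)
  refine key.mono ?_ fun _ _ h => h
  rw [← Finset.sum_filter, Finset.sum_const, nsmul_eq_mul]
  -- The non-zero entries are distinct words of `2n` bits, so the union bound does not depend on
  -- `t`.
  have hcard : ((Finset.range (4 ^ t)).filter fun i => m.arr 12 i ≠ 0).card ≤ 4 ^ n := by
    have h4 : 4 ^ n = (Finset.range (2 ^ (2 * n))).card := by
      rw [Finset.card_range, pow_mul]
      norm_num
    rw [h4]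
    refine Finset.card_le_card_of_injOn (m.arr 12) (fun i _ => ?_) ?_
    · simpa using hL.lt i
    · intro i hi j hj heq
      have hne : ∀ k, k ∈ (Finset.range (4 ^ t)).filter (fun i => m.arr 12 i ≠ 0) → k < len := by
        intro k hk
        by_contra hk'
        exact (Finset.mem_filter.mp hk).2 (hL.zero k (by omega))
      exact hL.inj i (hne i hi) j (hne j hj) heq
  calc _ ≤ ENNReal.ofReal ((4 : ℝ) ^ n) * ENNReal.ofReal (2 * Real.exp (-(4 * n))) := by
        gcongr
        rw [← ENNReal.ofReal_natCast]
        apply ENNReal.ofReal_le_ofReal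
        exact_mod_cast hcard
    _ = ENNReal.ofReal ((4 : ℝ) ^ n * (2 * Real.exp (-(4 * n)))) :=
        (ENNReal.ofReal_mul (by positivity)).symm
    _ ≤ _ := by
        apply ENNReal.ofReal_le_ofReal
        have he : Real.exp (-(4 * n)) ≤ (8 : ℝ)⁻¹ ^ n := by
          have h2 : (2 : ℝ) ≤ Real.exp 1 := by
            have := Real.add_one_le_exp 1
            linarith
          have h8 : (8 : ℝ) ≤ Real.exp 4 := by
            calc (8 : ℝ) ≤ 2 ^ 4 := by norm_num
              _ ≤ Real.exp 1 ^ 4 := by gcongr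
              _ = Real.exp 4 := by rw [← Real.exp_nat_mul]; norm_num
          rw [Real.exp_neg, mul_comm, Real.exp_nat_mul, inv_pow]
          gcongr
        calc (4 : ℝ) ^ n * (2 * Real.exp (-(4 * n))) ≤ 4 ^ n * (2 * (8 : ℝ)⁻¹ ^ n) := by gcongr
          _ = 2 * (4 * (8 : ℝ)⁻¹) ^ n := by rw [mul_pow]; ring
          _ = 2 * (2 : ℝ)⁻¹ ^ n := by norm_num

end Learn
end

noncomputable section

/-! ## The main theorem -/

/-- Output cells are numbered by `Nat.count`; this recovers from a cell the table or list entry it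
belongs to. -/
theorem exists_count_eq_of_lt {p : ℕ → Prop} [DecidablePred p] {k N : ℕ} (h : k < Nat.count p N) :
    ∃ i < N, p i ∧ Nat.count p i = k := by
  induction N with
  | zero => simp at h
  | succ N ih =>
    by_cases hk : k < Nat.count p N
    · obtain ⟨i, hi, h1, h2⟩ := ih hk
      exact ⟨i, by omega, h1, h2⟩
    · rw [Nat.count_succ] at h
      split_ifs at h with hp
      · exact ⟨N, by omega, hp, by omega⟩
      · omega

namespace Learn

open Prog

/-- The description in the memory. -/
def readOut (n t : ℕ) (m : Mem) : Description n := RAM.output n t ⟨m.reg, m.arr, 0, 0, 0⟩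

open Classical in
theorem readOut_isExact {n t len : ℕ} {ψ : PureState n} {T L : ℕ → ℕ} {m : Mem}
    (hst : IsStabTable ψ (tableOf T)) (h0 : m.reg 0 = freeCount T (2 * n))
    (hgens : ∀ p < 2 * n, T p = 0 →
      decodePauli n (m.arr 0 (freeCount T p)) (m.arr 1 (freeCount T p)) =
        toPauli n (dualTable (2 * n) (tableOf T) p) ∧
      ψ.expect (toPauli n (dualTable (2 * n) (tableOf T) p)) =
        if m.arr 2 (freeCount T p) = 0 then 1 else -1)
    (hL : CosetList n t (tableOf T) (2 * n) len L) (hval : Valued t ψ L (4 ^ t) m) :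
    (readOut n t m).IsExact ψ := by
  have hgen : ∀ j : Fin (readOut n t m).m, ∃ p < 2 * n, T p = 0 ∧ freeCount T p = j := by
    intro j
    have hj : (j : ℕ) < freeCount T (2 * n) := by
      rw [← h0]
      exact j.2
    exact exists_count_eq_of_lt hj
  have hbad : ∀ j : Fin (readOut n t m).k, ∃ p < 4 ^ t, IsBad ψ L p ∧ badCount ψ L p = j := by
    intro j
    have hj : (j : ℕ) < badCount ψ L (4 ^ t) := by
      rw [← hval.r1]
      exact j.2
    exact exists_count_eq_of_lt hj
  have hh : ∀ (j : Fin (readOut n t m).k) (p : ℕ), p < 4 ^ t → IsBad ψ L p →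
      badCount ψ L p = j → (readOut n t m).h j = toPauli n (bits (L p)) := by
    intro j p hp hb hj
    obtain ⟨h3, h4, -⟩ := hval.vals p hp hb
    rw [hj] at h3 h4
    change decodePauli n (m.arr 3 j) (m.arr 4 j) = _
    rw [h3, h4, decodePauli_eq]
  have hlt : ∀ p, L p ≠ 0 → p < len := by
    intro p hp
    by_contra hp'
    exact hp (hL.zero p (by omega))
  have hshort : ∀ i, Short (2 * n) (bits (L i)) := fun i => short_bits_iff.mpr (hL.lt i)
  refine hst.isExact (readOut n t m) (4 ^ t) (fun i => bits (L i)) ?_ ?_ ?_ ?_ (fun i _ => hshort i)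
    ?_ ?_ ?_ ?_ ?_ ?_
  · intro j
    obtain ⟨p, hp, hp0, hj⟩ := hgen j
    refine ⟨p, hp, tableOf_eq_zero_iff.mpr hp0, ?_⟩
    rw [← (hgens p hp hp0).1, hj]
    rfl
  · intro p hp hp0
    have hp0' := tableOf_eq_zero_iff.mp hp0
    have hlt' : freeCount T p < m.reg 0 := by
      rw [h0]
      exact freeCount_lt hp0' hp
    exact ⟨⟨freeCount T p, hlt'⟩, (hgens p hp hp0').1⟩
  · change m.reg 0 = _
    rw [h0, freeCount, Nat.count_eq_card_filter_range, IsStabTable.freeSet]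
    simp only [tableOf_eq_zero_iff]
  · intro j
    obtain ⟨p, hp, hp0, hj⟩ := hgen j
    obtain ⟨h1, h2⟩ := hgens p hp hp0
    rw [hj] at h1 h2
    change ψ.expect (decodePauli n (m.arr 0 j) (m.arr 1 j)) = if m.arr 2 j = 0 then 1 else -1
    rw [h1, h2]
  · intro i _ f hf hf0
    by_cases hi : i < len
    · obtain ⟨c, hc⟩ := hL.exists_combo i hi
      rw [hc]
      exact IsStabTable.combo_vanish _ _ hf hf0
    · rw [hL.zero i (by omega), bits_zero]
      rfl
  · intro c
    obtain ⟨j, hj, hc⟩ := hL.span c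
    exact ⟨j, hj.trans_le hL.le, hc⟩
  · intro j
    obtain ⟨p, hp, hb, hj⟩ := hbad j
    have hhj := hh j p hp hb hj
    exact ⟨p, hp, fun h' => hb.1 (bits_eq_zero_iff.mp h'), hhj, by rw [hhj]; exact hb.2⟩
  · intro i hi hi0 hex
    have hb : IsBad ψ L i := ⟨fun h' => hi0 (bits_eq_zero_iff.mpr h'), hex⟩
    have hlt' : badCount ψ L i < m.reg 1 := by
      rw [hval.r1]
      exact badCount_lt hb hi
    exact ⟨⟨badCount ψ L i, hlt'⟩, hh _ i hi hb rfl⟩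
  · intro j j' heq
    obtain ⟨p, hp, hb, hj⟩ := hbad j
    obtain ⟨p', hp', hb', hj'⟩ := hbad j'
    rw [hh j p hp hb hj, hh j' p' hp' hb' hj'] at heq
    have h1 := bits_injective (toPauli_injOn (hshort p) (hshort p') heq)
    have h2 := hL.inj p (hlt p hb.1) p' (hlt p' hb'.1) h1
    apply Fin.ext
    rw [← hj, ← hj', h2]
  · intro j
    obtain ⟨p, hp, hb, hj⟩ := hbad j
    rw [hh j p hp hb hj, ← (hval.vals p hp hb).2.2, hj]
    rfl

/-- What is known after the sampling. -/
structure Prepared {n : ℕ} (t : ℕ) (ψ : PureState n) (m : Mem) : Prop where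
  consts : Consts n t m
  calibrated : Calibrated n t m
  table : TableOK (2 * n) (m.arr 10)
  stab : IsStabTable ψ (tableOf (m.arr 10))
  r0 : m.reg 0 = 0
  r1 : m.reg 1 = 0
  arr11 : m.arr 11 = fun _ => 0
  arr12 : m.arr 12 = fun _ => 0

theorem preparation_ensures {n t : ℕ} {ψ : PureState n} (hn : 1 ≤ n) (ht : ψ.IsArithmetic t) :
    ((setup ⨾ approx ⨾ thresholds ⨾ sampling).sem (64 * (n + t)) ψ (RAM.init n t).mem).Ensures
      (ENNReal.ofReal ((2 : ℝ)⁻¹ ^ n)) (Prepared t ψ) := by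
  set w := 64 * (n + t) with hw
  obtain ⟨c1, s0, s1, sa⟩ := exec_setup (t := t) hn
  rw [← hw] at c1 s0 s1 sa
  set m₁ := setup.exec w (RAM.init n t).mem with hm₁
  have happ := exec_approx hn c1
  have c2 : Consts n t (approx.exec w m₁) := c1.exec w _ (by decide)
  have hcal := exec_thresholds hn c2 happ
  rw [← hw] at hcal
  have c3 : Consts n t (thresholds.exec w (approx.exec w m₁)) := c2.exec w _ (by decide)
  set m₃ := thresholds.exec w (approx.exec w m₁) with hm₃
  have hsem : (setup ⨾ approx ⨾ thresholds ⨾ sampling).sem w ψ (RAM.init n t).mem =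
      sampling.sem w ψ m₃ := by
    simp only [Prog.sem.eq_7, sem_of_isDet w ψ setup rfl, sem_of_isDet w ψ approx rfl,
      sem_of_isDet w ψ thresholds rfl, PMF.pure_bind, hm₁, hm₃]
  have ha : m₃.arr = fun _ _ => 0 := by
    rw [← sa]
    funext A
    rw [hm₃, exec_arr _ _ _ _ (by simp [thresholds, warrs]),
      exec_arr _ _ _ _ (by simp [approx, pellStep, scaleStep, warrs])]
  have r0 : m₃.reg 0 = 0 := by
    rw [hm₃, exec_reg _ _ _ _ (by decide), exec_reg _ _ _ _ (by decide), s0]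
  have r1 : m₃.reg 1 = 0 := by
    rw [hm₃, exec_reg _ _ _ _ (by decide), exec_reg _ _ _ _ (by decide), s1]
  have htab : tableOf (m₃.arr 10) = fun _ => 0 := by
    funext p
    rw [ha]
    exact bits_zero
  have hsam : Sampled t ψ m₃ := by
    refine ⟨c3, ⟨?_, ?_, ?_⟩, ?_⟩
    · rw [htab]
      intro p p' h
      exact absurd rfl h
    · intro p
      rw [ha]
      positivity
    · intro p _
      rw [ha]
    · intro g _ p _
      rw [htab]
      exact dot_zero_left _ _
  rw [hsem]
  refine (sampling_ensures ht (by omega) hsam).mono le_rfl ?_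
  rintro m' hm' ⟨hc, hT, hst⟩
  obtain ⟨fr, fa⟩ := sem_frame _ _ _ _ _ hm'
  refine ⟨hc, hcal.sem hm' (by decide), hT, hst, ?_, ?_, ?_, ?_⟩
  · rw [fr 0 (by decide), r0]
  · rw [fr 1 (by decide), r1]
  · rw [fa 11 (by decide), ha]
  · rw [fa 12 (by decide), ha]

theorem readOut_ensures {n t : ℕ} {ψ : PureState n} (hn : 1 ≤ n) (ht : ψ.IsArithmetic t) {m : Mem}
    (h : Prepared t ψ m) :
    ((generators ⨾ cosets ⨾ values).sem (64 * (n + t)) ψ m).Ensures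
      (ENNReal.ofReal (2 * (2 : ℝ)⁻¹ ^ n)) fun m' => (readOut n t m').IsExact ψ := by
  set w := 64 * (n + t) with hw
  have hwt : 2 * 4 ^ t < 2 ^ w := pow_lt_word _ (a := 2 * t + 1) (by
    rw [pow_succ', pow_mul]
    norm_num) (by omega)
  rw [Prog.sem, ← zero_add (ENNReal.ofReal _)]
  refine PMF.Ensures.bind (PMF.ensures_zero_iff.mpr (generators_support (by omega) h.consts h.table
    h.stab h.r0 h.arr11)) fun m₁ hm₁ hgen => ?_
  obtain ⟨fr, fa⟩ := sem_frame _ _ _ _ _ hm₁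
  have e10 : m₁.arr 10 = m.arr 10 := hgen.arr10
  have hUd : tableOf (m₁.arr 11) = dualTable (2 * n) (tableOf (m₁.arr 10)) := by
    funext p
    rw [tableOf, hgen.arr11 p, e10]
    split_ifs with hp
    · rfl
    · by_contra h'
      exact hp (dualTable_ne_zero_iff.mp (Ne.symm h')).1
  rw [Prog.sem, sem_of_isDet w ψ cosets rfl, PMF.pure_bind]
  obtain ⟨len, hL⟩ := exec_cosets (w := w) (by omega) hwt ht hgen.consts (by rw [e10]; exact h.table)
    (by rw [e10]; exact h.stab) hUd (by rw [fa 12 (by decide), h.arr12])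
  have hcal : Calibrated n t m₁ := h.calibrated.sem hm₁ (by decide)
  have hr1 : m₁.reg 1 = 0 := by rw [fr 1 (by decide), h.r1]
  refine (values_ensures hn ht (hgen.consts.exec w _ (by decide))
    (hcal.of_eq fun r hr => exec_reg _ _ _ _ (by revert r; decide)) hL
    (by rw [exec_reg _ _ _ _ (by decide), hr1])).mono le_rfl ?_
  intro m₃ hm₃ hval
  obtain ⟨fr', fa'⟩ := sem_frame _ _ _ _ _ hm₃
  rw [e10] at hL
  refine readOut_isExact h.stab ?_ ?_ hL hval
  · rw [fr' 0 (by decide), exec_reg _ _ _ _ (by decide), hgen.r0]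
  · rw [fa' 0 (by decide), fa' 1 (by decide), fa' 2 (by decide),
      exec_arr _ _ _ 0 (by decide), exec_arr _ _ _ 1 (by decide), exec_arr _ _ _ 2 (by decide)]
    exact hgen.gens

theorem algorithm_ensures {n t : ℕ} {ψ : PureState n} (hn : 1 ≤ n) (ht : ψ.IsArithmetic t) :
    (algorithm.run (64 * (n + t)) ψ (RAM.init n t)).Ensures
      (ENNReal.ofReal (3 * (2 : ℝ)⁻¹ ^ n)) fun s => (s.output n t).IsExact ψ := by
  have hsem : algorithm.sem (64 * (n + t)) ψ (RAM.init n t).mem =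
      ((setup ⨾ approx ⨾ thresholds ⨾ sampling).sem (64 * (n + t)) ψ (RAM.init n t).mem).bind
        ((generators ⨾ cosets ⨾ values).sem (64 * (n + t)) ψ) := by
    simp only [algorithm, body, Prog.sem.eq_7, PMF.bind_bind]
    rfl
  have h := (preparation_ensures hn ht).bind fun m _ hm => readOut_ensures hn ht hm
  rw [← hsem, ← map_mem_run, ← ENNReal.ofReal_add (by positivity) (by positivity)] at h
  refine (PMF.toOuterMeasure_map_le h).mono (le_of_eq ?_) fun s _ hs => hs
  congr 1
  ring

end Learn
end

theorem mainTheorem1 :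
    ∃ (alg : Prog) (K C : ℕ), ∀ (n t : ℕ), 1 ≤ n → ∀ ψ : PureState n, ψ.IsDoped t →
      (∀ s ∈ (alg.run (K * (n + t)) ψ (RAM.init n t)).support,
        s.samples ≤ C * (2 ^ t * n + t * 2 ^ (5 * t)) ∧
        s.shots ≤ C * (2 ^ (7 * t) + 2 ^ (4 * t) * n * (n + t)) ∧
        s.steps ≤ C * (4 ^ (2 * t) * n ^ 2)) ∧
      (alg.run (K * (n + t)) ψ (RAM.init n t)).toOuterMeasure
          {s | ¬ (s.output n t).IsExact ψ} ≤
        ENNReal.ofReal ((C : ℝ) * n * (2 : ℝ)⁻¹ ^ n) := by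
  -- The largest intermediate numbers in the comparisons stay below `2^(6t+n+32)`, so words of
  -- `64(n+t)` bits suffice. The constant `50000` covers `24 + 40000` steps, `2 + 16384` for the
  -- shots, `16` for the samples and the factor `3` of the failure probability. The summands
  -- `t·2^{5t}` and `2^{7t}` of the bounds are slack.
  refine ⟨Learn.algorithm, 64, 50000, fun n t hn ψ hψ => ⟨fun s hs => ?_, ?_⟩⟩
  · obtain ⟨h1, h2, h3⟩ := Learn.algorithm_resources hn ψ s hs
    refine ⟨?_, ?_, ?_⟩
    · nlinarith [Nat.zero_le (t * 2 ^ (5 * t))]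
    · have h16 : 4 ^ t * (16384 * (4 ^ t * n)) = 16384 * (2 ^ (4 * t) * n) := by
        have : 2 ^ (4 * t) = 4 ^ t * 4 ^ t := by
          rw [← mul_pow, pow_mul]
          norm_num
        rw [this]
        ring
      rw [h16] at h2
      have h5 : 2 ^ (4 * t) * n ≤ 2 ^ (4 * t) * n * (n + t) := Nat.le_mul_of_pos_right _ (by omega)
      have h6 : n ≤ 2 ^ (4 * t) * n := Nat.le_mul_of_pos_left _ (by positivity)
      linarith [Nat.zero_le (2 ^ (7 * t))]
    · have h4 : 1 ≤ 4 ^ (2 * t) * n ^ 2 := Nat.mul_pos (by positivity) (by positivity)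
      omega
  · refine (Learn.algorithm_ensures hn hψ.isArithmetic).trans (ENNReal.ofReal_le_ofReal ?_)
    have hn' : (1 : ℝ) ≤ n := by exact_mod_cast hn
    gcongr
    push_cast
    linarith
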